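/- Let $a>0$, $\gamma>1$, $L>0$, $P>0$, $\underline\rho>0$, put $\underline c=\sqrt{a\gamma}\,\underline\rho^{(\gamma-1)/2}$ and let $\underline u>\underline c$. Let $\alpha\in C^2(\mathbb R)$ be $P$-periodic with $\int_0^t\alpha(s)\,ds\ge 0$ for all $t\ge 0$ and $\int_0^P\alpha(s)\,ds=0$. Put $$r_\alpha(t)=\tfrac12 e^{\int_0^t\alpha}\,\underline u-\tfrac{1}{\gamma-1}\underline c,\qquad s_\alpha(t)=\tfrac12 e^{\int_0^t\alpha}\,\underline u+\tfrac{1}{\gamma-1}\underline c .$$ For $m=(m_1,m_2)^T$ write $r=r_\alpha+m_1$, $s=s_\alpha+m_2$, $u=r+s$, $c=\frac{\gamma-1}{2}(s-r)$, $\lambda_1=u-c$, $\lambda_2=u+c$ and $\Lambda=\mathrm{diag}(1/\lambda_1,1/\lambda_2)$. For $T_1>0$ and a function $m_0:[0,T_1]\to\mathbb R^2$ (the boundary perturbation $m_0=(r_l-r_\alpha,\,s_l-s_\alpha)^T$ of the inflow Riemann invariants $r_l,s_l$), consider on $(t,x)\in[0,T_1]\times[0,L]$ the initial-boundary value problem $$(\mathrm{PIB1})\qquad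 m_x+\Lambda m_t=\frac{\alpha(t)}{2}\,\Lambda\begin{pmatrix}m_1+m_2\\ m_1+m_2\end{pmatrix},\qquad m(t,0)=m_0(t),\qquad m(0,x)=0,$$ where a solution is understood to have $\lambda_1,\lambda_2\neq0$ on $[0,T_1]\times[0,L]$. **Theorem 4.2.** For every $T_0>0$ there exist $\varepsilon_1>0$, $C_1>0$ and $T_1>T_0$ such that the following holds for every $\varepsilon\in(0,\varepsilon_1)$. If $m_0\in H^2([0,T_1])$ satisfies the compatibility conditions $m_0(0)=0$ and $m_0'(0)=0$, and $\|m_0\|_{H^2([0,T_1])}\le\varepsilon$, then (PIB1) has a unique solution $m\in C([0,L];H^2([0,T_1]))\cap C^1([0,L];H^1([0,T_1]))$, and this solution satisfies $$\sup_{x\in[0,L]}\|m\|_{H^2([0,T_1])}+\sup_{x\in[0,L]}\|m_x\|_{H^1([0,T_1])}\le C_1\varepsilon .$$ -/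

import Mathlib

open MeasureTheory Set
open scoped ContDiff

namespace SupersonicDuct

/-- The values of `m = (m₁, m₂)`: the Euclidean plane. -/
abbrev State : Type := EuclideanSpace ℝ (Fin 2)

/-- Lebesgue measure on the time interval `(0, T)`. -/
noncomputable abbrev timeMeasure (T : ℝ) : Measure ℝ := volume.restrict (Ioo 0 T)

/-- `L²((0, T); ℝ²)`. -/
abbrev L2 (T : ℝ) : Type := Lp State 2 (timeMeasure T)

/-- Smooth real functions with compact support contained in `(0, T)`. -/
def IsTest (T : ℝ) (φ : ℝ → ℝ) : Prop :=
  ContDiff ℝ ∞ φ ∧ HasCompactSupport φ ∧ tsupport φ ⊆ Ioo 0 T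

/-- `g` is the weak derivative of `f` on `(0, T)`. -/
def IsWeakDeriv {T : ℝ} (f g : L2 T) : Prop :=
  ∀ φ : ℝ → ℝ, IsTest T φ →
    ∫ t, deriv φ t • f t ∂(timeMeasure T) = -∫ t, φ t • g t ∂(timeMeasure T)

theorem integrable_smul_L2 {T : ℝ} {ψ : ℝ → ℝ} (hψ : Continuous ψ) (hc : HasCompactSupport ψ)
    (f : L2 T) : Integrable (fun t => ψ t • f t) (timeMeasure T) := by
  have hf : Integrable (f : ℝ → State) (timeMeasure T) :=
    (Lp.memLp f).integrable (by norm_num)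
  obtain ⟨C, hC⟩ := hc.exists_bound_of_continuous hψ
  exact hf.bdd_smul C hψ.aestronglyMeasurable (Filter.Eventually.of_forall hC)

theorem IsTest.integrable {T : ℝ} {φ : ℝ → ℝ} (h : IsTest T φ) (f : L2 T) :
    Integrable (fun t => φ t • f t) (timeMeasure T) :=
  integrable_smul_L2 h.1.continuous h.2.1 f

theorem IsTest.integrable_deriv {T : ℝ} {φ : ℝ → ℝ} (h : IsTest T φ) (f : L2 T) :
    Integrable (fun t => deriv φ t • f t) (timeMeasure T) :=
  integrable_smul_L2 (h.1.continuous_deriv (by norm_num)) h.2.1.deriv f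

theorem IsWeakDeriv.zero {T : ℝ} : IsWeakDeriv (0 : L2 T) 0 := by
  intro φ _
  have h0 : ((0 : L2 T) : ℝ → State) =ᵐ[timeMeasure T] 0 := Lp.coeFn_zero _ _ _
  have h1 : ∀ ψ : ℝ → ℝ, ∫ t, ψ t • ((0 : L2 T) : ℝ → State) t ∂(timeMeasure T) = 0 := by
    intro ψ
    refine integral_eq_zero_of_ae ?_
    filter_upwards [h0] with t ht
    simp only [ht, Pi.zero_apply, smul_zero]
  rw [h1, h1, neg_zero]

theorem integral_smul_add {T : ℝ} {ψ : ℝ → ℝ} (f g : L2 T)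
    (hf : Integrable (fun t => ψ t • f t) (timeMeasure T))
    (hg : Integrable (fun t => ψ t • g t) (timeMeasure T)) :
    ∫ t, ψ t • ((f + g : L2 T) : ℝ → State) t ∂(timeMeasure T) =
      ∫ t, ψ t • f t ∂(timeMeasure T) + ∫ t, ψ t • g t ∂(timeMeasure T) := by
  rw [← integral_add hf hg]
  refine integral_congr_ae ?_
  filter_upwards [Lp.coeFn_add f g] with t ht
  simp only [ht, Pi.add_apply, smul_add]

theorem integral_smul_smul {T : ℝ} {ψ : ℝ → ℝ} (c : ℝ) (f : L2 T) :
    ∫ t, ψ t • ((c • f : L2 T) : ℝ → State) t ∂(timeMeasure T) = c • ∫ t, ψ t • f t ∂(timeMeasure T) := by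
  rw [← integral_smul]
  refine integral_congr_ae ?_
  filter_upwards [Lp.coeFn_smul c f] with t ht
  simp only [ht, Pi.smul_apply]
  rw [smul_comm]

theorem IsWeakDeriv.add {T : ℝ} {f g f' g' : L2 T} (h : IsWeakDeriv f g)
    (h' : IsWeakDeriv f' g') : IsWeakDeriv (f + f') (g + g') := by
  intro φ hφ
  rw [integral_smul_add _ _ (hφ.integrable_deriv f) (hφ.integrable_deriv f'),
    integral_smul_add _ _ (hφ.integrable g) (hφ.integrable g'), h φ hφ, h' φ hφ, neg_add]

theorem IsWeakDeriv.smul {T : ℝ} {f g : L2 T} (c : ℝ) (h : IsWeakDeriv f g) :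
    IsWeakDeriv (c • f) (c • g) := by
  intro φ hφ
  rw [integral_smul_smul, integral_smul_smul, h φ hφ, smul_neg]

/-- The Sobolev space `Hᵏ((0, T); ℝ²)`. An element is an `L²` function `f 0` together with its weak
derivatives `f 1, …, f k`, which are uniquely determined by `f 0`; the norm, inherited from the
`ℓ²` sum of `k + 1` copies of `L²`, is `(∑_{i ≤ k} ‖∂ₜⁱ f‖²_{L²})^{1/2}`. -/
def Sobolev (k : ℕ) (T : ℝ) : Submodule ℝ (PiLp 2 (fun _ : Fin (k + 1) => L2 T)) where
  carrier := {f | ∀ i : Fin k, IsWeakDeriv (f i.castSucc) (f i.succ)}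
  zero_mem' := fun _ => IsWeakDeriv.zero
  add_mem' := fun ha hb i => (ha i).add (hb i)
  smul_mem' := fun c _ ha i => (ha i).smul c

/-- The `i`-th weak time derivative of `f ∈ Hᵏ`. -/
def wderiv {k : ℕ} {T : ℝ} (f : Sobolev k T) (i : Fin (k + 1)) : L2 T := f.1 i

/-- The inclusion of `H²` in `H¹`. -/
def toH1 {T : ℝ} (f : Sobolev 2 T) : Sobolev 1 T :=
  ⟨WithLp.toLp 2 fun i => wderiv f i.castSucc, fun i => f.2 i.castSucc⟩

/-- `g` is the continuous representative on `[0, T]` of the `L²` class `f`. -/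
def IsContRep {T : ℝ} (f : L2 T) (g : ℝ → State) : Prop :=
  ContinuousOn g (Icc 0 T) ∧ f =ᵐ[timeMeasure T] g

/-- `f` has a continuous representative on `[0, T]`, and this vanishes at `t = 0`. -/
def VanishesAtZero {T : ℝ} (f : L2 T) : Prop :=
  ∃ g : ℝ → State, IsContRep f g ∧ g 0 = 0

/-- The constants of the problem, for the pressure law `p = a ρ^γ` in a duct of length `L`:
`ρb`, `ub` are the background density and velocity, `α` the coefficient of the external force
and `P` its period. -/
structure Duct where
  a : ℝ
  γ : ℝ
  ρb : ℝ
  ub : ℝ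
  L : ℝ
  P : ℝ
  α : ℝ → ℝ

namespace Duct

variable (d : Duct)

/-- The background sound speed `√(aγ) ρb^((γ-1)/2)`. -/
noncomputable def cb : ℝ := Real.sqrt (d.a * d.γ) * d.ρb ^ ((d.γ - 1) / 2)

/-- The standing assumptions: a polytropic gas, a supersonic background state, and a `C²`,
`P`-periodic force coefficient with nonnegative primitive and zero mean. -/
structure Admissible : Prop where
  a_pos : 0 < d.a
  one_lt_γ : 1 < d.γ
  ρb_pos : 0 < d.ρb
  supersonic : d.cb < d.ub
  L_pos : 0 < d.L
  P_pos : 0 < d.P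
  α_smooth : ContDiff ℝ 2 d.α
  α_periodic : Function.Periodic d.α d.P
  α_primitive : ∀ t : ℝ, 0 ≤ t → 0 ≤ ∫ s in (0 : ℝ)..t, d.α s
  α_mean : ∫ s in (0 : ℝ)..d.P, d.α s = 0

/-- The background velocity `exp (∫₀ᵗ α) ub`. -/
noncomputable def uα (t : ℝ) : ℝ := Real.exp (∫ s in (0 : ℝ)..t, d.α s) * d.ub

/-- The background Riemann invariant `r_α`. -/
noncomputable def rα (t : ℝ) : ℝ := 1 / 2 * d.uα t - 1 / (d.γ - 1) * d.cb

/-- The background Riemann invariant `s_α`. -/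
noncomputable def sα (t : ℝ) : ℝ := 1 / 2 * d.uα t + 1 / (d.γ - 1) * d.cb

/-- The velocity `u` in terms of the Riemann invariants
`r = (u - 2c/(γ-1))/2`, `s = (u + 2c/(γ-1))/2`. -/
def velocity (r s : ℝ) : ℝ := r + s

/-- The sound speed `c` in terms of the Riemann invariants. -/
noncomputable def soundSpeed (r s : ℝ) : ℝ := (d.γ - 1) / 2 * (s - r)

/-- The characteristic speeds `λ₁ = u - c` and `λ₂ = u + c`. -/
noncomputable def charSpeed (r s : ℝ) : Fin 2 → ℝ :=
  ![velocity r s - d.soundSpeed r s, velocity r s + d.soundSpeed r s]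

/-- The characteristic speeds at time `t` when `(r, s) = (r_α(t), s_α(t)) + m`. -/
noncomputable def speed (t : ℝ) (m : State) : Fin 2 → ℝ :=
  d.charSpeed (d.rα t + m 0) (d.sα t + m 1)

/-- The matrix `Λ = diag (1/λ₁, 1/λ₂)`. -/
noncomputable def Lam (t : ℝ) (m : State) : Matrix (Fin 2) (Fin 2) ℝ :=
  Matrix.diagonal fun i => 1 / d.speed t m i

/-- `m ∈ C([0, L]; H²(0, T)) ∩ C¹([0, L]; H¹(0, T))` solves
`m_x + Λ m_t = (α / 2) Λ (m₁ + m₂, m₁ + m₂)ᵀ` on `[0, T] × [0, L]`, `m(t, 0) = m₀(t)`,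
`m(0, x) = 0`. A function `m(t, x)` is regarded as a map from `x` to functions of `t`; its values
outside `[0, L]` are irrelevant. -/
structure IsSolution {T : ℝ} (m₀ : Sobolev 2 T) (m : ℝ → Sobolev 2 T) : Prop where
  continuousOn : ContinuousOn m (Icc 0 d.L)
  contDiffOn : ContDiffOn ℝ 1 (fun x => toH1 (m x)) (Icc 0 d.L)
  /-- `Λ` is defined, i.e. the characteristic speeds do not vanish on `[0, T] × [0, L]`. -/
  speed_ne_zero : ∀ x ∈ Icc 0 d.L, ∃ g : ℝ → State, IsContRep (wderiv (m x) 0) g ∧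
    ∀ t ∈ Icc 0 T, ∀ i, d.speed t (g t) i ≠ 0
  equation : ∀ x ∈ Icc 0 d.L, ∀ᵐ t ∂(timeMeasure T),
    (wderiv (derivWithin (fun y => toH1 (m y)) (Icc 0 d.L) x) 0 t).ofLp
        + (d.Lam t (wderiv (m x) 0 t)).mulVec (wderiv (m x) 1 t).ofLp
      = (d.α t / 2) • (d.Lam t (wderiv (m x) 0 t)).mulVec
          ![wderiv (m x) 0 t 0 + wderiv (m x) 0 t 1, wderiv (m x) 0 t 0 + wderiv (m x) 0 t 1]
  boundary : m 0 = m₀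
  initial : ∀ x ∈ Icc 0 d.L, VanishesAtZero (wderiv (m x) 0)

end Duct

end SupersonicDuct

/-! Take x as the evolution variable. On [0, T] the background speeds are at least ub − cb > 0, so
with a = 1/λ and β = α/2 the system ∂ₓm = a (β (m₁ + m₂) − ∂ₜm) transports both components towards
increasing t, and t = 0 is an inflow boundary carrying zero data. By compatibility m₀ and ∂ₜm₀
vanish there, so a solution can be sought as m = J²h with h = ∂ₜ²m, where J (`volterra`) is
integration from 0. This leads to the evolution equation ∂ₓh = G(h) − a ∂ₜh in L²(0, T)², where G
contains no third derivative of m.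

The derivative with zero initial value is J⁻¹; it is replaced by its Yosida approximation (δ + J)⁻¹
(`yosida`). The equation becomes an ODE whose field is Lipschitz on balls. Integration by parts
gives 2⟨a (δ + J)⁻¹h, h⟩ ≥ −‖∂ₜa‖ ‖h‖² uniformly in δ (`inner_smul_yosida_ge`), the boundary term at
T having the good sign because a ≥ 0. Together with G(0) = 0 and Grönwall, small data stay up to x =
L in a ball on which the speeds exceed κ (`exists_isApprox`).

The problem is quasilinear, so differences of approximations are estimated two derivatives lower: J²
of the difference is O(δ + δ') (`exists_volterra_sub_le`). The lost derivatives are recovered from a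
uniform regularity statement: h − (1 + ρ∂ₜ)⁻¹h tends to 0 with ρ, uniformly in x and δ
(`exists_defect_le`), because this operator commutes with coefficients and transport up to
controlled errors. `norm_le_defect_add` interpolates between the two facts, and the approximations
converge in L² uniformly in x. Hence m is continuous in x with values in H², and the limit of the
integrated equation for ∂ₜm makes it C¹ with values in H¹ (`exists_solution`).

The du Bois-Reymond lemma (`exists_eq_add_volterra`) translates between weak derivatives and
primitives. Uniqueness is the L² energy estimate for the difference of two solutions
(`exists_inner_sub_le`); it needs positive speeds, which an arbitrary solution has because they do
not vanish and are positive at t = 0. All this works for every T > 0, with a smallness threshold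
depending on T. -/

namespace SupersonicDuct

/-! ### Multiplication of L² functions by bounded continuous functions -/

/-- Real-valued `L²` functions on `(0, T)`. -/
abbrev ScalarL2 (T : ℝ) : Type := Lp ℝ 2 (timeMeasure T)

/-- Bounded continuous real functions. -/
abbrev BC : Type := BoundedContinuousFunction ℝ ℝ

variable {T : ℝ}

/-- The inclusion of bounded continuous functions in `L²(0, T)`. -/
noncomputable def emb (T : ℝ) : BC →L[ℝ] ScalarL2 T :=
  BoundedContinuousFunction.toLp 2 (timeMeasure T) ℝ

theorem coeFn_emb (f : BC) : emb T f =ᵐ[timeMeasure T] f :=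
  BoundedContinuousFunction.coeFn_toLp (p := 2) (timeMeasure T) ℝ f

theorem denseRange_emb : DenseRange (emb T) :=
  BoundedContinuousFunction.toLp_denseRange ℝ (timeMeasure T) ℝ (by norm_num)

theorem integrable_scalar (h : ScalarL2 T) : Integrable h (timeMeasure T) :=
  (Lp.memLp h).integrable (by norm_num)

theorem memLp_bc_mul (f : BC) (h : ScalarL2 T) :
    MemLp (fun t => f t * h t) 2 (timeMeasure T) :=
  (Lp.memLp h).of_le_mul (c := ‖f‖)
    (f.continuous.aestronglyMeasurable.mul (Lp.aestronglyMeasurable h))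
    (Filter.Eventually.of_forall fun t => by
      rw [norm_mul]; exact mul_le_mul_of_nonneg_right (f.norm_coe_le_norm t) (norm_nonneg _))

/-- Coefficients act on L² as scalars of a module, so that identities between products can be
normalized by `module`, and `IsBoundedSMul` supplies continuity. -/
noncomputable instance : SMul BC (ScalarL2 T) := ⟨fun f h => (memLp_bc_mul f h).toLp _⟩

theorem coeFn_bc_smul (f : BC) (h : ScalarL2 T) :
    (f • h : ScalarL2 T) =ᵐ[timeMeasure T] fun t => f t * h t :=
  MemLp.coeFn_toLp (memLp_bc_mul f h)

noncomputable instance : Module BC (ScalarL2 T) where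
  one_smul h := by
    apply Lp.ext
    filter_upwards [coeFn_bc_smul 1 h] with t h1
    simp [h1]
  mul_smul f g h := by
    apply Lp.ext
    filter_upwards [coeFn_bc_smul (f * g) h, coeFn_bc_smul f (g • h), coeFn_bc_smul g h]
      with t h1 h2 h3
    simp [h1, h2, h3, mul_assoc]
  smul_zero f := by
    apply Lp.ext
    filter_upwards [coeFn_bc_smul f (0 : ScalarL2 T), Lp.coeFn_zero ℝ 2 (timeMeasure T)]
      with t h1 h2
    rw [h1, h2, Pi.zero_apply, mul_zero]
  smul_add f g h := by
    apply Lp.ext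
    filter_upwards [coeFn_bc_smul f (g + h), coeFn_bc_smul f g, coeFn_bc_smul f h,
      Lp.coeFn_add g h, Lp.coeFn_add (f • g) (f • h)] with t h1 h2 h3 h4 h5
    simp only [h1, h2, h3, h4, h5, Pi.add_apply, mul_add]
  add_smul f g h := by
    apply Lp.ext
    filter_upwards [coeFn_bc_smul (f + g) h, coeFn_bc_smul f h, coeFn_bc_smul g h,
      Lp.coeFn_add (f • h) (g • h)] with t h1 h2 h3 h4
    simp only [h1, h2, h3, h4, BoundedContinuousFunction.coe_add, Pi.add_apply, add_mul]
  zero_smul h := by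
    apply Lp.ext
    filter_upwards [coeFn_bc_smul 0 h, Lp.coeFn_zero ℝ 2 (timeMeasure T)] with t h1 h2
    rw [h1, h2, BoundedContinuousFunction.coe_zero, Pi.zero_apply, zero_mul]

instance : IsScalarTower ℝ BC (ScalarL2 T) where
  smul_assoc c f h := by
    apply Lp.ext
    filter_upwards [coeFn_bc_smul (c • f) h, coeFn_bc_smul f h, Lp.coeFn_smul c (f • h)]
      with t h1 h2 h3
    simp [h1, h2, h3, mul_assoc]

instance : SMulCommClass ℝ BC (ScalarL2 T) where
  smul_comm c f h := by
    apply Lp.ext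
    filter_upwards [coeFn_bc_smul f (c • h), coeFn_bc_smul f h, Lp.coeFn_smul c (f • h),
      Lp.coeFn_smul c h] with t h1 h2 h3 h4
    simp only [h1, h2, h3, h4, Pi.smul_apply, smul_eq_mul]
    ring

theorem bc_smul_add (f : BC) (g h : ScalarL2 T) : f • (g + h) = f • g + f • h := by module

theorem bc_smul_sub (f : BC) (g h : ScalarL2 T) : f • (g - h) = f • g - f • h := by module

theorem norm_bc_smul_le (f : BC) (h : ScalarL2 T) : ‖f • h‖ ≤ ‖f‖ * ‖h‖ := by
  refine Lp.norm_le_mul_norm_of_ae_le_mul ?_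
  filter_upwards [coeFn_bc_smul f h] with t h1
  rw [h1, norm_mul]
  exact mul_le_mul_of_nonneg_right (f.norm_coe_le_norm t) (norm_nonneg _)

instance : IsBoundedSMul BC (ScalarL2 T) := IsBoundedSMul.of_norm_smul_le norm_bc_smul_le

theorem bc_smul_emb (f g : BC) : f • emb T g = emb T (f * g) := by
  apply Lp.ext
  filter_upwards [coeFn_bc_smul f (emb T g), coeFn_emb (T := T) g, coeFn_emb (T := T) (f * g)]
    with t h1 h2 h3
  simp [h1, h2, h3]

theorem emb_congr {f g : BC} (h : ∀ t ∈ Icc 0 T, f t = g t) : emb T f = emb T g := by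
  apply Lp.ext
  have : ∀ᵐ t ∂(timeMeasure T), t ∈ Ioo 0 T := ae_restrict_mem measurableSet_Ioo
  filter_upwards [coeFn_emb (T := T) f, coeFn_emb (T := T) g, this] with t h1 h2 h3
  rw [h1, h2, h t ⟨h3.1.le, h3.2.le⟩]

theorem inner_scalar (f g : ScalarL2 T) : inner ℝ f g = ∫ t, f t * g t ∂(timeMeasure T) := by
  rw [L2.inner_def]
  refine integral_congr_ae (Filter.Eventually.of_forall fun t => ?_)
  simp [mul_comm]

theorem inner_bc_smul (f : BC) (g h : ScalarL2 T) : inner ℝ (f • g) h = inner ℝ g (f • h) := by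
  rw [inner_scalar, inner_scalar]
  refine integral_congr_ae ?_
  filter_upwards [coeFn_bc_smul f g, coeFn_bc_smul f h] with t h1 h2
  rw [h1, h2]; ring

theorem inner_emb_one (h : ScalarL2 T) : inner ℝ (emb T 1) h = ∫ t, h t ∂(timeMeasure T) := by
  rw [inner_scalar]
  refine integral_congr_ae ?_
  filter_upwards [coeFn_emb (T := T) 1] with t h1
  simp [h1]

theorem integral_abs_le (h : ScalarL2 T) :
    ∫ t, ‖h t‖ ∂(timeMeasure T) ≤ ‖emb T 1‖ * ‖h‖ := by
  have h1 : ∫ t, ‖h t‖ ∂(timeMeasure T) = inner ℝ (emb T 1) |h| := by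
    rw [inner_emb_one]
    refine integral_congr_ae ?_
    filter_upwards [Lp.coeFn_abs h] with t h1
    rw [h1, Real.norm_eq_abs]
  rw [h1]
  refine (real_inner_le_norm _ _).trans ?_
  rw [norm_abs_eq_norm]

/-! ### Primitives of L² functions and the product rule -/

theorem intervalIntegrable_scalar (h : ScalarL2 T) (a b : ℝ) :
    IntervalIntegrable h (timeMeasure T) a b :=
  (integrable_scalar h).intervalIntegrable

theorem norm_primitive_le (h : ScalarL2 T) (t : ℝ) :
    ‖∫ s in (0 : ℝ)..t, h s ∂(timeMeasure T)‖ ≤ ‖emb T 1‖ * ‖h‖ := by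
  refine le_trans ?_ (integral_abs_le h)
  refine intervalIntegral.norm_integral_le_integral_norm_uIoc.trans ?_
  exact setIntegral_le_integral (integrable_scalar h).norm
    (Filter.Eventually.of_forall fun t => norm_nonneg _)

/-- The primitive vanishing at `0`, as a bounded continuous function. -/
noncomputable def prim : ScalarL2 T →L[ℝ] BC :=
  LinearMap.mkContinuous
    { toFun := fun h => BoundedContinuousFunction.ofNormedAddCommGroup
        (fun t => ∫ s in (0 : ℝ)..t, h s ∂(timeMeasure T))
        (intervalIntegral.continuous_primitive (intervalIntegrable_scalar h) 0)
        (‖emb T 1‖ * ‖h‖) (norm_primitive_le h)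
      map_add' := fun f g => by
        ext t
        simp only [BoundedContinuousFunction.coe_ofNormedAddCommGroup,
          BoundedContinuousFunction.coe_add, Pi.add_apply]
        rw [← intervalIntegral.integral_add (intervalIntegrable_scalar f 0 t)
          (intervalIntegrable_scalar g 0 t)]
        refine intervalIntegral.integral_congr_ae ?_
        filter_upwards [Lp.coeFn_add f g] with s hs _
        rw [hs, Pi.add_apply]
      map_smul' := fun c f => by
        ext t
        simp only [BoundedContinuousFunction.coe_ofNormedAddCommGroup, RingHom.id_apply,
          BoundedContinuousFunction.coe_smul, smul_eq_mul]
        rw [← intervalIntegral.integral_const_mul]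
        refine intervalIntegral.integral_congr_ae ?_
        filter_upwards [Lp.coeFn_smul c f] with s hs _
        rw [hs, Pi.smul_apply, smul_eq_mul] }
    ‖emb T 1‖ (fun h => BoundedContinuousFunction.norm_ofNormedAddCommGroup_le
      (intervalIntegral.continuous_primitive (intervalIntegrable_scalar h) 0) (by positivity)
      (norm_primitive_le h))

theorem prim_apply (h : ScalarL2 T) (t : ℝ) :
    prim h t = ∫ s in (0 : ℝ)..t, h s ∂(timeMeasure T) := rfl

@[simp]
theorem prim_zero_apply (h : ScalarL2 T) : prim h 0 = 0 := by
  rw [prim_apply, intervalIntegral.integral_same]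

theorem restrict_timeMeasure_Ioc {t : ℝ} (ht : t ∈ Icc 0 T) :
    (timeMeasure T).restrict (Ioc 0 t) = volume.restrict (Ioc 0 t) := by
  rw [Measure.restrict_congr_set Ioo_ae_eq_Ioc.symm, Measure.restrict_restrict measurableSet_Ioo,
    Measure.restrict_congr_set Ioo_ae_eq_Ioc.symm, inter_eq_left.2 (Ioo_subset_Ioo_right ht.2)]

theorem prim_emb_apply (f : BC) {t : ℝ} (ht : t ∈ Icc 0 T) :
    prim (emb T f) t = ∫ s in (0 : ℝ)..t, f s := by
  rw [prim_apply, intervalIntegral.integral_of_le ht.1, intervalIntegral.integral_of_le ht.1,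
    ← restrict_timeMeasure_Ioc ht]
  exact integral_congr_ae (ae_restrict_of_ae (coeFn_emb f))

theorem prim_apply_end (hT : 0 < T) (h : ScalarL2 T) : prim h T = inner ℝ (emb T 1) h := by
  rw [inner_emb_one, prim_apply, intervalIntegral.integral_of_le hT.le,
    restrict_timeMeasure_Ioc ⟨hT.le, le_rfl⟩, Measure.restrict_congr_set Ioo_ae_eq_Ioc.symm]

/-- `f` is a primitive of `g` on `[0, T]`. -/
def IsPrim (f : BC) (g : ScalarL2 T) : Prop := ∀ t ∈ Icc 0 T, f t = f 0 + prim g t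

theorem isPrim_prim (g : ScalarL2 T) : IsPrim (prim g) g := fun t _ => by simp

theorem IsPrim.add {f f' : BC} {g g' : ScalarL2 T} (h : IsPrim f g) (h' : IsPrim f' g') :
    IsPrim (f + f') (g + g') := fun t ht => by
  simp [h t ht, h' t ht]; ring

theorem IsPrim.sub {f f' : BC} {g g' : ScalarL2 T} (h : IsPrim f g) (h' : IsPrim f' g') :
    IsPrim (f - f') (g - g') := fun t ht => by
  simp [h t ht, h' t ht]; ring

theorem IsPrim.smul {f : BC} {g : ScalarL2 T} (c : ℝ) (h : IsPrim f g) :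
    IsPrim (c • f) (c • g) := fun t ht => by
  simp [h t ht]; ring

theorem IsPrim.congr {f : BC} {g g' : ScalarL2 T} (h : IsPrim f g) (e : g = g') : IsPrim f g' :=
  e ▸ h

theorem isPrim_of_hasDerivAt {f f' : BC} (h : ∀ t ∈ Ioo 0 T, HasDerivAt f (f' t) t) :
    IsPrim f (emb T f') := fun t ht => by
  rw [prim_emb_apply f' ht, intervalIntegral.integral_eq_sub_of_hasDerivAt_of_le ht.1
    f.continuous.continuousOn (fun x hx => h x ⟨hx.1, hx.2.trans_le ht.2⟩)
    (f'.continuous.intervalIntegrable _ _)]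
  ring

theorem IsPrim.hasDerivAt {f f' : BC} (h : IsPrim f (emb T f')) {t : ℝ} (ht : t ∈ Ioo 0 T) :
    HasDerivAt f (f' t) t := by
  have h1 : HasDerivAt (fun u => f 0 + ∫ s in (0 : ℝ)..u, f' s) (f' t) t :=
    (intervalIntegral.integral_hasDerivAt_right (f'.continuous.intervalIntegrable _ _)
      (f'.continuous.stronglyMeasurableAtFilter _ _) f'.continuous.continuousAt).const_add _
  refine h1.congr_of_eventuallyEq ?_
  filter_upwards [isOpen_Ioo.mem_nhds ht] with s hs
  rw [h s ⟨hs.1.le, hs.2.le⟩, prim_emb_apply f' ⟨hs.1.le, hs.2.le⟩]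

/-- Integration by parts. -/
theorem prim_mul_prim (f g : ScalarL2 T) {t : ℝ} (ht : t ∈ Icc 0 T) :
    prim f t * prim g t = prim (prim f • g + prim g • f) t := by
  revert t
  suffices ∀ t ∈ Icc 0 T, prim f t * prim g t = prim (prim f • g + prim g • f) t from
    fun {t} ht => this t ht
  intro t ht
  have hev : Continuous fun h : ScalarL2 T => prim h t :=
    (BoundedContinuousFunction.evalCLM ℝ t).continuous.comp prim.continuous
  -- Both sides are continuous in (f, g), so it is enough to treat continuous functions, where the
  -- classical product rule applies.
  refine denseRange_emb.induction_on₂ (p := fun f g : ScalarL2 T =>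
    prim f t * prim g t = prim (prim f • g + prim g • f) t) ?_ ?_ f g
  · refine isClosed_eq ?_ ?_
    · exact (hev.comp continuous_fst).mul (hev.comp continuous_snd)
    · refine hev.comp ?_
      exact ((prim.continuous.comp continuous_fst).smul continuous_snd).add
        ((prim.continuous.comp continuous_snd).smul continuous_fst)
  · intro a b
    have h1 : IsPrim (prim (emb T a) * prim (emb T b))
        (emb T (prim (emb T a) * b + prim (emb T b) * a)) := by
      refine isPrim_of_hasDerivAt fun s hs => ?_
      refine (((isPrim_prim (emb T a)).hasDerivAt hs).mul
        ((isPrim_prim (emb T b)).hasDerivAt hs)).congr_deriv ?_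
      simp only [BoundedContinuousFunction.coe_add, BoundedContinuousFunction.coe_mul,
        Pi.add_apply, Pi.mul_apply]
      ring
    have h2 := h1 t ht
    rw [bc_smul_emb, bc_smul_emb, ← map_add]
    simpa using h2

/-- On [0, T] each factor is a constant plus a primitive vanishing at 0; the constants enter
linearly and `prim_mul_prim` covers the remaining product. Derivatives thus need only be in L². -/
theorem IsPrim.mul {f f' : BC} {g g' : ScalarL2 T} (h : IsPrim f g) (h' : IsPrim f' g') :
    IsPrim (f * f') (f • g' + f' • g) := fun t ht => by
  have e : ∀ {f : BC} {g k : ScalarL2 T}, IsPrim f g → f • k = f 0 • k + prim g • k := by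
    intro f g k hfg
    apply Lp.ext
    have : ∀ᵐ t ∂(timeMeasure T), t ∈ Ioo 0 T := ae_restrict_mem measurableSet_Ioo
    filter_upwards [coeFn_bc_smul f k, coeFn_bc_smul (prim g) k, Lp.coeFn_smul (f 0) k,
      Lp.coeFn_add (f 0 • k) (prim g • k), this] with t h1 h2 h3 h4 h5
    rw [h1, h4, Pi.add_apply, h2, h3, hfg t ⟨h5.1.le, h5.2.le⟩, Pi.smul_apply, smul_eq_mul]
    ring
  rw [e h, e h', show f 0 • g' + prim g • g' + (f' 0 • g + prim g' • g)
    = f 0 • g' + f' 0 • g + (prim g • g' + prim g' • g) by abel, map_add, map_add]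
  simp only [BoundedContinuousFunction.coe_mul, BoundedContinuousFunction.coe_add, Pi.mul_apply,
    Pi.add_apply, ← prim_mul_prim g g' ht, BoundedContinuousFunction.coe_smul, map_smul,
    smul_eq_mul, h t ht, h' t ht]
  ring

/-! ### Truncated reciprocals -/

/-- The reciprocal `1 / f`, with `f` truncated from below at `κ > 0`. -/
noncomputable def recip {κ : ℝ} (hκ : 0 < κ) (f : BC) : BC :=
  BoundedContinuousFunction.ofNormedAddCommGroup (fun t => (max κ (f t))⁻¹)
    ((continuous_const.max f.continuous).inv₀ fun t => (lt_max_of_lt_left hκ).ne') κ⁻¹ fun t => by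
      rw [norm_inv, Real.norm_of_nonneg (hκ.le.trans (le_max_left _ _))]
      exact inv_anti₀ hκ (le_max_left _ _)

section recip

variable {κ : ℝ} (hκ : 0 < κ)

theorem recip_apply (f : BC) (t : ℝ) : recip hκ f t = (max κ (f t))⁻¹ := rfl

theorem recip_nonneg (f : BC) (t : ℝ) : 0 ≤ recip hκ f t :=
  inv_nonneg.2 (hκ.le.trans (le_max_left _ _))

theorem norm_recip_le (f : BC) : ‖recip hκ f‖ ≤ κ⁻¹ :=
  BoundedContinuousFunction.norm_ofNormedAddCommGroup_le _ (inv_nonneg.2 hκ.le) _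

theorem abs_recip_sub_recip_le (f g : BC) (t : ℝ) :
    |recip hκ f t - recip hκ g t| ≤ κ⁻¹ * κ⁻¹ * |f t - g t| := by
  have hf : κ ≤ max κ (f t) := le_max_left _ _
  have hg : κ ≤ max κ (g t) := le_max_left _ _
  have hf0 := hκ.trans_le hf
  have hg0 := hκ.trans_le hg
  rw [recip_apply, recip_apply, inv_sub_inv hf0.ne' hg0.ne', abs_div, abs_mul, abs_of_pos hf0,
    abs_of_pos hg0, div_eq_inv_mul, mul_inv]
  refine mul_le_mul ?_ ?_ (abs_nonneg _) (by positivity)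
  · exact mul_le_mul (inv_anti₀ hκ hf) (inv_anti₀ hκ hg) (by positivity) (by positivity)
  · rw [abs_sub_comm (f t)]
    rw [max_comm, max_comm κ]
    exact abs_max_sub_max_le_abs _ _ _

theorem norm_recip_sub_recip_le (f g : BC) :
    ‖recip hκ f - recip hκ g‖ ≤ κ⁻¹ * κ⁻¹ * ‖f - g‖ := by
  refine (BoundedContinuousFunction.norm_le (by positivity)).2 fun t => ?_
  exact (abs_recip_sub_recip_le hκ f g t).trans
    (mul_le_mul_of_nonneg_left ((f - g).norm_coe_le_norm t) (by positivity))

theorem recip_mul_apply {f : BC} {t : ℝ} (h : κ ≤ f t) : recip hκ f t * f t = 1 := by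
  rw [recip_apply, max_eq_right h, inv_mul_cancel₀ (hκ.trans_le h).ne']

/-- The lower bound makes the truncation inactive on [0, T], where this is the derivative of 1 / f.
-/
theorem IsPrim.recip {f f' : BC} (h : IsPrim f (emb T f')) (hf : ∀ t ∈ Icc 0 T, κ ≤ f t) :
    IsPrim (recip hκ f) (emb T (-(recip hκ f * recip hκ f * f'))) := by
  refine isPrim_of_hasDerivAt fun t ht => ?_
  have h0 : f t ≠ 0 := (hκ.trans_le (hf t ⟨ht.1.le, ht.2.le⟩)).ne'
  refine (((h.hasDerivAt ht).inv h0).congr_of_eventuallyEq ?_).congr_deriv ?_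
  · filter_upwards [isOpen_Ioo.mem_nhds ht] with s hs
    rw [recip_apply, max_eq_right (hf s ⟨hs.1.le, hs.2.le⟩)]
    rfl
  · simp [recip_apply, max_eq_right (hf t ⟨ht.1.le, ht.2.le⟩)]
    field_simp

end recip

end SupersonicDuct

namespace SupersonicDuct

variable {T : ℝ}

theorem inner_emb_one_smul (f : BC) (h : ScalarL2 T) :
    inner ℝ (emb T 1) (f • h) = inner ℝ (emb T f) h := by
  rw [← inner_bc_smul, bc_smul_emb, mul_one]

theorem abs_prim_smul_le (f : BC) (w : ScalarL2 T) (t : ℝ) :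
    |prim (f • w) t| ≤ ‖emb T f‖ * ‖w‖ := by
  rw [prim_apply, ← Real.norm_eq_abs]
  refine intervalIntegral.norm_integral_le_integral_norm_uIoc.trans ?_
  refine (setIntegral_le_integral (integrable_scalar _).norm
    (Filter.Eventually.of_forall fun t => norm_nonneg _)).trans ?_
  have h1 : ∫ t, ‖(f • w : ScalarL2 T) t‖ ∂(timeMeasure T) = inner ℝ |emb T f| |w| := by
    rw [inner_scalar]
    refine integral_congr_ae ?_
    filter_upwards [Lp.coeFn_abs w, Lp.coeFn_abs (emb T f), coeFn_emb (T := T) f,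
      coeFn_bc_smul f w] with t h1 h2 h3 h4
    rw [h1, h2, h3, h4, Real.norm_eq_abs, abs_mul]
  rw [h1]
  refine (real_inner_le_norm _ _).trans ?_
  rw [norm_abs_eq_norm, norm_abs_eq_norm]

/-! ### The Volterra operator and its accretivity -/

/-- The Volterra operator on `L²(0, T)`. -/
noncomputable def volterra (T : ℝ) : ScalarL2 T →L[ℝ] ScalarL2 T := (emb T).comp prim

theorem volterra_apply (h : ScalarL2 T) : volterra T h = emb T (prim h) := rfl

theorem IsPrim.emb_eq {f : BC} {g : ScalarL2 T} (h : IsPrim f g) :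
    emb T f = f 0 • emb T 1 + volterra T g := by
  rw [volterra_apply, ← map_smul, ← map_add]
  refine emb_congr fun t ht => ?_
  rw [h t ht]
  simp

theorem IsPrim.volterra_eq {f : BC} {g : ScalarL2 T} (h : IsPrim f g) (h0 : f 0 = 0) :
    volterra T g = emb T f := by
  rw [h.emb_eq, h0, zero_smul, zero_add]

/-- Integration by parts evaluated at T: the Volterra operator plus its adjoint is a rank-one form,
nonnegative on the diagonal. Accretivity, and with it the resolvent bounds below, rests on this. -/
theorem inner_volterra_add (hT : 0 < T) (f g : ScalarL2 T) :
    inner ℝ (volterra T f) g + inner ℝ (volterra T g) f = prim f T * prim g T := by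
  rw [prim_mul_prim f g ⟨hT.le, le_rfl⟩, prim_apply_end hT, inner_add_right, inner_emb_one_smul,
    inner_emb_one_smul]
  rfl

/-- With v = Jw one has 2∫ b v' v = b(T) v(T)² − ∫ b' v², since v(0) = 0. The term at T is dropped
by its sign, and the bound involves v but not w = v'. -/
theorem inner_smul_volterra_ge (hT : 0 < T) {b b' : BC} (hb : IsPrim b (emb T b'))
    (h0 : ∀ t ∈ Icc 0 T, 0 ≤ b t) (w : ScalarL2 T) :
    -(‖b'‖ * ‖volterra T w‖ ^ 2) ≤ 2 * inner ℝ (b • w) (volterra T w) := by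
  have hv := isPrim_prim w
  have h1 := (hb.mul (hv.mul hv)) T ⟨hT.le, le_rfl⟩
  rw [prim_apply_end hT] at h1
  have h2 : 0 ≤ (b * (prim w * prim w)) T := by
    simp only [BoundedContinuousFunction.coe_mul, Pi.mul_apply]
    exact mul_nonneg (h0 T ⟨hT.le, le_rfl⟩) (mul_self_nonneg _)
  rw [h1] at h2
  simp only [BoundedContinuousFunction.coe_mul, Pi.mul_apply, prim_zero_apply, mul_zero, zero_add,
    inner_add_right, bc_smul_add, inner_emb_one_smul] at h2
  have h3 : inner ℝ (emb T (prim w * prim w)) (emb T b') ≤ ‖b'‖ * ‖volterra T w‖ ^ 2 := by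
    rw [← bc_smul_emb, inner_bc_smul, bc_smul_emb, mul_comm, ← bc_smul_emb]
    refine (real_inner_le_norm _ _).trans ?_
    have := norm_bc_smul_le b' (emb T (prim w))
    rw [volterra_apply]
    nlinarith [norm_nonneg (emb T (prim w))]
  have h4 : inner ℝ (emb T b) (prim w • w) = inner ℝ (b • w) (volterra T w) := by
    rw [inner_bc_smul, volterra_apply, bc_smul_emb, ← inner_bc_smul, bc_smul_emb, real_inner_comm,
      mul_comm]
  rw [h4] at h2
  linarith

theorem inner_volterra_self_nonneg (hT : 0 < T) (w : ScalarL2 T) :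
    0 ≤ inner ℝ w (volterra T w) := by
  have h := inner_volterra_add hT w w
  rw [real_inner_comm w] at h
  nlinarith [mul_self_nonneg (prim w T)]

/-! ### Yosida approximation of the time derivative -/

/-- The resolvent `(ρ + J)⁻¹` of the Volterra operator `J`, i.e. the Yosida approximation
`∂ₜ (1 + ρ ∂ₜ)⁻¹` of the derivative with zero initial value. -/
noncomputable def yosida (T ρ : ℝ) : ScalarL2 T →L[ℝ] ScalarL2 T :=
  (ρ • ContinuousLinearMap.id ℝ (ScalarL2 T) + volterra T).inverse

/-- Lax–Milgram: since J is accretive, ρ + J is coercive with constant ρ. -/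
theorem exists_equiv_add_volterra (hT : 0 < T) {ρ : ℝ} (hρ : 0 < ρ) :
    ∃ e : ScalarL2 T ≃L[ℝ] ScalarL2 T,
      (e : ScalarL2 T →L[ℝ] ScalarL2 T) =
        ρ • ContinuousLinearMap.id ℝ (ScalarL2 T) + volterra T := by
  set A : ScalarL2 T →L[ℝ] ScalarL2 T := ρ • ContinuousLinearMap.id ℝ (ScalarL2 T) + volterra T
    with hA
  let B : ScalarL2 T →L[ℝ] ScalarL2 T →L[ℝ] ℝ :=
    LinearMap.mkContinuous₂ (LinearMap.mk₂ ℝ (fun u v => inner ℝ (A u) v)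
      (fun u u' v => by rw [map_add, inner_add_left])
      (fun c u v => by rw [map_smul, real_inner_smul_left, smul_eq_mul])
      (fun u v v' => by rw [inner_add_right])
      (fun c u v => by rw [real_inner_smul_right, smul_eq_mul])) ‖A‖ (fun u v => by
        rw [LinearMap.mk₂_apply]
        exact (norm_inner_le_norm _ _).trans
          (mul_le_mul_of_nonneg_right (A.le_opNorm u) (norm_nonneg _)))
  have hB : ∀ u v, B u v = inner ℝ (A u) v := fun u v => rfl
  have hc : IsCoercive B := by
    refine ⟨ρ, hρ, fun u => ?_⟩
    rw [hB, hA]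
    simp only [add_apply, smul_apply,
      ContinuousLinearMap.id_apply, inner_add_left, real_inner_smul_left,
      real_inner_self_eq_norm_sq]
    have := inner_volterra_self_nonneg hT u
    rw [real_inner_comm] at this
    nlinarith
  refine ⟨hc.continuousLinearEquivOfBilin, ?_⟩
  ext1 u
  refine ext_inner_right ℝ fun v => ?_
  rw [← hB]
  exact hc.continuousLinearEquivOfBilin_apply u v

section yosida

variable (hT : 0 < T) {ρ : ℝ} (hρ : 0 < ρ)

include hT hρ

theorem yosida_spec (h : ScalarL2 T) : ρ • yosida T ρ h + volterra T (yosida T ρ h) = h := by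
  obtain ⟨e, he⟩ := exists_equiv_add_volterra hT hρ
  have h1 : (ρ • ContinuousLinearMap.id ℝ (ScalarL2 T) + volterra T) (yosida T ρ h) = h := by
    rw [yosida, ← he, ContinuousLinearMap.inverse_equiv]
    exact e.apply_symm_apply h
  simpa using h1

theorem yosida_unique {w h : ScalarL2 T} (e : ρ • w + volterra T w = h) : yosida T ρ h = w := by
  obtain ⟨f, hf⟩ := exists_equiv_add_volterra hT hρ
  rw [← e, yosida, ← hf, ContinuousLinearMap.inverse_equiv]
  refine (f.symm_apply_eq).2 ?_
  have := congrArg (fun A : ScalarL2 T →L[ℝ] ScalarL2 T => A w) hf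
  simpa using this.symm

/-- Expand ‖ρw + Jw‖² for w = (ρ + J)⁻¹h; the cross term is nonnegative. The bounds for the
resolvent and for the smoothing both follow. -/
theorem norm_sq_yosida (h : ScalarL2 T) :
    ρ ^ 2 * ‖yosida T ρ h‖ ^ 2 + ‖volterra T (yosida T ρ h)‖ ^ 2 ≤ ‖h‖ ^ 2 := by
  conv_rhs => rw [← yosida_spec hT hρ h]
  rw [norm_add_sq_real, norm_smul, Real.norm_of_nonneg hρ.le, real_inner_smul_left]
  have := mul_nonneg hρ.le (inner_volterra_self_nonneg hT (yosida T ρ h))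
  nlinarith

theorem norm_yosida_le (h : ScalarL2 T) : ρ * ‖yosida T ρ h‖ ≤ ‖h‖ := by
  have := norm_sq_yosida hT hρ h
  exact le_of_sq_le_sq (by nlinarith [sq_nonneg ‖volterra T (yosida T ρ h)‖]) (norm_nonneg _)

theorem norm_smoothing_le (h : ScalarL2 T) : ‖volterra T (yosida T ρ h)‖ ≤ ‖h‖ := by
  have := norm_sq_yosida hT hρ h
  exact le_of_sq_le_sq (by nlinarith [mul_nonneg (sq_nonneg ρ) (sq_nonneg ‖yosida T ρ h‖)])
    (norm_nonneg _)

theorem yosida_volterra (h : ScalarL2 T) :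
    yosida T ρ (volterra T h) = volterra T (yosida T ρ h) := by
  refine yosida_unique hT hρ ?_
  rw [← map_smul, ← map_add, yosida_spec hT hρ]

theorem yosida_comm {δ : ℝ} (hδ : 0 < δ) (h : ScalarL2 T) :
    yosida T ρ (yosida T δ h) = yosida T δ (yosida T ρ h) := by
  refine yosida_unique hT hρ ?_
  rw [← yosida_volterra hT hδ, ← map_smul, ← map_add, yosida_spec hT hρ]

theorem sub_smoothing (h : ScalarL2 T) : h - volterra T (yosida T ρ h) = ρ • yosida T ρ h := by
  rw [sub_eq_iff_eq_add, yosida_spec hT hρ]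

/-- For w = (ρ + J)⁻¹h, (prim w)² = 2∫ w prim w ≤ 2 ‖Jw‖ ‖w‖ ≤ 2 ‖h‖² / ρ. This smallness in the sup
norm lets commutators be estimated for coefficients whose derivative is merely in L². -/
theorem norm_prim_yosida_le (h : ScalarL2 T) :
    ρ * ‖prim (yosida T ρ h)‖ ≤ Real.sqrt (2 * ρ) * ‖h‖ := by
  set w := yosida T ρ h with hw
  have h1 : ‖prim w‖ ≤ Real.sqrt (2 * (‖volterra T w‖ * ‖w‖)) := by
    refine (BoundedContinuousFunction.norm_le (Real.sqrt_nonneg _)).2 fun t => ?_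
    refine Real.abs_le_sqrt ?_
    have h0 : ∀ s ∈ Icc 0 T, prim w s ^ 2 ≤ 2 * (‖volterra T w‖ * ‖w‖) := fun s hs => by
      rw [sq, prim_mul_prim w w hs, ← two_smul ℝ, map_smul]
      have := (le_abs_self _).trans (abs_prim_smul_le (prim w) w s)
      rw [volterra_apply]
      simp only [BoundedContinuousFunction.coe_smul, smul_eq_mul]
      linarith
    -- Outside [0, T] the primitive is constant, so the supremum over ℝ is the one over [0, T].
    rcases le_or_gt t 0 with ht | ht
    · have : prim w t = 0 := by
        rw [prim_apply, intervalIntegral.integral_symm, intervalIntegral.integral_of_le ht,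
          Measure.restrict_restrict measurableSet_Ioc, show Ioc t 0 ∩ Ioo 0 T = ∅ from ?_]
        · simp
        · ext s; simp only [mem_inter_iff, mem_Ioc, mem_Ioo, mem_empty_iff_false, iff_false]
          intro h; linarith [h.1.2, h.2.1]
      rw [this, zero_pow two_ne_zero]; positivity
    · rcases le_or_gt t T with ht' | ht'
      · exact h0 t ⟨ht.le, ht'⟩
      · have : prim w t = prim w T := by
          rw [prim_apply, prim_apply, intervalIntegral.integral_of_le ht.le,
            intervalIntegral.integral_of_le hT.le, Measure.restrict_restrict measurableSet_Ioc,
            Measure.restrict_restrict measurableSet_Ioc,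
            inter_eq_right.2 (Ioo_subset_Ioc_self.trans (Ioc_subset_Ioc_right ht'.le)),
            inter_eq_right.2 Ioo_subset_Ioc_self]
        rw [this]; exact h0 T ⟨hT.le, le_rfl⟩
  have h2 : ρ * ‖w‖ ≤ ‖h‖ := norm_yosida_le hT hρ h
  have h3 : ‖volterra T w‖ ≤ ‖h‖ := norm_smoothing_le hT hρ h
  refine (mul_le_mul_of_nonneg_left h1 hρ.le).trans ?_
  rw [← Real.sqrt_sq (norm_nonneg h), ← Real.sqrt_mul (by positivity)]
  refine Real.le_sqrt_of_sq_le ?_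
  rw [mul_pow, Real.sq_sqrt (by positivity)]
  have : ‖volterra T w‖ * (ρ * ‖w‖) ≤ ‖h‖ * ‖h‖ :=
    mul_le_mul h3 h2 (by positivity) (norm_nonneg _)
  nlinarith

/-- The commutator of the smoothing operator with multiplication. -/
theorem smoothing_smul {A : BC} {A' : ScalarL2 T} (hA : IsPrim A A') (k : ScalarL2 T) :
    volterra T (yosida T ρ (A • k)) = A • volterra T (yosida T ρ k)
      - ρ • volterra T (yosida T ρ (prim (yosida T ρ k) • A')) := by
  set w := yosida T ρ k with hw
  have h1 : volterra T (A • w + prim w • A') = A • volterra T w := by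
    rw [(hA.mul (isPrim_prim w)).volterra_eq (by simp), volterra_apply, bc_smul_emb]
  -- The resolvent equation holds because ρ(A w + v A') + A v = A(ρw + v) + ρ v A' with v = prim w
  -- and ρw + v = k.
  have h2 : yosida T ρ (A • k + ρ • prim w • A') = A • w + prim w • A' := by
    refine yosida_unique hT hρ ?_
    rw [h1]
    conv_rhs => rw [← yosida_spec hT hρ k]
    rw [← hw]
    module
  have h3 : volterra T (yosida T ρ (A • k + ρ • prim w • A')) = A • volterra T w := by
    rw [h2, h1]
  rw [map_add, map_add, (yosida T ρ).map_smul, (volterra T).map_smul] at h3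
  rw [← h3, add_sub_cancel_right]

/-- Writing the defect as identity minus smoothing, the commutator formula leaves a remainder
containing ρ · prim(yosida k), which is O(√ρ) in the sup norm. -/
theorem norm_defect_smul_le {A : BC} {A' : ScalarL2 T} (hA : IsPrim A A') (k : ScalarL2 T) :
    ‖ρ • yosida T ρ (A • k)‖ ≤
      ‖A‖ * ‖ρ • yosida T ρ k‖ + Real.sqrt (2 * ρ) * (‖A'‖ * ‖k‖) := by
  have h1 : ρ • yosida T ρ (A • k) = A • (ρ • yosida T ρ k)
      + ρ • volterra T (yosida T ρ (prim (yosida T ρ k) • A')) := by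
    rw [← sub_smoothing hT hρ, smoothing_smul hT hρ hA, ← sub_smoothing hT hρ k, bc_smul_sub]
    abel
  rw [h1]
  refine (norm_add_le _ _).trans (add_le_add (norm_bc_smul_le _ _) ?_)
  rw [norm_smul, Real.norm_of_nonneg hρ.le]
  have h2 := (norm_smoothing_le hT hρ (prim (yosida T ρ k) • A')).trans (norm_bc_smul_le _ _)
  have h3 := mul_le_mul_of_nonneg_right (norm_prim_yosida_le hT hρ k) (norm_nonneg A')
  nlinarith

/-- Transport by a nonnegative Lipschitz speed is quasi-accretive, uniformly in `ρ`. -/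
theorem inner_smul_yosida_ge {b b' : BC} (hb : IsPrim b (emb T b'))
    (h0 : ∀ t ∈ Icc 0 T, 0 ≤ b t) (h : ScalarL2 T) :
    -(‖b'‖ * ‖h‖ ^ 2) ≤ 2 * inner ℝ (b • yosida T ρ h) h := by
  set w := yosida T ρ h with hw
  have h1 := inner_smul_volterra_ge hT hb h0 w
  have h2 : 0 ≤ inner ℝ (b • w) w := by
    rw [inner_scalar]
    refine integral_nonneg_of_ae ?_
    have : ∀ᵐ t ∂(timeMeasure T), t ∈ Ioo 0 T := ae_restrict_mem measurableSet_Ioo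
    filter_upwards [coeFn_bc_smul b w, this] with t ht ht'
    rw [ht, mul_assoc]
    exact mul_nonneg (h0 t ⟨ht'.1.le, ht'.2.le⟩) (mul_self_nonneg _)
  -- Split h = ρw + Jw: the first part gives a nonnegative term, the second is bounded below by
  -- `inner_smul_volterra_ge`.
  have h3 : inner ℝ (b • w) h = ρ * inner ℝ (b • w) w + inner ℝ (b • w) (volterra T w) := by
    conv_lhs => rw [← yosida_spec hT hρ h]
    rw [inner_add_right, real_inner_smul_right]
  have h4 : ‖volterra T w‖ ^ 2 ≤ ‖h‖ ^ 2 :=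
    pow_le_pow_left₀ (norm_nonneg _) (norm_smoothing_le hT hρ h) 2
  rw [h3]
  nlinarith [mul_nonneg hρ.le h2, mul_le_mul_of_nonneg_left h4 (norm_nonneg b')]

end yosida

/-! ### Test functions, and convergence of the smoothing -/

theorem IsTest.isPrim {φ : ℝ → ℝ} (h : IsTest T φ) :
    ∃ f f' : BC, (∀ t, f t = φ t) ∧ (∀ t, f' t = deriv φ t) ∧ IsPrim f (emb T f') := by
  obtain ⟨C, hC⟩ := h.2.1.exists_bound_of_continuous h.1.continuous
  have hd : Continuous (deriv φ) := h.1.continuous_deriv (by norm_num)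
  obtain ⟨C', hC'⟩ := h.2.1.deriv.exists_bound_of_continuous hd
  refine ⟨.ofNormedAddCommGroup φ h.1.continuous C hC, .ofNormedAddCommGroup _ hd C' hC',
    fun t => rfl, fun t => rfl, isPrim_of_hasDerivAt fun t _ => ?_⟩
  exact (h.1.differentiable (by norm_num) t).hasDerivAt

theorem IsTest.eq_zero {φ : ℝ → ℝ} (h : IsTest T φ) {t : ℝ} (ht : t ∉ Ioo 0 T) : φ t = 0 := by
  by_contra hne
  exact ht (h.2.2 (subset_tsupport _ hne))

theorem eq_zero_of_integral_test {k : ScalarL2 T}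
    (h : ∀ φ : ℝ → ℝ, IsTest T φ → ∫ t, φ t * k t ∂(timeMeasure T) = 0) : k = 0 := by
  rw [Lp.eq_zero_iff_ae_eq_zero]
  have h1 := IsOpen.ae_eq_zero_of_integral_contDiff_smul_eq_zero (U := Ioo 0 T) (μ := volume)
    (f := k) isOpen_Ioo (IntegrableOn.locallyIntegrableOn (integrable_scalar k)) ?_
  · have h2 : ∀ᵐ t ∂(timeMeasure T), t ∈ Ioo 0 T := ae_restrict_mem measurableSet_Ioo
    filter_upwards [ae_restrict_of_ae h1, h2] with t h3 h4 using h3 h4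
  · intro g hg hc hs
    have := h g ⟨hg, hc, hs⟩
    rw [setIntegral_eq_integral_of_forall_compl_eq_zero] at this
    · simpa using this
    · intro t ht
      rw [IsTest.eq_zero (T := T) ⟨hg, hc, hs⟩ ht, zero_mul]

theorem IsTest.emb_eq {φ : ℝ → ℝ} (h : IsTest T φ) {f f' : BC} (hf : ∀ t, f t = φ t)
    (hp : IsPrim f (emb T f')) : emb T f = volterra T (emb T f') :=
  (hp.volterra_eq (by rw [hf, h.eq_zero]; simp)).symm

theorem integral_eq_inner_emb {φ : ℝ → ℝ} {f : BC} (hf : ∀ t, f t = φ t) (k : ScalarL2 T) :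
    ∫ t, φ t * k t ∂(timeMeasure T) = inner ℝ (emb T f) k := by
  rw [inner_scalar]
  refine integral_congr_ae ?_
  filter_upwards [coeFn_emb (T := T) f] with t ht
  rw [ht, hf]

/-- Every test function is J of its derivative, so a function orthogonal to the range of J is
orthogonal to all test functions. -/
theorem denseRange_volterra : DenseRange (volterra T) := by
  have h : (LinearMap.range (volterra T).toLinearMap)ᗮ = ⊥ := by
    rw [Submodule.eq_bot_iff]
    intro k hk
    refine eq_zero_of_integral_test fun φ hφ => ?_
    obtain ⟨f, f', hf, hf', hp⟩ := hφ.isPrim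
    rw [integral_eq_inner_emb hf, hφ.emb_eq hf hp]
    exact (Submodule.mem_orthogonal _ k).1 hk _ ⟨emb T f', rfl⟩
  have := (Submodule.dense_iff_topologicalClosure_eq_top).2
    ((Submodule.topologicalClosure_eq_top_iff).2 h)
  exact this

/-- The operators ρ(ρ + J)⁻¹ are contractions, and on the dense range of J they are O(ρ) because ρ(ρ
+ J)⁻¹Jg = ρ J(ρ + J)⁻¹g. -/
theorem tendsto_defect (hT : 0 < T) (k : ScalarL2 T) :
    Filter.Tendsto (fun ρ => ‖ρ • yosida T ρ k‖) (nhdsWithin 0 (Ioi 0)) (nhds 0) := by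
  rw [Metric.tendsto_nhdsWithin_nhds]
  intro ε hε
  obtain ⟨g, hg⟩ := denseRange_volterra.exists_dist_lt k (half_pos hε)
  refine ⟨ε / 2 / (‖g‖ + 1), by positivity, fun {ρ} hρ hd => ?_⟩
  have hρ : 0 < ρ := hρ
  rw [dist_zero_right, Real.norm_of_nonneg hρ.le, lt_div_iff₀ (by positivity)] at hd
  rw [dist_zero_right, norm_norm]
  have h1 : ρ • yosida T ρ k = ρ • yosida T ρ (k - volterra T g)
      + ρ • volterra T (yosida T ρ g) := by
    rw [map_sub, yosida_volterra hT hρ, smul_sub, sub_add_cancel]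
  rw [h1]
  refine (norm_add_le _ _).trans_lt ?_
  rw [norm_smul, norm_smul, Real.norm_of_nonneg hρ.le]
  rw [dist_eq_norm] at hg
  have h2 := norm_yosida_le hT hρ (k - volterra T g)
  have h3 := norm_smoothing_le hT hρ g
  nlinarith

end SupersonicDuct

namespace SupersonicDuct

/-! ### Grönwall inequality in a Hilbert space -/

section Gronwall

variable {E : Type*} [NormedAddCommGroup E] [InnerProductSpace ℝ E]

theorem norm_sq_le_of_inner_deriv_le {u u' : ℝ → E} {L K η : ℝ} (hK : 0 ≤ K) (hη : 0 ≤ η)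
    (hu : ∀ x ∈ Icc 0 L, HasDerivWithinAt u (u' x) (Icc 0 L) x)
    (h : ∀ x ∈ Icc 0 L, 2 * inner ℝ (u' x) (u x) ≤ K * ‖u x‖ ^ 2 + η) :
    ∀ x ∈ Icc 0 L, ‖u x‖ ^ 2 ≤ Real.exp (K * L) * (‖u 0‖ ^ 2 + η * L) := by
  intro x hx
  have hL : 0 ≤ L := hx.1.trans hx.2
  -- The weight absorbs K‖u‖² and the linear term absorbs η, so g is antitone.
  let g : ℝ → ℝ := fun x => Real.exp (-(K * x)) * ‖u x‖ ^ 2 - η * x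
  have hg : ∀ x ∈ Icc 0 L, HasDerivWithinAt g
      (Real.exp (-(K * x)) * (-K) * ‖u x‖ ^ 2 + Real.exp (-(K * x)) * (2 * inner ℝ (u' x) (u x)) - η)
      (Icc 0 L) x := by
    intro x hx
    have h1 : HasDerivAt (fun x => Real.exp (-(K * x))) (Real.exp (-(K * x)) * (-K)) x := by
      refine HasDerivAt.exp ?_
      exact ((hasDerivAt_id x).const_mul K).neg.congr_deriv (by simp)
    have h2 : HasDerivWithinAt (fun x => ‖u x‖ ^ 2) (2 * inner ℝ (u' x) (u x)) (Icc 0 L) x := by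
      have := (hu x hx).norm_sq
      rwa [real_inner_comm] at this
    exact (h1.hasDerivWithinAt.mul h2).sub (by simpa using (hasDerivWithinAt_id x _).const_mul η)
  have hanti : AntitoneOn g (Icc 0 L) := by
    refine antitoneOn_of_hasDerivWithinAt_nonpos (convex_Icc 0 L)
      (fun x hx => (hg x hx).continuousWithinAt)
      (fun x hx => (hg x (interior_subset hx)).mono interior_subset) fun x hx => ?_
    have hx' := interior_subset hx
    have h1 := h x hx'
    have h2 : Real.exp (-(K * x)) ≤ 1 := Real.exp_le_one_iff.2 (by nlinarith [hx'.1])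
    nlinarith [mul_le_mul_of_nonneg_left h1 (Real.exp_pos (-(K * x))).le]
  have h1 := hanti ⟨le_rfl, hL⟩ hx hx.1
  simp only [g, mul_zero, neg_zero, Real.exp_zero, one_mul, sub_zero] at h1
  have h2 : ‖u x‖ ^ 2 = Real.exp (K * x) * (Real.exp (-(K * x)) * ‖u x‖ ^ 2) := by
    rw [← mul_assoc, ← Real.exp_add, add_neg_cancel, Real.exp_zero, one_mul]
  rw [h2]
  refine mul_le_mul (Real.exp_le_exp.2 (mul_le_mul_of_nonneg_left hx.2 hK)) ?_ (by positivity)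
    (Real.exp_pos _).le
  have := mul_le_mul_of_nonneg_left hx.2 hη
  linarith

end Gronwall

/-! ### Ordinary differential equations with an a priori estimate -/

section ODE

variable {E : Type*} [NormedAddCommGroup E] [InnerProductSpace ℝ E]

/-- The radial retraction onto the ball of radius `R`. -/
noncomputable def radial (R : ℝ) (x : E) : E := (R / max R ‖x‖) • x

variable {R : ℝ}

theorem radial_eq (hR : 0 < R) {x : E} (hx : ‖x‖ ≤ R) : radial R x = x := by
  rw [radial, max_eq_left hx, div_self hR.ne', one_smul]

theorem norm_radial_le (hR : 0 < R) (x : E) : ‖radial R x‖ ≤ R ∧ ‖radial R x‖ ≤ ‖x‖ := by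
  have h0 : 0 < max R ‖x‖ := lt_max_of_lt_left hR
  rw [radial, norm_smul, Real.norm_of_nonneg (by positivity)]
  constructor
  · rw [div_mul_eq_mul_div, div_le_iff₀ h0]
    exact mul_le_mul_of_nonneg_left (le_max_right _ _) hR.le
  · refine mul_le_of_le_one_left (norm_nonneg _) ?_
    rw [div_le_one h0]
    exact le_max_left _ _

theorem norm_radial_sub_le (hR : 0 < R) (x y : E) : ‖radial R x - radial R y‖ ≤ 2 * ‖x - y‖ := by
  have hx : 0 < max R ‖x‖ := lt_max_of_lt_left hR
  have hy : 0 < max R ‖y‖ := lt_max_of_lt_left hR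
  have e : radial R x - radial R y
      = (R / max R ‖x‖) • (x - y) + (R / max R ‖x‖ - R / max R ‖y‖) • y := by
    simp only [radial]; module
  rw [e]
  refine (norm_add_le _ _).trans ?_
  rw [norm_smul, norm_smul, Real.norm_of_nonneg (by positivity : 0 ≤ R / max R ‖x‖), two_mul]
  refine add_le_add (mul_le_of_le_one_left (norm_nonneg _)
    ((div_le_one hx).2 (le_max_left _ _))) ?_
  have h1 : ‖R / max R ‖x‖ - R / max R ‖y‖‖
      = R / max R ‖x‖ * (|max R ‖y‖ - max R ‖x‖| / max R ‖y‖) := by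
    rw [div_sub_div _ _ hx.ne' hy.ne', mul_comm (max R ‖x‖) R, ← mul_sub, Real.norm_eq_abs, abs_div,
      abs_mul, abs_of_pos hR, abs_of_pos (mul_pos hx hy)]
    field_simp
  have h2 : |max R ‖y‖ - max R ‖x‖| ≤ ‖x - y‖ := by
    rw [max_comm R, max_comm R]
    exact (abs_max_sub_max_le_abs _ _ _).trans
      ((abs_norm_sub_norm_le y x).trans_eq (norm_sub_rev _ _))
  have h3 : |max R ‖y‖ - max R ‖x‖| / max R ‖y‖ * ‖y‖ ≤ ‖x - y‖ := by
    rw [div_mul_eq_mul_div, div_le_iff₀ hy]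
    exact mul_le_mul h2 (le_max_right _ _) (norm_nonneg _) (norm_nonneg _)
  rw [h1, mul_assoc]
  exact (mul_le_of_le_one_left (by positivity) ((div_le_one hx).2 (le_max_left _ _))).trans h3

variable [CompleteSpace E]

/-- Picard–Lindelöf on a ball of radius M L, which a solution of speed at most M cannot leave before
x = L. -/
theorem exists_solution_of_bounded_lipschitz {F : E → E} {M K L : ℝ} (hL : 0 ≤ L)
    (hM : ∀ x, ‖F x‖ ≤ M) (hK : ∀ x y, ‖F x - F y‖ ≤ K * ‖x - y‖) (x₀ : E) :
    ∃ u : ℝ → E, u 0 = x₀ ∧ ∀ x ∈ Icc 0 L, HasDerivWithinAt u (F (u x)) (Icc 0 L) x := by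
  have hM0 : 0 ≤ M := (norm_nonneg _).trans (hM 0)
  have hPL : IsPicardLindelof (fun _ => F) (⟨0, le_rfl, hL⟩ : Icc 0 L) x₀ (M * L).toNNReal 0
      M.toNNReal K.toNNReal := by
    refine IsPicardLindelof.of_time_independent (fun x _ => ?_) ?_ ?_
    · rw [Real.coe_toNNReal _ hM0]; exact hM x
    · refine (LipschitzWith.of_dist_le_mul fun x y => ?_).lipschitzOnWith
      rw [dist_eq_norm, dist_eq_norm]
      exact (hK x y).trans (mul_le_mul_of_nonneg_right (Real.le_coe_toNNReal K) (norm_nonneg _))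
    · simp only [sub_zero, sub_self, NNReal.coe_zero]
      rw [max_eq_left hL, Real.coe_toNNReal _ hM0, Real.coe_toNNReal _ (by positivity)]
  exact hPL.exists_eq_forall_mem_Icc_hasDerivWithinAt₀

/-- Existence on `[0, L]` from an a priori estimate. -/
theorem exists_solution_of_inner_le {F : E → E} {M K C R L : ℝ} (hL : 0 ≤ L) (hR : 0 < R)
    (hC : 0 ≤ C) (hM : ∀ x, ‖x‖ ≤ R → ‖F x‖ ≤ M)
    (hK : ∀ x y, ‖x‖ ≤ R → ‖y‖ ≤ R → ‖F x - F y‖ ≤ K * ‖x - y‖)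
    (hF : ∀ x, ‖x‖ ≤ R → 2 * inner ℝ (F x) x ≤ C * ‖x‖ ^ 2) {x₀ : E}
    (hx₀ : Real.exp (C * L) * ‖x₀‖ ^ 2 ≤ R ^ 2) :
    ∃ u : ℝ → E, u 0 = x₀ ∧ (∀ x ∈ Icc 0 L, ‖u x‖ ^ 2 ≤ Real.exp (C * L) * ‖x₀‖ ^ 2) ∧
      (∀ x ∈ Icc 0 L, ‖u x‖ ≤ R) ∧
      ∀ x ∈ Icc 0 L, HasDerivWithinAt u (F (u x)) (Icc 0 L) x := by
  have hK0 : ∀ x y, ‖x‖ ≤ R → ‖y‖ ≤ R → ‖F x - F y‖ ≤ |K| * ‖x - y‖ := fun x y hx hy =>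
    (hK x y hx hy).trans (mul_le_mul_of_nonneg_right (le_abs_self K) (norm_nonneg _))
  -- Precomposition with the radial retraction makes the field globally bounded and Lipschitz.
  obtain ⟨u, hu0, hu⟩ := exists_solution_of_bounded_lipschitz (F := fun x => F (radial R x)) hL
    (fun x => hM _ (norm_radial_le hR x).1) (K := |K| * 2) (fun x y =>
      (hK0 _ _ (norm_radial_le hR x).1 (norm_radial_le hR y).1).trans
        ((mul_le_mul_of_nonneg_left (norm_radial_sub_le hR x y) (abs_nonneg K)).trans_eq
          (mul_assoc _ _ _).symm)) x₀
  have hb : ∀ x ∈ Icc 0 L, ‖u x‖ ^ 2 ≤ Real.exp (C * L) * ‖x₀‖ ^ 2 := by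
    have := norm_sq_le_of_inner_deriv_le hC le_rfl hu (fun x _ => ?_)
    · simpa [hu0] using this
    · set v := u x
      obtain ⟨h1, h2⟩ := norm_radial_le hR v
      -- Since v is a nonnegative multiple of its retraction, the inequality assumed on the ball
      -- also holds for the truncated field off the ball. The resulting bound keeps u in the ball,
      -- where the truncation is inactive.
      have h3 : v = (max R ‖v‖ / R) • radial R v := by
        have : 0 < max R ‖v‖ := lt_max_of_lt_left hR
        rw [radial, smul_smul, div_mul_div_cancel₀ hR.ne', div_self this.ne', one_smul]
      have h4 : 2 * inner ℝ (F (radial R v)) v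
          = max R ‖v‖ / R * (2 * inner ℝ (F (radial R v)) (radial R v)) := by
        conv_lhs => rw [h3, real_inner_smul_right, ← h3]
        ring
      have h5 : ‖v‖ = max R ‖v‖ / R * ‖radial R v‖ := by
        conv_lhs => rw [h3]
        rw [norm_smul, Real.norm_of_nonneg (by positivity)]
      rw [h4, add_zero]
      refine (mul_le_mul_of_nonneg_left (hF _ h1) (by positivity)).trans ?_
      calc max R ‖v‖ / R * (C * ‖radial R v‖ ^ 2)
          = C * ((max R ‖v‖ / R * ‖radial R v‖) * ‖radial R v‖) := by ring
        _ = C * (‖v‖ * ‖radial R v‖) := by rw [← h5]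
        _ ≤ C * ‖v‖ ^ 2 := by
          rw [sq]
          gcongr
  have hb' : ∀ x ∈ Icc 0 L, ‖u x‖ ≤ R := fun x hx =>
    le_of_sq_le_sq ((hb x hx).trans hx₀) hR.le
  refine ⟨u, hu0, hb, hb', fun x hx => ?_⟩
  have := hu x hx
  rwa [radial_eq hR (hb' x hx)] at this

end ODE

/-! ### Calculus of bounded Lipschitz maps -/

/-- `f` is bounded and Lipschitz on `s`. -/
def BddLipOn {X Y : Type*} [SeminormedAddCommGroup X] [SeminormedAddCommGroup Y] (s : Set X)
    (f : X → Y) : Prop :=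
  ∃ C, 0 ≤ C ∧ (∀ x ∈ s, ‖f x‖ ≤ C) ∧ ∀ x ∈ s, ∀ y ∈ s, ‖f x - f y‖ ≤ C * ‖x - y‖

namespace BddLipOn

variable {X Y Z W : Type*} [SeminormedAddCommGroup X] [SeminormedAddCommGroup Y]
  [SeminormedAddCommGroup Z] [SeminormedAddCommGroup W] {s : Set X}

theorem const (y : Y) : BddLipOn s fun _ => y :=
  ⟨‖y‖, norm_nonneg _, fun _ _ => le_rfl, fun _ _ _ _ => by
    rw [sub_self, norm_zero]; positivity⟩

theorem add {f g : X → Y} (hf : BddLipOn s f) (hg : BddLipOn s g) :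
    BddLipOn s fun x => f x + g x := by
  obtain ⟨C, h0, h1, h2⟩ := hf
  obtain ⟨C', h0', h1', h2'⟩ := hg
  refine ⟨C + C', by positivity, fun x hx => (norm_add_le _ _).trans
    (add_le_add (h1 x hx) (h1' x hx)), fun x hx y hy => ?_⟩
  rw [add_sub_add_comm, add_mul]
  exact (norm_add_le _ _).trans (add_le_add (h2 x hx y hy) (h2' x hx y hy))

theorem neg {f : X → Y} (hf : BddLipOn s f) : BddLipOn s fun x => -f x := by
  obtain ⟨C, h0, h1, h2⟩ := hf
  refine ⟨C, h0, fun x hx => by rw [norm_neg]; exact h1 x hx, fun x hx y hy => ?_⟩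
  rw [neg_sub_neg, norm_sub_rev]
  exact h2 x hx y hy

theorem sub {f g : X → Y} (hf : BddLipOn s f) (hg : BddLipOn s g) :
    BddLipOn s fun x => f x - g x := by
  simpa only [sub_eq_add_neg] using hf.add hg.neg

theorem sum {ι : Type*} {t : Finset ι} {f : ι → X → Y} (hf : ∀ i ∈ t, BddLipOn s (f i)) :
    BddLipOn s fun x => ∑ i ∈ t, f i x := by
  classical
  induction t using Finset.induction_on with
  | empty => simpa using const (0 : Y)
  | insert i t hi ih =>
    simp only [Finset.sum_insert hi]
    exact (hf i (Finset.mem_insert_self i t)).add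
      (ih fun j hj => hf j (Finset.mem_insert_of_mem hj))

/-- Composition with a map which is bounded and Lipschitz by a linear growth estimate. -/
theorem comp_of_le {f : X → Y} (hf : BddLipOn s f) {φ : Y → Z} {c : ℝ}
    (hb : ∃ b, ∀ C, 0 ≤ C → ∀ y, ‖y‖ ≤ C → ‖φ y‖ ≤ b + c * C)
    (hl : ∀ y y', ‖φ y - φ y'‖ ≤ c * ‖y - y'‖) : BddLipOn s fun x => φ (f x) := by
  obtain ⟨C, h0, h1, h2⟩ := hf
  obtain ⟨b, hb⟩ := hb
  refine ⟨|b| + |c| * C, by positivity, fun x hx => (hb C h0 _ (h1 x hx)).trans ?_,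
    fun x hx y hy => (hl _ _).trans ?_⟩
  · gcongr <;> exact le_abs_self _
  · refine (mul_le_mul (le_abs_self c) (h2 x hx y hy) (norm_nonneg _) (abs_nonneg _)).trans ?_
    rw [← mul_assoc]
    refine mul_le_mul_of_nonneg_right ?_ (norm_nonneg _)
    linarith [abs_nonneg b]

theorem clm [NormedSpace ℝ Y] [NormedSpace ℝ Z] (A : Y →L[ℝ] Z) {f : X → Y} (hf : BddLipOn s f) :
    BddLipOn s fun x => A (f x) :=
  hf.comp_of_le (c := ‖A‖) ⟨0, fun C hC y hy => by
    rw [zero_add]; exact (A.le_opNorm y).trans (mul_le_mul_of_nonneg_left hy (norm_nonneg _))⟩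
    fun y y' => by rw [← map_sub]; exact A.le_opNorm _

theorem bilin {f : X → Y} {g : X → Z} (hf : BddLipOn s f) (hg : BddLipOn s g) {B : Y → Z → W}
    (hB : ∀ y z, ‖B y z‖ ≤ ‖y‖ * ‖z‖)
    (hBl : ∀ y y' z, B y z - B y' z = B (y - y') z)
    (hBr : ∀ y z z', B y z - B y z' = B y (z - z')) : BddLipOn s fun x => B (f x) (g x) := by
  obtain ⟨C, h0, h1, h2⟩ := hf
  obtain ⟨C', h0', h1', h2'⟩ := hg
  refine ⟨C * C' + C * C', by positivity, fun x hx => ?_, fun x hx y hy => ?_⟩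
  · have := (hB (f x) (g x)).trans (mul_le_mul (h1 x hx) (h1' x hx) (norm_nonneg _) h0)
    have h3 : 0 ≤ C * C' := by positivity
    linarith
  · rw [← sub_add_sub_cancel _ (B (f x) (g y)), hBl, hBr]
    refine (norm_add_le _ _).trans ?_
    rw [add_mul]
    refine add_le_add ?_ ?_
    · refine (hB _ _).trans ((mul_le_mul (h1 x hx) (h2' x hx y hy) (norm_nonneg _) h0).trans_eq ?_)
      ring
    · refine (hB _ _).trans ((mul_le_mul (h2 x hx y hy) (h1' y hy) (norm_nonneg _)
        (by positivity)).trans_eq ?_)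
      ring

theorem mul {f g : X → BC} (hf : BddLipOn s f) (hg : BddLipOn s g) :
    BddLipOn s fun x => f x * g x :=
  hf.bilin hg norm_mul_le (fun _ _ _ => (sub_mul _ _ _).symm) fun _ _ _ => (mul_sub _ _ _).symm

theorem smul {T : ℝ} {f : X → BC} {g : X → ScalarL2 T} (hf : BddLipOn s f) (hg : BddLipOn s g) :
    BddLipOn s fun x => f x • g x :=
  hf.bilin hg norm_bc_smul_le (fun _ _ _ => by module) fun _ _ _ => by module

theorem recip {κ : ℝ} (hκ : 0 < κ) {f : X → BC} (hf : BddLipOn s f) :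
    BddLipOn s fun x => recip hκ (f x) :=
  hf.comp_of_le (c := κ⁻¹ * κ⁻¹) ⟨κ⁻¹, fun C hC y _ => (norm_recip_le hκ y).trans (by
    have : 0 ≤ κ⁻¹ * κ⁻¹ * C := by positivity
    linarith)⟩ (norm_recip_sub_recip_le hκ)

end BddLipOn

end SupersonicDuct

namespace SupersonicDuct

variable {T : ℝ}

/-! ### The system differentiated twice in time -/

/-- Pairs of real-valued `L²` functions on `(0, T)`. -/
abbrev Pair (T : ℝ) : Type := PiLp 2 (fun _ : Fin 2 => ScalarL2 T)

theorem emb_eq_smul_one (f : BC) : emb T f = f • emb T 1 := by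
  rw [bc_smul_emb, mul_one]

/-- The coefficients of the diagonal system
`∂ₓ mᵢ + λᵢ⁻¹ ∂ₜ mᵢ = λᵢ⁻¹ β (m₁ + m₂)` with speeds `λᵢ = μᵢ + ∑ⱼ ℓᵢⱼ mⱼ`, together with their
time derivatives. -/
structure Coeffs (T : ℝ) where
  κ : ℝ
  κ_pos : 0 < κ
  β : BC
  β' : BC
  β'' : ScalarL2 T
  isPrim_β : IsPrim β (emb T β')
  isPrim_β' : IsPrim β' β''
  μ : Fin 2 → BC
  μ' : Fin 2 → BC
  μ'' : Fin 2 → ScalarL2 T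
  isPrim_μ : ∀ i, IsPrim (μ i) (emb T (μ' i))
  isPrim_μ' : ∀ i, IsPrim (μ' i) (μ'' i)
  ℓ : Fin 2 → Fin 2 → ℝ
  μ_ge : ∀ i, ∀ t ∈ Icc 0 T, 2 * κ ≤ μ i t

namespace Coeffs

variable (c : Coeffs T)

/-- `∂ₜ m` as a function of `h = ∂ₜ² m`. -/
noncomputable def p (u : Pair T × Pair T) (j : Fin 2) : BC := prim (u.1 j)

/-- `m` as a function of `h = ∂ₜ² m`. -/
noncomputable def m (u : Pair T × Pair T) (j : Fin 2) : BC := prim (volterra T (u.1 j))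

/-- The speed `λᵢ`. -/
noncomputable def lam (u : Pair T × Pair T) (i : Fin 2) : BC := c.μ i + ∑ j, c.ℓ i j • m u j

/-- `∂ₜ λᵢ`. -/
noncomputable def dlam (u : Pair T × Pair T) (i : Fin 2) : BC := c.μ' i + ∑ j, c.ℓ i j • p u j

/-- `∂ₜ² λᵢ`. -/
noncomputable def ddlam (u : Pair T × Pair T) (i : Fin 2) : ScalarL2 T :=
  c.μ'' i + ∑ j, c.ℓ i j • u.1 j

/-- `λᵢ⁻¹`. -/
noncomputable def a (u : Pair T × Pair T) (i : Fin 2) : BC := recip c.κ_pos (c.lam u i)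

/-- `∂ₜ λᵢ⁻¹`. -/
noncomputable def da (u : Pair T × Pair T) (i : Fin 2) : BC :=
  -(c.a u i * c.a u i * c.dlam u i)

/-- `β (m₁ + m₂) - ∫₀ᵗ kᵢ`, where `k` stands for an approximation of `∂ₜ² m`. -/
noncomputable def q (u : Pair T × Pair T) (i : Fin 2) : BC :=
  c.β * ∑ j, m u j - prim (u.2 i)

/-- `∂ₜ qᵢ`. -/
noncomputable def dq (u : Pair T × Pair T) (i : Fin 2) : ScalarL2 T :=
  emb T (c.β' * ∑ j, m u j + c.β * ∑ j, p u j) - u.2 i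

/-- `∂ₓ mᵢ` according to the system. -/
noncomputable def y (u : Pair T × Pair T) (i : Fin 2) : BC := c.a u i * c.q u i

/-- `∂ₜ ∂ₓ mᵢ` according to the system. -/
noncomputable def dy (u : Pair T × Pair T) (i : Fin 2) : ScalarL2 T :=
  c.a u i • (c.dq u i - c.y u i • emb T (c.dlam u i))

/-- The terms of `∂ₜ² ∂ₓ mᵢ` that contain no third derivative. -/
noncomputable def G (u : Pair T × Pair T) (i : Fin 2) : ScalarL2 T :=
  c.a u i • ((∑ j, m u j) • c.β'' + (2 : ℝ) • emb T (c.β' * ∑ j, p u j) + c.β • ∑ j, u.1 j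
    - (2 : ℝ) • c.dlam u i • c.dy u i - c.y u i • c.ddlam u i)

/-- Pairs of pairs of norm at most `R`. -/
def ball (T R : ℝ) : Set (Pair T × Pair T) := {u | ‖u.1‖ ≤ R ∧ ‖u.2‖ ≤ R}

section BddLip

variable (R : ℝ)

theorem bddLipOn_id : BddLipOn (ball T R) id :=
  ⟨max R 1, by positivity, fun u hu => by
    rw [id, Prod.norm_def]
    exact max_le (hu.1.trans (le_max_left _ _)) (hu.2.trans (le_max_left _ _)),
    fun u _ v _ => le_mul_of_one_le_left (norm_nonneg _) (le_max_right _ _)⟩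

theorem bddLipOn_fst (j : Fin 2) : BddLipOn (ball T R) fun u => u.1 j :=
  (bddLipOn_id R).clm ((PiLp.proj 2 (𝕜 := ℝ) (fun _ : Fin 2 => ScalarL2 T) j).comp
    (ContinuousLinearMap.fst ℝ (Pair T) (Pair T)))

theorem bddLipOn_snd (j : Fin 2) : BddLipOn (ball T R) fun u => u.2 j :=
  (bddLipOn_id R).clm ((PiLp.proj 2 (𝕜 := ℝ) (fun _ : Fin 2 => ScalarL2 T) j).comp
    (ContinuousLinearMap.snd ℝ (Pair T) (Pair T)))

theorem _root_.SupersonicDuct.BddLipOn.const_smul {X Y : Type*} [SeminormedAddCommGroup X]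
    [NormedAddCommGroup Y] [NormedSpace ℝ Y] {s : Set X} (r : ℝ) {f : X → Y} (hf : BddLipOn s f) :
    BddLipOn s fun x => r • f x :=
  hf.clm (r • ContinuousLinearMap.id ℝ Y)

theorem bddLipOn_p (j : Fin 2) : BddLipOn (ball T R) fun u => p u j :=
  (bddLipOn_fst R j).clm prim

theorem bddLipOn_m (j : Fin 2) : BddLipOn (ball T R) fun u => m u j :=
  ((bddLipOn_fst R j).clm (volterra T)).clm prim

theorem bddLipOn_sum_p : BddLipOn (ball T R) fun u => ∑ j, p u j :=
  .sum fun j _ => bddLipOn_p R j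

theorem bddLipOn_sum_m : BddLipOn (ball T R) fun u => ∑ j, m u j :=
  .sum fun j _ => bddLipOn_m R j

theorem bddLipOn_lam (i : Fin 2) : BddLipOn (ball T R) fun u => c.lam u i :=
  (BddLipOn.const _).add (.sum fun j _ => (bddLipOn_m R j).const_smul _)

theorem bddLipOn_dlam (i : Fin 2) : BddLipOn (ball T R) fun u => c.dlam u i :=
  (BddLipOn.const _).add (.sum fun j _ => (bddLipOn_p R j).const_smul _)

theorem bddLipOn_ddlam (i : Fin 2) : BddLipOn (ball T R) fun u => c.ddlam u i :=
  (BddLipOn.const _).add (.sum fun j _ => (bddLipOn_fst R j).const_smul _)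

theorem bddLipOn_a (i : Fin 2) : BddLipOn (ball T R) fun u => c.a u i :=
  (c.bddLipOn_lam R i).recip c.κ_pos

theorem bddLipOn_da (i : Fin 2) : BddLipOn (ball T R) fun u => c.da u i :=
  (((c.bddLipOn_a R i).mul (c.bddLipOn_a R i)).mul (c.bddLipOn_dlam R i)).neg

theorem bddLipOn_q (i : Fin 2) : BddLipOn (ball T R) fun u => c.q u i :=
  ((BddLipOn.const _).mul (bddLipOn_sum_m R)).sub ((bddLipOn_snd R i).clm prim)

theorem bddLipOn_dq (i : Fin 2) : BddLipOn (ball T R) fun u => c.dq u i :=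
  ((((BddLipOn.const _).mul (bddLipOn_sum_m R)).add
    ((BddLipOn.const _).mul (bddLipOn_sum_p R))).clm (emb T)).sub (bddLipOn_snd R i)

theorem bddLipOn_y (i : Fin 2) : BddLipOn (ball T R) fun u => c.y u i :=
  (c.bddLipOn_a R i).mul (c.bddLipOn_q R i)

theorem bddLipOn_dy (i : Fin 2) : BddLipOn (ball T R) fun u => c.dy u i :=
  (c.bddLipOn_a R i).smul ((c.bddLipOn_dq R i).sub
    ((c.bddLipOn_y R i).smul ((c.bddLipOn_dlam R i).clm (emb T))))

theorem bddLipOn_G (i : Fin 2) : BddLipOn (ball T R) fun u => c.G u i :=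
  (c.bddLipOn_a R i).smul ((((((bddLipOn_sum_m R).smul (.const _)).add
    ((((BddLipOn.const _).mul (bddLipOn_sum_p R)).clm (emb T)).const_smul 2)).add
    ((BddLipOn.const c.β).smul (.sum fun j _ => bddLipOn_fst R j))).sub
    (((c.bddLipOn_dlam R i).smul (c.bddLipOn_dy R i)).const_smul 2)).sub
    ((c.bddLipOn_y R i).smul (c.bddLipOn_ddlam R i)))

end BddLip

theorem _root_.SupersonicDuct.IsPrim.sum {ι : Type*} {t : Finset ι} {f : ι → BC}
    {g : ι → ScalarL2 T} (h : ∀ i ∈ t, IsPrim (f i) (g i)) :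
    IsPrim (∑ i ∈ t, f i) (∑ i ∈ t, g i) := by
  classical
  induction t using Finset.induction_on with
  | empty => exact fun s _ => by simp
  | insert i t hi ih =>
    simp only [Finset.sum_insert hi]
    exact (h i (Finset.mem_insert_self i t)).add
      (ih fun j hj => h j (Finset.mem_insert_of_mem hj))

variable {c} {u : Pair T × Pair T} {i : Fin 2}

theorem isPrim_p (u : Pair T × Pair T) (j : Fin 2) : IsPrim (p u j) (u.1 j) := isPrim_prim _

theorem isPrim_m (u : Pair T × Pair T) (j : Fin 2) : IsPrim (m u j) (emb T (p u j)) :=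
  isPrim_prim _

theorem isPrim_lam : IsPrim (c.lam u i) (emb T (c.dlam u i)) :=
  ((c.isPrim_μ i).add (.sum fun j _ => (isPrim_m u j).smul (c.ℓ i j))).congr
    (by simp [dlam, map_add])

theorem isPrim_dlam : IsPrim (c.dlam u i) (c.ddlam u i) :=
  (c.isPrim_μ' i).add (.sum fun j _ => (isPrim_p u j).smul (c.ℓ i j))

theorem isPrim_a (h : ∀ t ∈ Icc 0 T, c.κ ≤ c.lam u i t) :
    IsPrim (c.a u i) (emb T (c.da u i)) :=
  isPrim_lam.recip c.κ_pos h

theorem isPrim_q : IsPrim (c.q u i) (c.dq u i) :=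
  ((c.isPrim_β.mul (.sum fun j _ => isPrim_m u j)).sub (isPrim_prim (u.2 i))).congr (by
    rw [dq, ← map_sum, bc_smul_emb, bc_smul_emb, ← map_add, add_comm, mul_comm c.β'])

@[simp]
theorem m_zero (u : Pair T × Pair T) (j : Fin 2) : m u j 0 = 0 := prim_zero_apply _

@[simp]
theorem p_zero (u : Pair T × Pair T) (j : Fin 2) : p u j 0 = 0 := prim_zero_apply _

theorem q_zero (u : Pair T × Pair T) (i : Fin 2) : c.q u i 0 = 0 := by
  simp [q]

theorem y_zero (u : Pair T × Pair T) (i : Fin 2) : c.y u i 0 = 0 := by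
  simp [y, q_zero]

theorem isPrim_y (h : ∀ t ∈ Icc 0 T, c.κ ≤ c.lam u i t) : IsPrim (c.y u i) (c.dy u i) :=
  ((isPrim_a h).mul isPrim_q).congr (by
    rw [dy, da, emb_eq_smul_one (-_), emb_eq_smul_one (c.dlam u i), y]
    module)

/-- The right-hand side y vanishes at t = 0, so it is recovered from its derivative by J: the zero
initial value is preserved along x. -/
theorem volterra_dy (h : ∀ t ∈ Icc 0 T, c.κ ≤ c.lam u i t) :
    volterra T (c.dy u i) = emb T (c.y u i) :=
  (isPrim_y h).volterra_eq (y_zero u i)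

/-- The second time derivative of the right-hand side, when the approximation of `∂ₜ² m` is itself
differentiable in time. -/
theorem volterra_ddy (h : ∀ t ∈ Icc 0 T, c.κ ≤ c.lam u i t) {w : ScalarL2 T}
    (hw : u.2 i = volterra T w) :
    volterra T (c.G u i - c.a u i • w) = c.dy u i := by
  -- As u.2 i is itself a primitive, dq and dy have continuous representatives Q and Y, and Y can be
  -- differentiated once more; w enters only through −a w.
  let Q : BC := c.β' * ∑ j, m u j + c.β * ∑ j, p u j - prim w
  have hQ : emb T Q = c.dq u i := by rw [dq, hw, map_sub]; rfl
  have hQp : IsPrim Q ((∑ j, m u j) • c.β'' + (2 : ℝ) • emb T (c.β' * ∑ j, p u j)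
      + c.β • ∑ j, u.1 j - w) :=
    (((c.isPrim_β'.mul (.sum fun j _ => isPrim_m u j)).add
      (c.isPrim_β.mul (.sum fun j _ => isPrim_p u j))).sub (isPrim_prim w)).congr (by
        rw [← map_sum, emb_eq_smul_one c.β', emb_eq_smul_one (_ * _),
          emb_eq_smul_one (∑ j, p u j), two_smul]
        module)
  let Y : BC := c.a u i * (Q - c.dlam u i * c.y u i)
  have hY : emb T Y = c.dy u i := by
    rw [dy, ← hQ, bc_smul_emb, ← map_sub, bc_smul_emb, mul_comm (c.y u i)]
  have hYp : IsPrim Y (c.G u i - c.a u i • w) :=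
    ((isPrim_a h).mul (hQp.sub (isPrim_dlam.mul (isPrim_y h)))).congr (by
      rw [G, ← hY]
      simp only [Y, da]
      rw [emb_eq_smul_one (-_), emb_eq_smul_one (c.a u i * _), two_smul, two_smul]
      module)
  rw [← hY]
  refine hYp.volterra_eq ?_
  simp [Y, Q, y_zero]

theorem y_at_zero : c.y (0 : Pair T × Pair T) i = 0 := by
  simp [y, q, m]

theorem dy_at_zero : c.dy (0 : Pair T × Pair T) i = 0 := by
  have hm : ∀ j, m (0 : Pair T × Pair T) j = 0 := fun j => by simp [m]
  have hp : ∀ j, p (0 : Pair T × Pair T) j = 0 := fun j => by simp [p]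
  simp only [dy, dq, hm, hp, y_at_zero, Finset.sum_const_zero, mul_zero, add_zero, map_zero]
  simp
  module

/-- The state m = 0 is an equilibrium. Combined with the Lipschitz bound this makes G linearly
small, so the energy inequality has no constant term. -/
theorem G_zero : c.G 0 i = 0 := by
  have hm : ∀ j, m (0 : Pair T × Pair T) j = 0 := fun j => by simp [m]
  have hp : ∀ j, p (0 : Pair T × Pair T) j = 0 := fun j => by simp [p]
  simp only [G, hm, hp, y_at_zero, dy_at_zero, Finset.sum_const_zero, mul_zero, map_zero]
  simp
  module

end Coeffs

end SupersonicDuct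

namespace SupersonicDuct

variable {T : ℝ}

/-! ### Operators on pairs, and the commutator with transport -/

theorem norm_sq_pair (v : Pair T) : ‖v‖ ^ 2 = ‖v 0‖ ^ 2 + ‖v 1‖ ^ 2 := by
  rw [PiLp.norm_sq_eq_of_L2, Fin.sum_univ_two]

theorem norm_apply_le_pair (v : Pair T) (i : Fin 2) : ‖v i‖ ≤ ‖v‖ :=
  PiLp.norm_apply_le v i

theorem norm_pair_le (v : Pair T) : ‖v‖ ≤ ‖v 0‖ + ‖v 1‖ :=
  le_of_sq_le_sq (by
    rw [norm_sq_pair]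
    nlinarith [mul_nonneg (norm_nonneg (v 0)) (norm_nonneg (v 1))]) (by positivity)

theorem inner_pair (v w : Pair T) : inner ℝ v w = ∑ i, inner ℝ (v i) (w i) :=
  PiLp.inner_apply v w

/-- The componentwise action of an operator on pairs. -/
noncomputable def onPair (A : ScalarL2 T →L[ℝ] ScalarL2 T) : Pair T →L[ℝ] Pair T :=
  ((PiLp.continuousLinearEquiv 2 ℝ (fun _ : Fin 2 => ScalarL2 T)).symm :
      (Fin 2 → ScalarL2 T) →L[ℝ] Pair T).comp
    (ContinuousLinearMap.pi fun i =>
      A.comp (PiLp.proj 2 (𝕜 := ℝ) (fun _ : Fin 2 => ScalarL2 T) i))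

@[simp]
theorem onPair_apply (A : ScalarL2 T →L[ℝ] ScalarL2 T) (v : Pair T) (i : Fin 2) :
    onPair A v i = A (v i) := rfl

theorem norm_onPair_le {A : ScalarL2 T →L[ℝ] ScalarL2 T} {C : ℝ} (hC : 0 ≤ C)
    (hA : ∀ h, ‖A h‖ ≤ C * ‖h‖) (v : Pair T) : ‖onPair A v‖ ≤ C * ‖v‖ := by
  refine le_of_sq_le_sq ?_ (by positivity)
  rw [mul_pow, norm_sq_pair, norm_sq_pair, onPair_apply, onPair_apply]
  have h0 := pow_le_pow_left₀ (norm_nonneg _) (hA (v 0)) 2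
  have h1 := pow_le_pow_left₀ (norm_nonneg _) (hA (v 1)) 2
  nlinarith

theorem BddLipOn.comp_map {X X' Y : Type*} [SeminormedAddCommGroup X] [SeminormedAddCommGroup X']
    [SeminormedAddCommGroup Y] {s : Set X} {s' : Set X'} {f : X → Y} (hf : BddLipOn s f)
    {g : X' → X} (hg : MapsTo g s' s) (hl : ∀ x y, ‖g x - g y‖ ≤ ‖x - y‖) :
    BddLipOn s' fun x => f (g x) := by
  obtain ⟨C, h0, h1, h2⟩ := hf
  exact ⟨C, h0, fun x hx => h1 _ (hg hx), fun x hx y hy =>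
    (h2 _ (hg hx) _ (hg hy)).trans (mul_le_mul_of_nonneg_left (hl x y) h0)⟩

theorem BddLipOn.toPair {X : Type*} [SeminormedAddCommGroup X] {s : Set X}
    {f : X → Fin 2 → ScalarL2 T} (hf : ∀ i, BddLipOn s fun x => f x i) :
    BddLipOn s fun x => (WithLp.toLp 2 (f x) : Pair T) := by
  obtain ⟨C, h0, h1, h2⟩ := hf 0
  obtain ⟨C', h0', h1', h2'⟩ := hf 1
  refine ⟨C + C', by positivity, fun x hx => (norm_pair_le _).trans
    (add_le_add (h1 x hx) (h1' x hx)), fun x hx y hy => ?_⟩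
  rw [add_mul]
  exact (norm_pair_le _).trans (add_le_add (h2 x hx y hy) (h2' x hx y hy))

/-- The smoothing operator `(1 + ρ ∂ₜ)⁻¹`. -/
noncomputable def smoothing (T ρ : ℝ) : ScalarL2 T →L[ℝ] ScalarL2 T :=
  (volterra T).comp (yosida T ρ)

theorem smoothing_apply (ρ : ℝ) (h : ScalarL2 T) :
    smoothing T ρ h = volterra T (yosida T ρ h) := rfl

/-- The operator `1 - (1 + ρ ∂ₜ)⁻¹ = ρ ∂ₜ (1 + ρ ∂ₜ)⁻¹`. -/
noncomputable def defect (T ρ : ℝ) : ScalarL2 T →L[ℝ] ScalarL2 T := ρ • yosida T ρ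

theorem defect_apply (ρ : ℝ) (h : ScalarL2 T) : defect T ρ h = ρ • yosida T ρ h := rfl

theorem sub_smoothing_eq_defect (hT : 0 < T) {ρ : ℝ} (hρ : 0 < ρ) (h : ScalarL2 T) :
    h - smoothing T ρ h = defect T ρ h := sub_smoothing hT hρ h

theorem norm_onPair_smoothing_le (hT : 0 < T) {ρ : ℝ} (hρ : 0 < ρ) (v : Pair T) :
    ‖onPair (smoothing T ρ) v‖ ≤ ‖v‖ := by
  simpa using norm_onPair_le zero_le_one
    (fun h => by rw [one_mul]; exact norm_smoothing_le hT hρ h) v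

/-- The commutator equals smoothing_ρ (b' · smoothing_δ (defect_ρ h)): one derivative falls on b,
and both resolvents turn into contractions. Hence no negative power of ρ or δ appears. -/
theorem norm_defect_transport_le (hT : 0 < T) {ρ δ : ℝ} (hρ : 0 < ρ) (hδ : 0 < δ) {b b' : BC}
    (hb : IsPrim b (emb T b')) (h : ScalarL2 T) :
    ‖defect T ρ (b • yosida T δ h) - b • yosida T δ (defect T ρ h)‖ ≤ ‖b'‖ * ‖defect T ρ h‖ := by
  set w := yosida T δ h with hw
  have e : yosida T δ (defect T ρ h) = ρ • yosida T ρ w := by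
    rw [defect_apply, (yosida T δ).map_smul, hw, yosida_comm hT hρ hδ]
  have h1 : defect T ρ (b • w) - b • yosida T δ (defect T ρ h)
      = smoothing T ρ (b' • smoothing T δ (defect T ρ h)) := by
    have h2 : b' • smoothing T δ (defect T ρ h) = ρ • prim (yosida T ρ w) • emb T b' := by
      rw [smoothing_apply, e, (volterra T).map_smul, ← smul_comm ρ b', volterra_apply, bc_smul_emb,
        bc_smul_emb, mul_comm]
    rw [h2, (smoothing T ρ).map_smul, ← sub_smoothing_eq_defect hT hρ, smoothing_apply,
      smoothing_smul hT hρ hb, e, ← sub_smoothing hT hρ, bc_smul_sub, smoothing_apply]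
    abel
  rw [h1]
  refine (norm_smoothing_le hT hρ _).trans ((norm_bc_smul_le _ _).trans ?_)
  exact mul_le_mul_of_nonneg_left (norm_smoothing_le hT hδ _) (norm_nonneg _)

theorem norm_emb_le_of_abs_le {f g : BC} {C : ℝ} (h : ∀ t, |f t| ≤ C * |g t|) :
    ‖emb T f‖ ≤ C * ‖emb T g‖ := by
  refine Lp.norm_le_mul_norm_of_ae_le_mul ?_
  filter_upwards [coeFn_emb (T := T) f, coeFn_emb (T := T) g] with t h1 h2
  rw [h1, h2]
  exact h t

/-! ### Uniform time regularity of nonlinear expressions -/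

section Regularity

/-- The size of `u` not seen after smoothing at scale `ρ`. -/
noncomputable def defectSum (ρ : ℝ) (u : Pair T × Pair T) : ℝ :=
  ∑ j, (‖defect T ρ (u.1 j)‖ + ‖defect T ρ (u.2 j)‖)

theorem defectSum_nonneg (ρ : ℝ) (u : Pair T × Pair T) : 0 ≤ defectSum ρ u :=
  Finset.sum_nonneg fun _ _ => by positivity

/-- `f u` is, uniformly for `u ∈ s`, at least as regular in time as `u`. -/
def RegOn (s : Set (Pair T × Pair T)) (f : Pair T × Pair T → ScalarL2 T) : Prop :=
  ∃ C, 0 ≤ C ∧ ∃ η : ℝ → ℝ, Filter.Tendsto η (nhdsWithin 0 (Ioi 0)) (nhds 0) ∧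
    (∀ u ∈ s, ‖f u‖ ≤ C) ∧
    ∀ ρ, 0 < ρ → ∀ u ∈ s, ‖defect T ρ (f u)‖ ≤ C * defectSum ρ u + η ρ

/-- The functions `f u`, `u ∈ s`, are bounded in the Sobolev space `H¹`. -/
def PrimBddOn (s : Set (Pair T × Pair T)) (f : Pair T × Pair T → BC) : Prop :=
  ∃ (f' : Pair T × Pair T → ScalarL2 T) (C : ℝ), 0 ≤ C ∧
    ∀ u ∈ s, IsPrim (f u) (f' u) ∧ ‖f u‖ ≤ C ∧ ‖f' u‖ ≤ C

variable {s : Set (Pair T × Pair T)}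

theorem RegOn.const (hT : 0 < T) (k : ScalarL2 T) : RegOn s fun _ => k :=
  ⟨‖k‖, norm_nonneg _, fun ρ => ‖defect T ρ k‖, tendsto_defect hT k, fun _ _ => le_rfl,
    fun ρ _ u _ => le_add_of_nonneg_left (mul_nonneg (norm_nonneg _) (defectSum_nonneg ρ u))⟩

theorem RegOn.add {f g : Pair T × Pair T → ScalarL2 T} (hf : RegOn s f) (hg : RegOn s g) :
    RegOn s fun u => f u + g u := by
  obtain ⟨C, h0, η, h1, h2, h3⟩ := hf
  obtain ⟨C', h0', η', h1', h2', h3'⟩ := hg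
  refine ⟨C + C', by positivity, fun ρ => η ρ + η' ρ, by simpa using h1.add h1', fun u hu =>
    (norm_add_le _ _).trans (add_le_add (h2 u hu) (h2' u hu)), fun ρ hρ u hu => ?_⟩
  rw [map_add]
  refine (norm_add_le _ _).trans ((add_le_add (h3 ρ hρ u hu) (h3' ρ hρ u hu)).trans_eq ?_)
  ring

theorem RegOn.const_smul (r : ℝ) {f : Pair T × Pair T → ScalarL2 T} (hf : RegOn s f) :
    RegOn s fun u => r • f u := by
  obtain ⟨C, h0, η, h1, h2, h3⟩ := hf
  refine ⟨|r| * C, by positivity, fun ρ => |r| * η ρ, by simpa using h1.const_mul |r|,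
    fun u hu => ?_, fun ρ hρ u hu => ?_⟩
  · rw [norm_smul]
    exact mul_le_mul_of_nonneg_left (h2 u hu) (norm_nonneg _)
  · rw [map_smul, norm_smul]
    refine (mul_le_mul_of_nonneg_left (h3 ρ hρ u hu) (norm_nonneg _)).trans_eq ?_
    rw [Real.norm_eq_abs]
    ring

theorem RegOn.sub {f g : Pair T × Pair T → ScalarL2 T} (hf : RegOn s f) (hg : RegOn s g) :
    RegOn s fun u => f u - g u := by
  simpa only [sub_eq_add_neg, neg_one_smul] using hf.add (hg.const_smul (-1))

theorem RegOn.sum {ι : Type*} (hT : 0 < T) {t : Finset ι} {f : ι → Pair T × Pair T → ScalarL2 T}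
    (hf : ∀ i ∈ t, RegOn s (f i)) : RegOn s fun u => ∑ i ∈ t, f i u := by
  classical
  induction t using Finset.induction_on with
  | empty => simpa using RegOn.const hT 0
  | insert i t hi ih =>
    simp only [Finset.sum_insert hi]
    exact (hf i (Finset.mem_insert_self i t)).add
      (ih fun j hj => hf j (Finset.mem_insert_of_mem hj))

/-- A coefficient bounded in H¹ costs only the O(√ρ) commutator of `norm_defect_smul_le`, which is
uniform on s and goes into η. -/
theorem RegOn.smul (hT : 0 < T) {A : Pair T × Pair T → BC} {f : Pair T × Pair T → ScalarL2 T}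
    (hA : PrimBddOn s A) (hf : RegOn s f) : RegOn s fun u => A u • f u := by
  obtain ⟨A', K, hK, hA⟩ := hA
  obtain ⟨C, h0, η, h1, h2, h3⟩ := hf
  refine ⟨K * C, by positivity, fun ρ => K * |η ρ| + Real.sqrt (2 * ρ) * (K * C), ?_,
    fun u hu => (norm_bc_smul_le _ _).trans
      (mul_le_mul (hA u hu).2.1 (h2 u hu) (norm_nonneg _) hK), fun ρ hρ u hu => ?_⟩
  · have h4 : Filter.Tendsto (fun ρ : ℝ => Real.sqrt (2 * ρ) * (K * C)) (nhdsWithin 0 (Ioi 0))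
        (nhds (Real.sqrt (2 * 0) * (K * C))) :=
      ((Real.continuous_sqrt.comp (continuous_const.mul continuous_id)).mul
        continuous_const).continuousAt.tendsto.mono_left nhdsWithin_le_nhds
    simpa using (h1.abs.const_mul K).add h4
  · obtain ⟨hp, hb, hb'⟩ := hA u hu
    refine (norm_defect_smul_le hT hρ hp (f u)).trans ?_
    have h4 : ‖ρ • yosida T ρ (f u)‖ ≤ C * defectSum ρ u + |η ρ| :=
      (h3 ρ hρ u hu).trans (add_le_add_right (le_abs_self _) _)
    have h5 := mul_le_mul hb h4 (norm_nonneg _) hK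
    have h6 := mul_le_mul_of_nonneg_left (mul_le_mul hb' (h2 u hu) (norm_nonneg _) hK)
      (Real.sqrt_nonneg (2 * ρ))
    linarith

theorem RegOn.fst (j : Fin 2) (R : ℝ) : RegOn (Coeffs.ball T R) fun u => u.1 j := by
  -- One constant serves both clauses: it must exceed R for the norm and 1 for the defect.
  refine ⟨|R| + 1, by positivity, fun _ => 0, tendsto_const_nhds, fun u hu => ?_,
    fun ρ _ u _ => ?_⟩
  · have := (norm_apply_le_pair u.1 j).trans (hu.1.trans (le_abs_self R))
    linarith
  · have h1 : ‖defect T ρ (u.1 j)‖ ≤ defectSum ρ u :=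
      (le_add_of_nonneg_right (norm_nonneg (defect T ρ (u.2 j)))).trans
        (Finset.single_le_sum (f := fun j => ‖defect T ρ (u.1 j)‖ + ‖defect T ρ (u.2 j)‖)
          (fun _ _ => by positivity) (Finset.mem_univ j))
    nlinarith [defectSum_nonneg ρ u, abs_nonneg R]

theorem RegOn.snd (j : Fin 2) (R : ℝ) : RegOn (Coeffs.ball T R) fun u => u.2 j := by
  refine ⟨|R| + 1, by positivity, fun _ => 0, tendsto_const_nhds, fun u hu => ?_,
    fun ρ _ u _ => ?_⟩
  · have := (norm_apply_le_pair u.2 j).trans (hu.2.trans (le_abs_self R))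
    linarith
  · have h1 : ‖defect T ρ (u.2 j)‖ ≤ defectSum ρ u :=
      (le_add_of_nonneg_left (norm_nonneg (defect T ρ (u.1 j)))).trans
        (Finset.single_le_sum (f := fun j => ‖defect T ρ (u.1 j)‖ + ‖defect T ρ (u.2 j)‖)
          (fun _ _ => by positivity) (Finset.mem_univ j))
    nlinarith [defectSum_nonneg ρ u, abs_nonneg R]

theorem PrimBddOn.of_bddLipOn {f : Pair T × Pair T → BC} {f' : Pair T × Pair T → ScalarL2 T}
    (hf : BddLipOn s f) (hf' : BddLipOn s f') (h : ∀ u ∈ s, IsPrim (f u) (f' u)) :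
    PrimBddOn s f := by
  obtain ⟨C, h0, h1, -⟩ := hf
  obtain ⟨C', h0', h1', -⟩ := hf'
  exact ⟨f', C + C', by positivity, fun u hu => ⟨h u hu,
    (h1 u hu).trans (le_add_of_nonneg_right h0'), (h1' u hu).trans (le_add_of_nonneg_left h0)⟩⟩

theorem PrimBddOn.const {f : BC} {f' : ScalarL2 T} (h : IsPrim f f') :
    PrimBddOn s fun _ => f :=
  .of_bddLipOn (.const f) (.const f') fun _ _ => h

theorem PrimBddOn.mul {f g : Pair T × Pair T → BC} (hf : PrimBddOn s f) (hg : PrimBddOn s g) :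
    PrimBddOn s fun u => f u * g u := by
  obtain ⟨f', C, h0, h⟩ := hf
  obtain ⟨g', C', h0', h'⟩ := hg
  refine ⟨fun u => f u • g' u + g u • f' u, C * C' + C' * C, by positivity, fun u hu => ?_⟩
  obtain ⟨h1, h2, h3⟩ := h u hu
  obtain ⟨h1', h2', h3'⟩ := h' u hu
  refine ⟨h1.mul h1', ?_, ?_⟩
  · refine (norm_mul_le _ _).trans ((mul_le_mul h2 h2' (norm_nonneg _) h0).trans ?_)
    exact le_add_of_nonneg_right (by positivity)
  · refine (norm_add_le _ _).trans (add_le_add ?_ ?_)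
    · exact (norm_bc_smul_le _ _).trans (mul_le_mul h2 h3' (norm_nonneg _) h0)
    · exact (norm_bc_smul_le _ _).trans (mul_le_mul h2' h3 (norm_nonneg _) h0')

theorem RegOn.emb (hT : 0 < T) {A : Pair T × Pair T → BC} (hA : PrimBddOn s A) :
    RegOn s fun u => emb T (A u) := by
  have : (fun u => SupersonicDuct.emb T (A u)) = fun u => A u • SupersonicDuct.emb T 1 :=
    funext fun u => emb_eq_smul_one _
  rw [this]
  exact RegOn.smul hT hA (.const hT _)

namespace Coeffs

/-- The speeds stay above `κ` on the ball of radius `R`. -/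
def SpeedBound (c : Coeffs T) (R : ℝ) : Prop :=
  ∀ u ∈ ball T R, ∀ i, ∀ t ∈ Icc 0 T, c.κ ≤ c.lam u i t

variable {c : Coeffs T} {R : ℝ}

/-- G is built from u.1, u.2 and fixed L² functions, multiplied by coefficients bounded in H¹ on the
ball; the fixed functions β'' and μ'' have vanishing defect by `tendsto_defect`. -/
theorem regOn_G (hT : 0 < T) (hR : c.SpeedBound R) (i : Fin 2) :
    RegOn (ball T R) fun u => c.G u i := by
  have hm : PrimBddOn (ball T R) fun u => ∑ j, m u j :=
    .of_bddLipOn (bddLipOn_sum_m R) (.sum fun j _ => (bddLipOn_p R j).clm (SupersonicDuct.emb T))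
      fun u _ => .sum fun j _ => isPrim_m u j
  have hp : PrimBddOn (ball T R) fun u => ∑ j, p u j :=
    .of_bddLipOn (bddLipOn_sum_p R) (.sum fun j _ => bddLipOn_fst R j)
      fun u _ => .sum fun j _ => isPrim_p u j
  have ha : PrimBddOn (ball T R) fun u => c.a u i :=
    .of_bddLipOn (c.bddLipOn_a R i) ((c.bddLipOn_da R i).clm (SupersonicDuct.emb T)) fun u hu => isPrim_a (hR u hu i)
  have hdl : PrimBddOn (ball T R) fun u => c.dlam u i :=
    .of_bddLipOn (c.bddLipOn_dlam R i) (c.bddLipOn_ddlam R i) fun u _ => isPrim_dlam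
  have hy : PrimBddOn (ball T R) fun u => c.y u i :=
    .of_bddLipOn (c.bddLipOn_y R i) (c.bddLipOn_dy R i) fun u hu => isPrim_y (hR u hu i)
  have hβ : PrimBddOn (ball T R) fun _ => c.β := .const c.isPrim_β
  have hβ' : PrimBddOn (ball T R) fun _ => c.β' := .const c.isPrim_β'
  have hddl : RegOn (ball T R) fun u => c.ddlam u i :=
    (RegOn.const hT _).add (.sum hT fun j _ => (RegOn.fst j R).const_smul _)
  have hdq : RegOn (ball T R) fun u => c.dq u i := by
    simp only [dq, map_add]
    exact ((RegOn.emb hT (hβ'.mul hm)).add (.emb hT (hβ.mul hp))).sub (.snd i R)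
  have hdy : RegOn (ball T R) fun u => c.dy u i :=
    .smul hT ha (hdq.sub (.smul hT hy (.emb hT hdl)))
  exact .smul hT ha (((((RegOn.smul hT hm (.const hT _)).add
    ((RegOn.emb hT (hβ'.mul hp)).const_smul 2)).add
    (.smul hT hβ (.sum hT fun j _ => .fst j R))).sub
    ((RegOn.smul hT hdl hdy).const_smul 2)).sub (.smul hT hy hddl))

end Coeffs

end Regularity

end SupersonicDuct

namespace SupersonicDuct

variable {T : ℝ}

/-! ### The regularized equation and its uniform energy estimate -/

theorem BddLipOn.exists_uniform {X Y : Type*} [SeminormedAddCommGroup X] [SeminormedAddCommGroup Y]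
    {s : Set X} {f : X → Fin 2 → Y} (hf : ∀ i, BddLipOn s fun x => f x i) :
    ∃ C, 0 ≤ C ∧ (∀ x ∈ s, ∀ i, ‖f x i‖ ≤ C) ∧
      ∀ x ∈ s, ∀ y ∈ s, ∀ i, ‖f x i - f y i‖ ≤ C * ‖x - y‖ := by
  choose C h0 h1 h2 using hf
  have hle : ∀ i, C i ≤ ∑ j, C j := fun i =>
    Finset.single_le_sum (fun j _ => h0 j) (Finset.mem_univ i)
  exact ⟨∑ i, C i, Finset.sum_nonneg fun i _ => h0 i, fun x hx i => (h1 i x hx).trans (hle i),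
    fun x hx y hy i => (h2 i x hx y hy).trans
      (mul_le_mul_of_nonneg_right (hle i) (norm_nonneg _))⟩

theorem norm_sum_pair_le (w : Pair T) : ‖∑ j, w j‖ ≤ 2 * ‖w‖ := by
  rw [Fin.sum_univ_two, two_mul]
  exact (norm_add_le _ _).trans (add_le_add (norm_apply_le_pair w 0) (norm_apply_le_pair w 1))

/-- Energy estimate for one component of a difference of solutions. -/
theorem inner_difference_le {β b : BC} {w : Pair T} {i : Fin 2} {D r s : ScalarL2 T} {A K S : ℝ}
    (hA : ‖b‖ ≤ A) (hD : -(K * ‖w‖ ^ 2) ≤ 2 * inner ℝ (b • D) (w i)) (hs : ‖s‖ ≤ S * ‖w‖) :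
    2 * inner ℝ (b • (β • ∑ j, w j - (D + r)) + s) (w i) ≤
      (4 * A * ‖β‖ + K + 2 * S) * ‖w‖ ^ 2 + 2 * A * ‖r‖ * ‖w‖ := by
  have hA0 : 0 ≤ A := (norm_nonneg _).trans hA
  have hw := norm_apply_le_pair w i
  have e : b • (β • ∑ j, w j - (D + r)) + s
      = b • β • ∑ j, w j - b • D - b • r + s := by module
  rw [e, inner_add_left, inner_sub_left, inner_sub_left]
  have h1 : inner ℝ (b • β • ∑ j, w j) (w i) ≤ A * (‖β‖ * (2 * ‖w‖)) * ‖w‖ := by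
    refine (real_inner_le_norm _ _).trans (mul_le_mul ?_ hw (norm_nonneg _) (by positivity))
    refine (norm_bc_smul_le _ _).trans (mul_le_mul hA ?_ (norm_nonneg _) hA0)
    exact (norm_bc_smul_le _ _).trans
      (mul_le_mul_of_nonneg_left (norm_sum_pair_le w) (norm_nonneg _))
  have h2 : -(A * ‖r‖ * ‖w‖) ≤ inner ℝ (b • r) (w i) := by
    refine neg_le_of_abs_le ((abs_real_inner_le_norm _ _).trans ?_)
    refine mul_le_mul ?_ hw (norm_nonneg _) (by positivity)
    exact (norm_bc_smul_le _ _).trans (mul_le_mul_of_nonneg_right hA (norm_nonneg _))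
  have h3 : inner ℝ s (w i) ≤ S * ‖w‖ * ‖w‖ := by
    refine (real_inner_le_norm _ _).trans (mul_le_mul hs hw (norm_nonneg _) ?_)
    exact (norm_nonneg _).trans hs
  nlinarith

namespace Coeffs

variable (c : Coeffs T) {R L : ℝ}

theorem a_nonneg (u : Pair T × Pair T) (i : Fin 2) (t : ℝ) : 0 ≤ c.a u i t :=
  recip_nonneg c.κ_pos _ t

/-- The argument of the regularized vector field. -/
noncomputable def state (δ : ℝ) (h : Pair T) : Pair T × Pair T := (h, onPair (smoothing T δ) h)

theorem state_mem (hT : 0 < T) {δ : ℝ} (hδ : 0 < δ) {h : Pair T} (hh : ‖h‖ ≤ R) :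
    state δ h ∈ ball T R :=
  ⟨hh, (norm_onPair_smoothing_le hT hδ h).trans hh⟩

theorem norm_state_le (hT : 0 < T) {δ : ℝ} (hδ : 0 < δ) (h : Pair T) : ‖state δ h‖ ≤ ‖h‖ := by
  rw [Prod.norm_def]
  exact max_le le_rfl (norm_onPair_smoothing_le hT hδ h)

theorem state_sub (δ : ℝ) (h h' : Pair T) : state δ h - state δ h' = state δ (h - h') := by
  simp [state]

/-- The regularized vector field for `h = ∂ₜ² m`. -/
noncomputable def field (δ : ℝ) (h : Pair T) : Pair T :=
  WithLp.toLp 2 fun i => c.G (state δ h) i - c.a (state δ h) i • yosida T δ (h i)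

/-- The right-hand side of the equation for `∂ₜ m`. -/
noncomputable def dyPair (u : Pair T × Pair T) : Pair T := WithLp.toLp 2 fun i => c.dy u i

theorem bddLipOn_dyPair (R : ℝ) : BddLipOn (ball T R) c.dyPair :=
  .toPair fun i => c.bddLipOn_dy R i

/-- The Lipschitz constant may depend on δ, through the norm of `yosida T δ`; it serves to solve the
ODE for fixed δ. -/
theorem bddLipOn_field (hT : 0 < T) {δ : ℝ} (hδ : 0 < δ) (R : ℝ) :
    BddLipOn {h : Pair T | ‖h‖ ≤ R} (c.field δ) := by
  have hm : MapsTo (state δ) {h : Pair T | ‖h‖ ≤ R} (ball T R) := fun h hh => state_mem hT hδ hh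
  have hl : ∀ x y : Pair T, ‖state δ x - state δ y‖ ≤ ‖x - y‖ := fun x y => by
    rw [state_sub]; exact norm_state_le hT hδ _
  refine .toPair fun i => ?_
  refine ((c.bddLipOn_G R i).comp_map hm hl).sub (((c.bddLipOn_a R i).comp_map hm hl).smul ?_)
  exact (((bddLipOn_fst R i).comp_map hm hl).clm (yosida T δ))

variable {c}

/-- The regularization enters the right-hand side y before differentiation, so the field is exactly
its second time derivative and integrating back leaves no error term. -/
theorem volterra_field (hT : 0 < T) (hR : c.SpeedBound R) {δ : ℝ} (hδ : 0 < δ) {h : Pair T}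
    (hh : ‖h‖ ≤ R) : onPair (volterra T) (c.field δ h) = c.dyPair (state δ h) := by
  ext1 i
  exact volterra_ddy (hR _ (state_mem hT hδ hh) i) rfl

/-- The transport term is quasi-accretive with a constant bounding ∂ₜa on the ball, and ‖G‖ ≤ C‖h‖
by `G_zero`. Neither constant sees δ. -/
theorem exists_inner_field_le (hT : 0 < T) (hR0 : 0 ≤ R) (hR : c.SpeedBound R) :
    ∃ C, 0 ≤ C ∧ ∀ δ, 0 < δ → ∀ h : Pair T, ‖h‖ ≤ R →
      2 * inner ℝ (c.field δ h) h ≤ C * ‖h‖ ^ 2 := by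
  obtain ⟨K, hK0, hK, -⟩ := BddLipOn.exists_uniform (fun i => c.bddLipOn_da R i)
  obtain ⟨C, hC0, -, hC⟩ := BddLipOn.exists_uniform (fun i => c.bddLipOn_G R i)
  refine ⟨2 * (2 * C + K), by positivity, fun δ hδ h hh => ?_⟩
  have hs := state_mem hT hδ hh
  have key : ∀ i, 2 * inner ℝ (c.field δ h i) (h i) ≤ (2 * C + K) * ‖h‖ ^ 2 := by
    intro i
    have hw := norm_apply_le_pair h i
    have h1 := inner_smul_yosida_ge hT hδ (isPrim_a (hR _ hs i))
      (fun t _ => c.a_nonneg (state δ h) i t) (h i)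
    have h2 : ‖c.G (state δ h) i‖ ≤ C * ‖h‖ := by
      have := hC _ hs 0 ⟨by simpa using hR0, by simpa using hR0⟩ i
      rw [G_zero, sub_zero, sub_zero] at this
      exact this.trans (mul_le_mul_of_nonneg_left (norm_state_le hT hδ h) hC0)
    have h3 : inner ℝ (c.G (state δ h) i) (h i) ≤ C * ‖h‖ * ‖h‖ :=
      (real_inner_le_norm _ _).trans (mul_le_mul h2 hw (norm_nonneg _) (by positivity))
    have h4 : ‖c.da (state δ h) i‖ * ‖h i‖ ^ 2 ≤ K * ‖h‖ ^ 2 :=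
      mul_le_mul (hK _ hs i) (pow_le_pow_left₀ (norm_nonneg _) hw 2) (by positivity) hK0
    have e : c.field δ h i = c.G (state δ h) i - c.a (state δ h) i • yosida T δ (h i) := rfl
    rw [e, inner_sub_left]
    nlinarith
  rw [inner_pair, Fin.sum_univ_two]
  linarith [key 0, key 1]

variable (c) in
/-- `u` solves the regularized equation with initial value `h₀`, and stays in a ball. -/
structure IsApprox (R L δ : ℝ) (h₀ : Pair T) (u : ℝ → Pair T) : Prop where
  zero : u 0 = h₀
  norm_le : ∀ x ∈ Icc 0 L, ‖u x‖ ≤ R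
  deriv : ∀ x ∈ Icc 0 L, HasDerivWithinAt u (c.field δ (u x)) (Icc 0 L) x

/-- The exponent comes from the energy inequality rather than from the Lipschitz constant, so one
smallness condition on the data serves all δ. -/
theorem exists_isApprox (hT : 0 < T) (hL : 0 ≤ L) (hR0 : 0 < R) (hR : c.SpeedBound R) :
    ∃ C, 0 ≤ C ∧ ∀ h₀ : Pair T, Real.exp (C * L) * ‖h₀‖ ^ 2 ≤ R ^ 2 → ∀ δ, 0 < δ →
      ∃ u, c.IsApprox R L δ h₀ u ∧
        ∀ x ∈ Icc 0 L, ‖u x‖ ^ 2 ≤ Real.exp (C * L) * ‖h₀‖ ^ 2 := by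
  obtain ⟨C, hC0, hC⟩ := exists_inner_field_le hT hR0.le hR
  refine ⟨C, hC0, fun h₀ hh₀ δ hδ => ?_⟩
  obtain ⟨M, hM0, hM, hM'⟩ := c.bddLipOn_field hT hδ R
  obtain ⟨u, h0, h1, h2, h3⟩ := exists_solution_of_inner_le hL hR0 hC0 (fun x hx => hM x hx)
    (fun x y hx hy => hM' x hx y hy) (fun x hx => hC δ hδ x hx) hh₀
  exact ⟨u, ⟨h0, h2, h3⟩, h1⟩

theorem _root_.HasDerivWithinAt.clm_apply_const {E F : Type*} [NormedAddCommGroup E]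
    [NormedSpace ℝ E] [NormedAddCommGroup F] [NormedSpace ℝ F] (A : E →L[ℝ] F) {u : ℝ → E} {u' : E}
    {s : Set ℝ} {x : ℝ} (h : HasDerivWithinAt u u' s x) :
    HasDerivWithinAt (fun x => A (u x)) (A u') s x :=
  A.hasFDerivAt.comp_hasDerivWithinAt x h

/-! ### Uniform regularity and low-norm convergence of the approximations -/

/-- The regularized solutions are equicontinuous in time in the `L²` sense, uniformly in the
regularization parameter. -/
theorem exists_defect_le (hT : 0 < T) (hR : c.SpeedBound R) (h₀ : Pair T) :
    ∃ θ : ℝ → ℝ, Filter.Tendsto θ (nhdsWithin 0 (Ioi 0)) (nhds 0) ∧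
      ∀ δ, 0 < δ → ∀ u, c.IsApprox R L δ h₀ u → ∀ ρ, 0 < ρ → ∀ x ∈ Icc 0 L,
        ‖onPair (defect T ρ) (u x)‖ ^ 2 ≤ θ ρ := by
  obtain ⟨K, hK0, hK, -⟩ := BddLipOn.exists_uniform (fun i => c.bddLipOn_da R i)
  have hG : ∃ C, 0 ≤ C ∧ ∃ η : ℝ → ℝ, Filter.Tendsto η (nhdsWithin 0 (Ioi 0)) (nhds 0) ∧
      ∀ ρ, 0 < ρ → ∀ u ∈ ball T R, ∀ i, ‖defect T ρ (c.G u i)‖ ≤ C * defectSum ρ u + |η ρ| := by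
    choose C h0 η h1 _ h3 using fun i => regOn_G (c := c) hT hR i
    refine ⟨∑ i, C i, Finset.sum_nonneg fun i _ => h0 i, fun ρ => ∑ i, |η i ρ|, ?_, ?_⟩
    · simpa using tendsto_finsetSum (Finset.univ : Finset (Fin 2)) fun i _ => (h1 i).abs
    · intro ρ hρ u hu i
      refine (h3 i ρ hρ u hu).trans (add_le_add ?_ ?_)
      · exact mul_le_mul_of_nonneg_right (Finset.single_le_sum (fun j _ => h0 j)
          (Finset.mem_univ i)) (defectSum_nonneg _ _)
      · exact ((le_abs_self _).trans (Finset.single_le_sum (f := fun i => |η i ρ|)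
          (fun j _ => abs_nonneg _) (Finset.mem_univ i))).trans (le_abs_self _)
  obtain ⟨C, hC0, η, hη, hC⟩ := hG
  -- Per component: 8C from G, K from accretivity, 2K from the commutator, 1 from splitting the
  -- product with η; then two components are added.
  refine ⟨fun ρ => Real.exp ((16 * C + 6 * K + 2) * L) *
    (‖onPair (defect T ρ) h₀‖ ^ 2 + 2 * η ρ ^ 2 * L), ?_, ?_⟩
  · have h1 : Filter.Tendsto (fun ρ => ‖onPair (defect T ρ) h₀‖ ^ 2) (nhdsWithin 0 (Ioi 0))
        (nhds 0) := by
      have e : (fun ρ => ‖onPair (defect T ρ) h₀‖ ^ 2)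
          = fun ρ => ‖defect T ρ (h₀ 0)‖ ^ 2 + ‖defect T ρ (h₀ 1)‖ ^ 2 :=
        funext fun ρ => norm_sq_pair _
      rw [e]
      have := ((tendsto_defect hT (h₀ 0)).pow 2).add ((tendsto_defect hT (h₀ 1)).pow 2)
      rw [zero_pow two_ne_zero, add_zero] at this
      exact this
    simpa using ((h1.add (((hη.pow 2).const_mul 2).mul_const L)).const_mul
      (Real.exp ((16 * C + 6 * K + 2) * L)))
  · intro δ hδ u hu ρ hρ x hx
    rw [← hu.zero]
    refine norm_sq_le_of_inner_deriv_le (u := fun x => onPair (defect T ρ) (u x)) (by positivity)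
      (by positivity) (fun x hx => (hu.deriv x hx).clm_apply_const _) (fun x hx => ?_) x hx
    set h := u x with hh
    have hs : state δ h ∈ ball T R := state_mem hT hδ (hu.norm_le x hx)
    set z := onPair (defect T ρ) h with hz
    -- Smoothing at scale δ commutes with the defect at scale ρ and is a contraction, so the second
    -- half of the state is no rougher than h.
    have hsum : defectSum ρ (state δ h) ≤ 4 * ‖z‖ := by
      have h1 : ∀ j, ‖defect T ρ (h j)‖ + ‖defect T ρ (smoothing T δ (h j))‖ ≤ 2 * ‖z‖ := by
        intro j
        have h2 : ‖defect T ρ (h j)‖ ≤ ‖z‖ := norm_apply_le_pair z j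
        have h3 : defect T ρ (smoothing T δ (h j)) = smoothing T δ (defect T ρ (h j)) := by
          rw [defect_apply, defect_apply, (smoothing T δ).map_smul, smoothing_apply,
            smoothing_apply, yosida_volterra hT hρ, yosida_comm hT hρ hδ]
        have h4 := norm_smoothing_le hT hδ (defect T ρ (h j))
        rw [h3]
        rw [← smoothing_apply] at h4
        linarith
      have e : defectSum ρ (state δ h)
          = ∑ j, (‖defect T ρ (h j)‖ + ‖defect T ρ (smoothing T δ (h j))‖) := rfl
      rw [e, Fin.sum_univ_two]
      linarith [h1 0, h1 1]
    have key : ∀ i, 2 * inner ℝ (onPair (defect T ρ) (c.field δ h) i) (z i) ≤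
        (8 * C + 3 * K + 1) * ‖z‖ ^ 2 + η ρ ^ 2 := by
      intro i
      have hw := norm_apply_le_pair z i
      have ha := isPrim_a (hR _ hs i)
      -- The defect z of h satisfies a transport equation of the same form, with the defect of G and
      -- a commutator of size K‖z‖ as sources.
      have e : onPair (defect T ρ) (c.field δ h) i = defect T ρ (c.G (state δ h) i)
          - c.a (state δ h) i • yosida T δ (z i)
          - (defect T ρ (c.a (state δ h) i • yosida T δ (h i))
            - c.a (state δ h) i • yosida T δ (z i)) := by
        rw [onPair_apply]
        have : c.field δ h i = c.G (state δ h) i - c.a (state δ h) i • yosida T δ (h i) := rfl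
        rw [this, map_sub]
        abel
      have h1 := inner_smul_yosida_ge hT hδ ha (fun t _ => c.a_nonneg (state δ h) i t) (z i)
      have h2 : ‖defect T ρ (c.G (state δ h) i)‖ ≤ 4 * C * ‖z‖ + |η ρ| := by
        refine (hC ρ hρ _ hs i).trans (add_le_add ?_ le_rfl)
        have := mul_le_mul_of_nonneg_left hsum hC0
        linarith
      have h3 : ‖defect T ρ (c.a (state δ h) i • yosida T δ (h i))
            - c.a (state δ h) i • yosida T δ (z i)‖ ≤ K * ‖z‖ :=
        (norm_defect_transport_le hT hρ hδ ha (h i)).trans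
          (mul_le_mul (hK _ hs i) hw (norm_nonneg _) hK0)
      have h4 : ‖c.da (state δ h) i‖ * ‖z i‖ ^ 2 ≤ K * ‖z‖ ^ 2 :=
        mul_le_mul (hK _ hs i) (pow_le_pow_left₀ (norm_nonneg _) hw 2) (by positivity) hK0
      have h5 : inner ℝ (defect T ρ (c.G (state δ h) i)) (z i) ≤ (4 * C * ‖z‖ + |η ρ|) * ‖z‖ :=
        (real_inner_le_norm _ _).trans (mul_le_mul h2 hw (norm_nonneg _) (by positivity))
      have h6 : -(K * ‖z‖ * ‖z‖) ≤ inner ℝ (defect T ρ (c.a (state δ h) i • yosida T δ (h i))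
            - c.a (state δ h) i • yosida T δ (z i)) (z i) :=
        neg_le_of_abs_le ((abs_real_inner_le_norm _ _).trans
          (mul_le_mul h3 hw (norm_nonneg _) (by positivity)))
      rw [e, inner_sub_left, inner_sub_left]
      have h7 : 2 * (|η ρ| * ‖z‖) ≤ η ρ ^ 2 + ‖z‖ ^ 2 := by
        rw [← sq_abs (η ρ)]
        nlinarith [sq_nonneg (|η ρ| - ‖z‖)]
      nlinarith
    change 2 * inner ℝ (onPair (defect T ρ) (c.field δ h)) z ≤ _
    rw [inner_pair, Fin.sum_univ_two]
    linarith [key 0, key 1]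

/-- Consistency error of the Yosida approximation on functions with two derivatives: (δ + J)⁻¹J²g =
Jg − δ J(δ + J)⁻¹g. -/
theorem norm_yosida_sub_le (hT : 0 < T) {δ δ' : ℝ} (hδ : 0 < δ) (hδ' : 0 < δ') (g : ScalarL2 T) :
    ‖yosida T δ (volterra T (volterra T g)) - yosida T δ' (volterra T (volterra T g))‖ ≤
      (δ + δ') * ‖g‖ := by
  have h1 : ∀ {δ : ℝ}, 0 < δ → yosida T δ (volterra T (volterra T g))
      = volterra T g - δ • volterra T (yosida T δ g) := fun {δ} hδ => by
    have := sub_smoothing hT hδ (volterra T g)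
    rw [← yosida_volterra hT hδ g, ← this, yosida_volterra hT hδ (volterra T g)]
    abel
  rw [h1 hδ, h1 hδ', sub_sub_sub_cancel_left, add_comm, add_mul]
  refine (norm_sub_le _ _).trans (add_le_add ?_ ?_)
  · rw [norm_smul, Real.norm_of_nonneg hδ'.le]
    exact mul_le_mul_of_nonneg_left (norm_smoothing_le hT hδ' g) hδ'.le
  · rw [norm_smul, Real.norm_of_nonneg hδ.le]
    exact mul_le_mul_of_nonneg_left (norm_smoothing_le hT hδ g) hδ.le

/-- The regularized solutions converge in the `L²` norm of `m`. -/
theorem exists_volterra_sub_le (hT : 0 < T) (hL : 0 ≤ L) (hR : c.SpeedBound R) :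
    ∃ C, 0 ≤ C ∧ ∀ h₀ : Pair T, ∀ δ δ', 0 < δ → 0 < δ' → ∀ u v, c.IsApprox R L δ h₀ u →
      c.IsApprox R L δ' h₀ v → ∀ x ∈ Icc 0 L,
        ‖onPair ((volterra T).comp (volterra T)) (u x - v x)‖ ^ 2 ≤ C * (δ + δ') ^ 2 := by
  obtain ⟨K, hK0, hK, -⟩ := BddLipOn.exists_uniform (fun i => c.bddLipOn_da R i)
  obtain ⟨Q, hQ0, hQ, -⟩ := BddLipOn.exists_uniform (fun i => c.bddLipOn_q R i)
  set κ := c.κ with hκ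
  have hκ0 : 0 < κ := c.κ_pos
  set Λ : ℝ := ∑ i, ∑ j, |c.ℓ i j| with hΛ
  have hΛ0 : 0 ≤ Λ := Finset.sum_nonneg fun i _ => Finset.sum_nonneg fun j _ => abs_nonneg _
  set S : ℝ := Q * (κ⁻¹ * κ⁻¹ * Λ) with hS
  have hS0 : 0 ≤ S := by positivity
  set M : ℝ := 4 * κ⁻¹ * ‖c.β‖ + K + 2 * S with hM
  have hM0 : 0 ≤ M := by positivity
  refine ⟨Real.exp ((2 * M + 2) * L) * (2 * (κ⁻¹ * R) ^ 2 * L), by positivity, ?_⟩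
  intro h₀ δ δ' hδ hδ' u v hu hv x hx
  have hgron := norm_sq_le_of_inner_deriv_le
    (u := fun x => onPair ((volterra T).comp (volterra T)) (u x - v x))
    (K := 2 * M + 2) (η := 2 * (κ⁻¹ * R * (δ + δ')) ^ 2) (L := L) (by positivity) (by positivity)
    (fun x hx => ((hu.deriv x hx).sub (hv.deriv x hx)).clm_apply_const _) ?_ x hx
  · refine hgron.trans_eq ?_
    rw [hu.zero, hv.zero, sub_self, map_zero, norm_zero]
    ring
  intro x hx
  set U := state δ (u x) with hU
  set V := state δ' (v x) with hV
  have hUs : U ∈ ball T R := state_mem hT hδ (hu.norm_le x hx)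
  have hVs : V ∈ ball T R := state_mem hT hδ' (hv.norm_le x hx)
  set w := onPair ((volterra T).comp (volterra T)) (u x - v x) with hw
  have hwj : ∀ j, w j = emb T (m U j - m V j) := fun j => by
    rw [map_sub, hw, map_sub]
    rfl
  have key : ∀ i, 2 * inner ℝ
      (onPair ((volterra T).comp (volterra T)) (c.field δ (u x) - c.field δ' (v x)) i) (w i) ≤
      (M + 1) * ‖w‖ ^ 2 + (κ⁻¹ * R * (δ + δ')) ^ 2 := by
    intro i
    -- After applying J² the fields are the undifferentiated right-hand sides, so only differences
    -- of m and of its approximate derivative remain.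
    have e1 : onPair ((volterra T).comp (volterra T)) (c.field δ (u x) - c.field δ' (v x)) i
        = emb T (c.y U i) - emb T (c.y V i) := by
      have h1 := congrArg (fun p : Pair T => volterra T (p i))
        (volterra_field hT hR hδ (hu.norm_le x hx))
      have h2 := congrArg (fun p : Pair T => volterra T (p i))
        (volterra_field hT hR hδ' (hv.norm_le x hx))
      simp only [onPair_apply] at h1 h2
      rw [map_sub]
      change volterra T (volterra T (c.field δ (u x) i))
        - volterra T (volterra T (c.field δ' (v x) i)) = _
      rw [h1, h2]
      exact congrArg₂ _ (volterra_dy (hR _ hUs i)) (volterra_dy (hR _ hVs i))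
    -- The two parameters meet only here: the transport term is written with δ alone and r is the
    -- consistency error on v.
    set r : ScalarL2 T := yosida T δ (volterra T (volterra T (v x i)))
      - yosida T δ' (volterra T (volterra T (v x i))) with hr
    have hrn : ‖r‖ ≤ (δ + δ') * R := (norm_yosida_sub_le hT hδ hδ' _).trans
      (mul_le_mul_of_nonneg_left ((norm_apply_le_pair _ _).trans (hv.norm_le x hx))
        (by positivity))
    have e2 : emb T (c.q U i - c.q V i) = c.β • ∑ j, w j - (yosida T δ (w i) + r) := by
      have h1 : c.q U i - c.q V i = c.β * ∑ j, (m U j - m V j)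
          - (prim (volterra T (yosida T δ (u x i))) - prim (volterra T (yosida T δ' (v x i)))) := by
        rw [Finset.sum_sub_distrib, mul_sub]
        simp only [q]
        change c.β * _ - prim (volterra T (yosida T δ (u x i)))
          - (c.β * _ - prim (volterra T (yosida T δ' (v x i)))) = _
        abel
      have h2 : yosida T δ (w i) + r = volterra T (volterra T (yosida T δ (u x i)))
          - volterra T (volterra T (yosida T δ' (v x i))) := by
        have h3 : w i = volterra T (volterra T (u x i)) - volterra T (volterra T (v x i)) := by
          rw [hw, map_sub]; rfl
        rw [h3, map_sub, hr, ← yosida_volterra hT hδ, ← yosida_volterra hT hδ,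
          ← yosida_volterra hT hδ', ← yosida_volterra hT hδ']
        abel
      rw [h1, h2, map_sub, map_sub, ← bc_smul_emb, map_sum]
      simp only [hwj]
      rfl
    -- Difference of products a q: the factor q of V is bounded in the sup norm, and the difference
    -- of the a's is controlled by w in L².
    have e3 : emb T (c.y U i) - emb T (c.y V i)
        = c.a U i • (c.β • ∑ j, w j - (yosida T δ (w i) + r))
          + c.q V i • emb T (c.a U i - c.a V i) := by
      rw [← e2, bc_smul_emb, bc_smul_emb, ← map_sub, ← map_add]
      congr 1
      simp only [y]
      ring
    have hs : ‖c.q V i • emb T (c.a U i - c.a V i)‖ ≤ S * ‖w‖ := by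
      have h1 : ‖emb T (c.a U i - c.a V i)‖ ≤ κ⁻¹ * κ⁻¹ * ‖emb T (c.lam U i - c.lam V i)‖ :=
        norm_emb_le_of_abs_le fun t => abs_recip_sub_recip_le c.κ_pos _ _ t
      have h2 : c.lam U i - c.lam V i = ∑ j, c.ℓ i j • (m U j - m V j) := by
        simp only [lam, smul_sub, Finset.sum_sub_distrib]
        abel
      have h3 : ‖emb T (c.lam U i - c.lam V i)‖ ≤ Λ * ‖w‖ := by
        rw [h2, map_sum]
        refine (norm_sum_le _ _).trans ?_
        have h4 : ∑ j, |c.ℓ i j| ≤ Λ := Finset.single_le_sum (f := fun i => ∑ j, |c.ℓ i j|)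
          (fun i _ => Finset.sum_nonneg fun j _ => abs_nonneg _) (Finset.mem_univ i)
        refine le_trans ?_ (mul_le_mul_of_nonneg_right h4 (norm_nonneg _))
        rw [Finset.sum_mul]
        refine Finset.sum_le_sum fun j _ => ?_
        rw [map_smul, ← hwj, norm_smul, Real.norm_eq_abs]
        exact mul_le_mul_of_nonneg_left (norm_apply_le_pair w j) (abs_nonneg _)
      refine (norm_bc_smul_le _ _).trans ?_
      rw [hS, mul_assoc]
      refine mul_le_mul (hQ _ hVs i) ?_ (norm_nonneg _) hQ0
      rw [mul_assoc]
      exact h1.trans (mul_le_mul_of_nonneg_left h3 (by positivity))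
    have hD : -(K * ‖w‖ ^ 2) ≤ 2 * inner ℝ (c.a U i • yosida T δ (w i)) (w i) := by
      refine le_trans ?_ (inner_smul_yosida_ge hT hδ (isPrim_a (hR _ hUs i))
        (fun t _ => c.a_nonneg U i t) (w i))
      exact neg_le_neg (mul_le_mul (hK _ hUs i)
        (pow_le_pow_left₀ (norm_nonneg _) (norm_apply_le_pair w i) 2) (by positivity) hK0)
    have h1 := inner_difference_le (β := c.β) (r := r) (norm_recip_le c.κ_pos (c.lam U i)) hD hs
    rw [e1, e3]
    refine h1.trans ?_
    have h2 : 2 * κ⁻¹ * ‖r‖ * ‖w‖ ≤ ‖w‖ ^ 2 + (κ⁻¹ * R * (δ + δ')) ^ 2 := by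
      have h3 : κ⁻¹ * ‖r‖ ≤ κ⁻¹ * R * (δ + δ') := by
        have := mul_le_mul_of_nonneg_left hrn (inv_nonneg.2 hκ0.le)
        linarith
      have h4 := mul_le_mul_of_nonneg_right h3 (norm_nonneg w)
      nlinarith [sq_nonneg (κ⁻¹ * R * (δ + δ') - ‖w‖)]
    linarith
  change 2 * inner ℝ (onPair ((volterra T).comp (volterra T))
    (c.field δ (u x) - c.field δ' (v x))) w ≤ _
  rw [inner_pair, Fin.sum_univ_two]
  linarith [key 0, key 1]

end Coeffs

end SupersonicDuct

namespace SupersonicDuct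

variable {T : ℝ}

/-! ### Strong convergence and passage to the limit -/

/-- With the smoothing S = JY, Y = (ρ + J)⁻¹, write 1 = (1 + S)(1 − S) + S² and S² = Y²J²; then ‖S‖
≤ 1 and ‖Y‖ ≤ 1/ρ. -/
theorem norm_le_defect_add (hT : 0 < T) {ρ : ℝ} (hρ : 0 < ρ) (g : Pair T) :
    ‖g‖ ≤ 2 * ‖onPair (defect T ρ) g‖
      + ρ⁻¹ * ρ⁻¹ * ‖onPair ((volterra T).comp (volterra T)) g‖ := by
  have e : g = onPair (defect T ρ) g + (onPair (smoothing T ρ) (onPair (defect T ρ) g)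
      + onPair (yosida T ρ) (onPair (yosida T ρ)
        (onPair ((volterra T).comp (volterra T)) g))) := by
    ext1 i
    simp only [PiLp.add_apply, onPair_apply]
    change g i = defect T ρ (g i) + (smoothing T ρ (defect T ρ (g i))
      + yosida T ρ (yosida T ρ (volterra T (volterra T (g i)))))
    have h1 : yosida T ρ (yosida T ρ (volterra T (volterra T (g i))))
        = smoothing T ρ (smoothing T ρ (g i)) := by
      simp only [smoothing_apply, yosida_volterra hT hρ]
    rw [h1, ← map_add, ← sub_smoothing_eq_defect hT hρ, sub_add_cancel, sub_add_cancel]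
  have hy : ∀ v : Pair T, ‖onPair (yosida T ρ) v‖ ≤ ρ⁻¹ * ‖v‖ := by
    refine norm_onPair_le (inv_nonneg.2 hρ.le) fun h => ?_
    rw [← div_eq_inv_mul, le_div_iff₀ hρ, mul_comm]
    exact norm_yosida_le hT hρ h
  have h1 := norm_onPair_smoothing_le hT hρ (onPair (defect T ρ) g)
  have h2 := (hy (onPair (yosida T ρ) (onPair ((volterra T).comp (volterra T)) g))).trans
    (mul_le_mul_of_nonneg_left (hy _) (inv_nonneg.2 hρ.le))
  have h3 : ‖g‖ ≤ ‖onPair (defect T ρ) g‖ + (‖onPair (smoothing T ρ) (onPair (defect T ρ) g)‖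
      + ‖onPair (yosida T ρ) (onPair (yosida T ρ)
        (onPair ((volterra T).comp (volterra T)) g))‖) := by
    conv_lhs => rw [e]
    exact (norm_add_le _ _).trans (add_le_add le_rfl (norm_add_le _ _))
  linarith

theorem integral_eq_sub_of_hasDerivWithinAt_Icc {E : Type*} [NormedAddCommGroup E]
    [NormedSpace ℝ E] [CompleteSpace E] {u u' : ℝ → E} {L : ℝ}
    (hu : ∀ x ∈ Icc 0 L, HasDerivWithinAt u (u' x) (Icc 0 L) x) (hu' : ContinuousOn u' (Icc 0 L))
    {x : ℝ} (hx : x ∈ Icc 0 L) : ∫ y in (0 : ℝ)..x, u' y = u x - u 0 := by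
  have hsub : Icc 0 x ⊆ Icc 0 L := Icc_subset_Icc_right hx.2
  refine intervalIntegral.integral_eq_sub_of_hasDerivAt_of_le hx.1
    (fun y hy => ((hu y (hsub hy)).continuousWithinAt).mono hsub) (fun y hy => ?_) ?_
  · exact (hu y (hsub (Ioo_subset_Icc_self hy))).hasDerivAt
      (Icc_mem_nhds hy.1 (hy.2.trans_le hx.2))
  · refine ContinuousOn.intervalIntegrable ?_
    rw [uIcc_of_le hx.1]
    exact hu'.mono hsub

theorem hasDerivWithinAt_of_eq_add_integral {E : Type*} [NormedAddCommGroup E]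
    [NormedSpace ℝ E] [CompleteSpace E] {u u' : ℝ → E} {L : ℝ} (hL : 0 ≤ L)
    (hu' : ContinuousOn u' (Icc 0 L))
    (hu : ∀ x ∈ Icc 0 L, u x = u 0 + ∫ y in (0 : ℝ)..x, u' y) {x : ℝ} (hx : x ∈ Icc 0 L) :
    HasDerivWithinAt u (u' x) (Icc 0 L) x := by
  -- Extending u' continuously to ℝ makes the two-sided fundamental theorem available at the
  -- endpoints too.
  let v : ℝ → E := IccExtend hL ((Icc 0 L).domRestrict u')
  have hv : Continuous v := (continuousOn_iff_continuous_domRestrict.1 hu').Icc_extend'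
  have hvu : ∀ y ∈ Icc 0 L, v y = u' y := fun y hy => by
    simp only [v, IccExtend_of_mem hL _ hy, domRestrict_apply]
  have h1 : HasDerivAt (fun x => u 0 + ∫ y in (0 : ℝ)..x, v y) (v x) x :=
    (intervalIntegral.integral_hasDerivAt_right (hv.intervalIntegrable _ _)
      (hv.stronglyMeasurableAtFilter _ _) hv.continuousAt).const_add _
  rw [← hvu x hx]
  refine h1.hasDerivWithinAt.congr_of_mem (fun y hy => ?_) hx
  rw [hu y hy]
  congr 1
  refine intervalIntegral.integral_congr fun z hz => ?_
  rw [uIcc_of_le hy.1] at hz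
  exact (hvu z ⟨hz.1, hz.2.trans hy.2⟩).symm

namespace Coeffs

variable {c : Coeffs T} {R L : ℝ}

/-- First ρ is fixed so that the defects of all approximations are small; then n is taken large to
beat the factor ρ⁻² in `norm_le_defect_add`. -/
theorem uniformCauchySeqOn_approx (hT : 0 < T) (hL : 0 ≤ L) (hR : c.SpeedBound R) {h₀ : Pair T}
    {u : ℕ → ℝ → Pair T} (hu : ∀ n : ℕ, c.IsApprox R L (1 / ((n : ℝ) + 1)) h₀ (u n)) :
    UniformCauchySeqOn u Filter.atTop (Icc 0 L) := by
  obtain ⟨θ, hθ, hθu⟩ := exists_defect_le (L := L) hT hR h₀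
  obtain ⟨C, hC0, hC⟩ := exists_volterra_sub_le hT hL hR
  rw [Metric.uniformCauchySeqOn_iff]
  intro ε hε
  obtain ⟨ρ, hρθ, hρ : 0 < ρ⟩ := ((hθ.eventually
    (gt_mem_nhds (show (0 : ℝ) < (ε / 8) ^ 2 by positivity))).and self_mem_nhdsWithin).exists
  obtain ⟨N, hN⟩ := exists_nat_one_div_lt (K := ℝ)
    (ε := ε / 2 / (2 * (ρ⁻¹ * ρ⁻¹ * Real.sqrt C) + 1)) (by positivity)
  have hle : ∀ n ≥ N, 1 / ((n : ℝ) + 1) ≤ 1 / ((N : ℝ) + 1) := fun n hn =>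
    Nat.one_div_le_one_div hn
  refine ⟨N, fun m hm n hn x hx => ?_⟩
  rw [dist_eq_norm]
  have hpos : ∀ n : ℕ, 0 < 1 / ((n : ℝ) + 1) := fun n => Nat.one_div_pos_of_nat
  have hd : ∀ n, ‖onPair (defect T ρ) (u n x)‖ ≤ ε / 8 := fun n =>
    le_of_sq_le_sq ((hθu _ (hpos n) _ (hu n) ρ hρ x hx).trans hρθ.le) (by positivity)
  have h1 : ‖onPair (defect T ρ) (u m x - u n x)‖ ≤ ε / 4 := by
    rw [map_sub]
    exact (norm_sub_le _ _).trans (by linarith [hd m, hd n])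
  have h2 : ‖onPair ((volterra T).comp (volterra T)) (u m x - u n x)‖
      ≤ Real.sqrt C * (2 * (1 / ((N : ℝ) + 1))) := by
    have h3 := hC h₀ _ _ (hpos m) (hpos n) _ _ (hu m) (hu n) x hx
    have h4 : 0 < 1 / ((m : ℝ) + 1) + 1 / ((n : ℝ) + 1) := add_pos (hpos m) (hpos n)
    refine (le_of_sq_le_sq (b := Real.sqrt C * (1 / ((m : ℝ) + 1) + 1 / ((n : ℝ) + 1))) ?_
      (by positivity)).trans ?_
    · rwa [mul_pow, Real.sq_sqrt hC0]
    · refine mul_le_mul_of_nonneg_left ?_ (Real.sqrt_nonneg _)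
      linarith [hle m hm, hle n hn]
  have h5 := norm_le_defect_add hT hρ (u m x - u n x)
  have h6 : ρ⁻¹ * ρ⁻¹ * ‖onPair ((volterra T).comp (volterra T)) (u m x - u n x)‖ < ε / 2 := by
    rw [lt_div_iff₀ (by positivity)] at hN
    have h7 := mul_le_mul_of_nonneg_left h2 (show 0 ≤ ρ⁻¹ * ρ⁻¹ by positivity)
    have := hpos N
    nlinarith
  linarith

theorem continuousOn_dyPair (R : ℝ) : ContinuousOn c.dyPair (ball T R) := by
  obtain ⟨K, hK0, -, hK'⟩ := c.bddLipOn_dyPair R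
  refine (LipschitzOnWith.of_dist_le_mul (K := K.toNNReal) fun x hx y hy => ?_).continuousOn
  rw [dist_eq_norm, dist_eq_norm, Real.coe_toNNReal _ hK0]
  exact hK' x hx y hy

theorem continuousOn_field (hT : 0 < T) {δ : ℝ} (hδ : 0 < δ) (R : ℝ) :
    ContinuousOn (c.field δ) {h : Pair T | ‖h‖ ≤ R} := by
  obtain ⟨K, hK0, -, hK'⟩ := c.bddLipOn_field hT hδ R
  refine (LipschitzOnWith.of_dist_le_mul (K := K.toNNReal) fun x hx y hy => ?_).continuousOn
  rw [dist_eq_norm, dist_eq_norm, Real.coe_toNNReal _ hK0]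
  exact hK' x hx y hy

theorem IsApprox.continuousOn {δ : ℝ} {h₀ : Pair T} {u : ℝ → Pair T} (hu : c.IsApprox R L δ h₀ u) :
    ContinuousOn u (Icc 0 L) := fun x hx => (hu.deriv x hx).continuousWithinAt

theorem IsApprox.continuousOn_dyPair (hT : 0 < T) (hR : c.SpeedBound R) {δ : ℝ} (hδ : 0 < δ)
    {h₀ : Pair T} {u : ℝ → Pair T} (hu : c.IsApprox R L δ h₀ u) :
    ContinuousOn (fun x => c.dyPair (state δ (u x))) (Icc 0 L) := by
  have h1 : ContinuousOn (fun x => onPair (volterra T) (c.field δ (u x))) (Icc 0 L) :=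
    (onPair (volterra T)).continuous.comp_continuousOn
      ((continuousOn_field hT hδ R).comp hu.continuousOn fun x hx => hu.norm_le x hx)
  exact h1.congr fun x hx => (volterra_field hT hR hδ (hu.norm_le x hx)).symm

theorem IsApprox.integral_dyPair (hT : 0 < T) (hR : c.SpeedBound R) {δ : ℝ} (hδ : 0 < δ)
    {h₀ : Pair T} {u : ℝ → Pair T} (hu : c.IsApprox R L δ h₀ u) {x : ℝ} (hx : x ∈ Icc 0 L) :
    ∫ y in (0 : ℝ)..x, c.dyPair (state δ (u y))
      = onPair (volterra T) (u x) - onPair (volterra T) h₀ := by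
  rw [← hu.zero]
  refine integral_eq_sub_of_hasDerivWithinAt_Icc (u := fun x => onPair (volterra T) (u x))
    (fun y hy => ?_) (hu.continuousOn_dyPair hT hR hδ) hx
  rw [← volterra_field hT hR hδ (hu.norm_le y hy)]
  exact (hu.deriv y hy).clm_apply_const _

/-- The state also contains u n smoothed at the moving scale δ = 1/(n + 1). The uniform defect
estimate with ρ = δ shows that it has the same limit h. -/
theorem tendsto_dyPair_approx (hT : 0 < T) (hR : c.SpeedBound R) {h₀ : Pair T}
    {u : ℕ → ℝ → Pair T} (hu : ∀ n : ℕ, c.IsApprox R L (1 / ((n : ℝ) + 1)) h₀ (u n)) {x : ℝ}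
    (hx : x ∈ Icc 0 L) {h : Pair T} (hh : Filter.Tendsto (fun n => u n x) Filter.atTop (nhds h)) :
    Filter.Tendsto (fun n : ℕ => c.dyPair (state (1 / ((n : ℝ) + 1)) (u n x))) Filter.atTop
      (nhds (c.dyPair (h, h))) := by
  have hpos : ∀ n : ℕ, 0 < 1 / ((n : ℝ) + 1) := fun n => Nat.one_div_pos_of_nat
  obtain ⟨θ, hθ, hθu⟩ := exists_defect_le (L := L) hT hR h₀
  have hδ : Filter.Tendsto (fun n : ℕ => 1 / ((n : ℝ) + 1)) Filter.atTop
      (nhdsWithin 0 (Ioi 0)) :=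
    tendsto_nhdsWithin_iff.2 ⟨tendsto_one_div_add_atTop_nhds_zero_nat,
      Filter.Eventually.of_forall hpos⟩
  have h1 : Filter.Tendsto (fun n : ℕ => onPair (defect T (1 / ((n : ℝ) + 1))) (u n x))
      Filter.atTop (nhds 0) := by
    have h2 := (Real.continuous_sqrt.tendsto 0).comp (hθ.comp hδ)
    rw [Real.sqrt_zero] at h2
    exact squeeze_zero_norm
      (fun n => Real.le_sqrt_of_sq_le (hθu _ (hpos n) _ (hu n) _ (hpos n) x hx)) h2
  have h3 : Filter.Tendsto (fun n : ℕ => onPair (smoothing T (1 / ((n : ℝ) + 1))) (u n x))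
      Filter.atTop (nhds h) := by
    have h4 := hh.sub h1
    rw [sub_zero] at h4
    refine h4.congr fun n => ?_
    ext1 i
    rw [PiLp.sub_apply, onPair_apply, onPair_apply, ← sub_smoothing_eq_defect hT (hpos n),
      sub_sub_cancel]
  have hmem : (h, h) ∈ ball T R := by
    have : ‖h‖ ≤ R := le_of_tendsto hh.norm
      (Filter.Eventually.of_forall fun n => (hu n).norm_le x hx)
    exact ⟨this, this⟩
  have h5 : Filter.Tendsto (fun n : ℕ => state (1 / ((n : ℝ) + 1)) (u n x)) Filter.atTop
      (nhdsWithin (h, h) (ball T R)) :=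
    tendsto_nhdsWithin_iff.2 ⟨hh.prodMk_nhds h3, Filter.Eventually.of_forall fun n =>
      state_mem hT (hpos n) ((hu n).norm_le x hx)⟩
  exact (continuousOn_dyPair R (h, h) hmem).tendsto.comp h5

/-- Solvability of the system for `h = ∂ₜ² m`, in integrated form. -/
theorem exists_solution (hT : 0 < T) (hL : 0 ≤ L) (hR0 : 0 < R) (hR : c.SpeedBound R) :
    ∃ C, 0 ≤ C ∧ ∀ h₀ : Pair T, Real.exp (C * L) * ‖h₀‖ ^ 2 ≤ R ^ 2 →
      ∃ h : ℝ → Pair T, h 0 = h₀ ∧ ContinuousOn h (Icc 0 L) ∧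
        (∀ x ∈ Icc 0 L, ‖h x‖ ^ 2 ≤ Real.exp (C * L) * ‖h₀‖ ^ 2) ∧
        (∀ x ∈ Icc 0 L, ‖h x‖ ≤ R) ∧
        ∀ x ∈ Icc 0 L, HasDerivWithinAt (fun x => onPair (volterra T) (h x))
          (c.dyPair (h x, h x)) (Icc 0 L) x := by
  obtain ⟨C, hC0, hC⟩ := exists_isApprox hT hL hR0 hR
  refine ⟨C, hC0, fun h₀ hh₀ => ?_⟩
  have hpos : ∀ n : ℕ, 0 < 1 / ((n : ℝ) + 1) := fun n => Nat.one_div_pos_of_nat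
  choose u hu hub using fun n : ℕ => hC h₀ hh₀ _ (hpos n)
  have hcau := uniformCauchySeqOn_approx hT hL hR hu
  have hlim : ∀ x, ∃ y, x ∈ Icc 0 L → Filter.Tendsto (fun n => u n x) Filter.atTop (nhds y) := by
    intro x
    by_cases hx : x ∈ Icc 0 L
    · obtain ⟨y, hy⟩ := cauchySeq_tendsto_of_complete (hcau.cauchySeq hx)
      exact ⟨y, fun _ => hy⟩
    · exact ⟨0, fun h => absurd h hx⟩
  choose h hh using hlim
  have hunif : TendstoUniformlyOn u h Filter.atTop (Icc 0 L) :=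
    hcau.tendstoUniformlyOn_of_tendsto fun x hx => hh x hx
  have hcont : ContinuousOn h (Icc 0 L) :=
    hunif.continuousOn (Filter.Frequently.of_forall fun n => (hu n).continuousOn)
  have h0 : h 0 = h₀ := by
    refine tendsto_nhds_unique (hh 0 ⟨le_rfl, hL⟩) ?_
    simp only [(hu _).zero]
    exact tendsto_const_nhds
  have hbR : ∀ x ∈ Icc 0 L, ‖h x‖ ≤ R := fun x hx =>
    le_of_tendsto (hh x hx).norm (Filter.Eventually.of_forall fun n => (hu n).norm_le x hx)
  refine ⟨h, h0, hcont, fun x hx => le_of_tendsto ((hh x hx).norm.pow 2)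
    (Filter.Eventually.of_forall fun n => hub n x hx), hbR, fun x hx => ?_⟩
  -- The limit is taken in the integrated equation for ∂ₜm = Jh; the field for h contains an
  -- approximation of ∂ₜh, which need not converge in L².
  refine hasDerivWithinAt_of_eq_add_integral (u := fun x => onPair (volterra T) (h x))
    (u' := fun x => c.dyPair (h x, h x)) hL ((continuousOn_dyPair R).comp (hcont.prodMk hcont)
      fun x hx => ⟨hbR x hx, hbR x hx⟩) (fun x hx => ?_) hx
  have hsub : uIoc 0 x ⊆ Icc 0 L := by
    rw [uIoc_of_le hx.1]
    exact Ioc_subset_Icc_self.trans (Icc_subset_Icc_right hx.2)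
  obtain ⟨K, hK0, hK, -⟩ := c.bddLipOn_dyPair R
  have h1 : Filter.Tendsto
      (fun n : ℕ => ∫ y in (0 : ℝ)..x, c.dyPair (state (1 / ((n : ℝ) + 1)) (u n y)))
      Filter.atTop (nhds (∫ y in (0 : ℝ)..x, c.dyPair (h y, h y))) := by
    refine intervalIntegral.tendsto_integral_filter_of_dominated_convergence (fun _ => K) ?_ ?_ ?_ ?_
    · exact Filter.Eventually.of_forall fun n =>
        (((hu n).continuousOn_dyPair hT hR (hpos n)).mono hsub).aestronglyMeasurable
          measurableSet_uIoc
    · exact Filter.Eventually.of_forall fun n => Filter.Eventually.of_forall fun y hy =>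
        hK _ (state_mem hT (hpos n) ((hu n).norm_le y (hsub hy)))
    · exact intervalIntegrable_const
    · exact Filter.Eventually.of_forall fun y hy =>
        tendsto_dyPair_approx hT hR hu (hsub hy) (hh y (hsub hy))
  have h2 : Filter.Tendsto (fun n => onPair (volterra T) (u n x) - onPair (volterra T) h₀)
      Filter.atTop (nhds (onPair (volterra T) (h x) - onPair (volterra T) h₀)) :=
    (((onPair (volterra T)).continuous.tendsto _).comp (hh x hx)).sub_const _
  have h3 := tendsto_nhds_unique h1
    (h2.congr fun n => ((hu n).integral_dyPair hT hR (hpos n) hx).symm)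
  simp only [h3, h0]
  abel

end Coeffs

end SupersonicDuct

namespace SupersonicDuct

variable {T : ℝ}

/-! ### Weak derivatives and the du Bois-Reymond lemma -/

theorem IsPrim.integral_test (hT : 0 < T) {F : BC} {g : ScalarL2 T} (h : IsPrim F g) {φ : ℝ → ℝ}
    (hφ : IsTest T φ) :
    ∫ t, deriv φ t * emb T F t ∂(timeMeasure T) = -∫ t, φ t * g t ∂(timeMeasure T) := by
  obtain ⟨f, f', hf, hf', hp⟩ := hφ.isPrim
  rw [integral_eq_inner_emb hf, integral_eq_inner_emb hf']
  have h1 := (hp.mul h) T ⟨hT.le, le_rfl⟩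
  rw [prim_apply_end hT, inner_add_right, inner_emb_one_smul, inner_emb_one_smul] at h1
  simp only [BoundedContinuousFunction.coe_mul, Pi.mul_apply, hf] at h1
  rw [hφ.eq_zero (by simp), hφ.eq_zero (by simp)] at h1
  linarith [real_inner_comm (emb T F) (emb T f')]

theorem IsTest.exists_Icc (hT : 0 < T) {φ : ℝ → ℝ} (hφ : IsTest T φ) :
    ∃ a b, 0 < a ∧ a ≤ b ∧ b < T ∧ tsupport φ ⊆ Icc a b := by
  rcases (tsupport φ).eq_empty_or_nonempty with h | h
  · exact ⟨T / 2, T / 2, by positivity, le_rfl, by linarith, by simp [h]⟩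
  · have hK : IsCompact (tsupport φ) := hφ.2.1
    exact ⟨sInf (tsupport φ), sSup (tsupport φ), (hφ.2.2 (hK.sInf_mem h)).1,
      Real.sInf_le_sSup _ hK.bddBelow hK.bddAbove, (hφ.2.2 (hK.sSup_mem h)).2,
      hK.isBounded.subset_Icc_sInf_sSup⟩

/-- Mean zero is what makes the primitive vanish to the right of the support of ψ. -/
theorem IsTest.primitive (hT : 0 < T) {ψ : ℝ → ℝ} (hψ : IsTest T ψ) (h0 : ∫ t, ψ t = 0) :
    IsTest T (fun t => ∫ s in (0 : ℝ)..t, ψ s) ∧ deriv (fun t => ∫ s in (0 : ℝ)..t, ψ s) = ψ := by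
  have hd : ∀ t, HasDerivAt (fun t => ∫ s in (0 : ℝ)..t, ψ s) (ψ t) t := fun t =>
    intervalIntegral.integral_hasDerivAt_right (hψ.1.continuous.intervalIntegrable _ _)
      (hψ.1.continuous.stronglyMeasurableAtFilter _ _) hψ.1.continuous.continuousAt
  have hd' : deriv (fun t => ∫ s in (0 : ℝ)..t, ψ s) = ψ := funext fun t => (hd t).deriv
  obtain ⟨a, b, ha, hab, hb, hs⟩ := hψ.exists_Icc hT
  have hz : ∀ t, t ∉ Icc a b → ψ t = 0 := fun t ht => image_eq_zero_of_notMem_tsupport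
    fun h => ht (hs h)
  have hout : ∀ t, t ∉ Icc a b → ∫ s in (0 : ℝ)..t, ψ s = 0 := by
    intro t ht
    rcases lt_or_ge t a with h | h
    · rw [intervalIntegral.integral_congr (g := fun _ => (0 : ℝ)), intervalIntegral.integral_zero]
      intro s hs
      refine hz s fun h' => ?_
      have := hs.2
      rcases max_choice 0 t with h1 | h1 <;> simp only [h1] at this <;> linarith [h'.1]
    · have hbt : b < t := lt_of_not_ge fun h' => ht ⟨h, h'⟩
      rw [intervalIntegral.integral_of_le (ha.le.trans h)]
      refine Eq.trans ?_ h0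
      refine setIntegral_eq_integral_of_forall_compl_eq_zero fun s hs => hz s fun h' => hs ?_
      exact ⟨ha.trans_le h'.1, h'.2.trans hbt.le⟩
  have hts : tsupport (fun t => ∫ s in (0 : ℝ)..t, ψ s) ⊆ Icc a b :=
    closure_minimal (fun t ht => by_contra fun h => ht (hout t h)) isClosed_Icc
  refine ⟨⟨contDiff_infty_iff_deriv.2 ⟨fun t => (hd t).differentiableAt, by rw [hd']; exact hψ.1⟩,
    isCompact_Icc.of_isClosed_subset (isClosed_tsupport _) hts,
    hts.trans (Icc_subset_Ioo ha hb)⟩, hd'⟩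

theorem IsTest.sub_smul {φ ψ : ℝ → ℝ} (hφ : IsTest T φ) (hψ : IsTest T ψ) (c : ℝ) :
    IsTest T fun t => φ t - c * ψ t := by
  have hψ' : HasCompactSupport fun t => c * ψ t := hψ.2.1.mul_left
  have h1 : tsupport (fun t => φ t - c * ψ t) ⊆ tsupport φ ∪ tsupport ψ := by
    refine closure_minimal (fun t ht => ?_) ((isClosed_tsupport _).union (isClosed_tsupport _))
    by_contra h
    rw [mem_union, not_or] at h
    refine ht ?_
    simp only [image_eq_zero_of_notMem_tsupport h.1, image_eq_zero_of_notMem_tsupport h.2]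
    simp
  exact ⟨hφ.1.sub (contDiff_const.mul hψ.1),
    (hφ.2.1.isCompact.union hψ.2.1.isCompact).of_isClosed_subset (isClosed_tsupport _) h1,
    h1.trans (union_subset hφ.2.2 hψ.2.2)⟩

theorem exists_isTest_integral_eq_one (hT : 0 < T) : ∃ χ, IsTest T χ ∧ ∫ t, χ t = 1 := by
  let b : ContDiffBump (T / 2) := ⟨T / 8, T / 4, by positivity, by linarith⟩
  refine ⟨b.normed volume, ⟨b.contDiff_normed, b.hasCompactSupport_normed, ?_⟩,
    b.integral_normed⟩
  rw [b.tsupport_normed_eq]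
  intro t ht
  rw [Metric.mem_closedBall, Real.dist_eq] at ht
  have : b.rOut = T / 4 := rfl
  rw [this, abs_le] at ht
  exact ⟨by linarith [ht.1], by linarith [ht.2]⟩

theorem IsTest.integral_timeMeasure {φ : ℝ → ℝ} (hφ : IsTest T φ) :
    ∫ t, φ t ∂(timeMeasure T) = ∫ t, φ t :=
  setIntegral_eq_integral_of_forall_compl_eq_zero fun _ ht => hφ.eq_zero ht

theorem IsTest.integrable_mul {φ : ℝ → ℝ} (hφ : IsTest T φ) (f : ScalarL2 T) :
    Integrable (fun t => φ t * f t) (timeMeasure T) := by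
  obtain ⟨C, hC⟩ := hφ.2.1.exists_bound_of_continuous hφ.1.continuous
  exact (integrable_scalar f).bdd_mul hφ.1.continuous.aestronglyMeasurable
    (Filter.Eventually.of_forall hC)

/-- The du Bois-Reymond lemma: an `L²` function with a weak derivative is a primitive of it. -/
theorem exists_eq_add_volterra (hT : 0 < T) {f g : ScalarL2 T}
    (h : ∀ φ, IsTest T φ →
      ∫ t, deriv φ t * f t ∂(timeMeasure T) = -∫ t, φ t * g t ∂(timeMeasure T)) :
    ∃ c : ℝ, f = c • emb T 1 + volterra T g := by
  -- For any test ψ, ψ − (∫ψ)χ has mean zero and so is the derivative of a test function; testing u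
  -- against it shows that u is the constant ∫χu.
  obtain ⟨χ, hχ, hχ1⟩ := exists_isTest_integral_eq_one hT
  set u := f - volterra T g with hu
  have hu0 : ∀ φ, IsTest T φ → ∫ t, deriv φ t * u t ∂(timeMeasure T) = 0 := by
    intro φ hφ
    obtain ⟨F, F', hF, hF', hp⟩ := hφ.isPrim
    rw [integral_eq_inner_emb hF', hu, inner_sub_right, ← integral_eq_inner_emb hF',
      ← integral_eq_inner_emb hF', h φ hφ, volterra_apply, (isPrim_prim g).integral_test hT hφ,
      sub_self]
  set c := ∫ t, χ t * u t ∂(timeMeasure T) with hc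
  refine ⟨c, ?_⟩
  rw [← sub_eq_iff_eq_add, ← hu, ← sub_eq_zero]
  refine eq_zero_of_integral_test fun ψ hψ => ?_
  obtain ⟨hp, hd⟩ := (hψ.sub_smul hχ (∫ t, ψ t)).primitive hT (by
    rw [integral_sub (hψ.1.continuous.integrable_of_hasCompactSupport hψ.2.1)
      ((hχ.1.continuous.integrable_of_hasCompactSupport hχ.2.1).const_mul _), integral_const_mul,
      hχ1, mul_one, sub_self])
  have h1 := hu0 _ hp
  rw [hd] at h1
  have h2 : ∫ t, (ψ t - (∫ t, ψ t) * χ t) * u t ∂(timeMeasure T)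
      = ∫ t, ψ t * u t ∂(timeMeasure T) - (∫ t, ψ t) * c := by
    rw [hc, ← integral_const_mul, ← integral_sub (hψ.integrable_mul u)
      ((hχ.integrable_mul u).const_mul _)]
    refine integral_congr_ae (Filter.Eventually.of_forall fun t => ?_)
    simp only
    ring
  rw [h2] at h1
  obtain ⟨F, F', hF, hF', hp⟩ := hψ.isPrim
  have h3 : ∫ t, ψ t = inner ℝ (emb T F) (emb T 1) := by
    rw [← hψ.integral_timeMeasure, ← integral_eq_inner_emb hF]
    refine integral_congr_ae ?_
    filter_upwards [coeFn_emb (T := T) 1] with t ht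
    rw [ht]; simp
  rw [integral_eq_inner_emb hF, inner_sub_right, real_inner_smul_right, ← h3,
    ← integral_eq_inner_emb hF, mul_comm]
  exact h1

/-! ### Vector-valued functions and their components -/

section Components

/-- The components of a vector-valued `L²` function. -/
noncomputable def comp (i : Fin 2) : L2 T →L[ℝ] ScalarL2 T :=
  (EuclideanSpace.proj i : State →L[ℝ] ℝ).compLpL 2 (timeMeasure T)

theorem coeFn_comp (i : Fin 2) (f : L2 T) : comp i f =ᵐ[timeMeasure T] fun t => f t i :=
  ContinuousLinearMap.coeFn_compLpL _ f

theorem ext_comp {f g : L2 T} (h : ∀ i, comp i f = comp i g) : f = g := by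
  apply Lp.ext
  filter_upwards [coeFn_comp 0 f, coeFn_comp 1 f, coeFn_comp 0 g, coeFn_comp 1 g] with t h0 h1 h2 h3
  ext i
  fin_cases i
  · change f t 0 = g t 0
    rw [← h0, ← h2, h 0]
  · change f t 1 = g t 1
    rw [← h1, ← h3, h 1]

/-- The vector-valued `L²` function with given components. -/
noncomputable def ofPair : Pair T →L[ℝ] L2 T :=
  ∑ i, ((ContinuousLinearMap.toSpanSingleton ℝ (EuclideanSpace.single i (1 : ℝ) : State)).compLpL 2
    (timeMeasure T)).comp (PiLp.proj 2 (𝕜 := ℝ) (fun _ : Fin 2 => ScalarL2 T) i)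

theorem coeFn_ofPair (v : Pair T) (i : Fin 2) :
    (fun t => ofPair v t i) =ᵐ[timeMeasure T] v i := by
  have e : ofPair v
      = (ContinuousLinearMap.toSpanSingleton ℝ (EuclideanSpace.single 0 (1 : ℝ) : State)).compLpL 2
          (timeMeasure T) (v 0)
        + (ContinuousLinearMap.toSpanSingleton ℝ (EuclideanSpace.single 1 (1 : ℝ) : State)).compLpL 2
          (timeMeasure T) (v 1) := by
    simp [ofPair, Fin.sum_univ_two]
  rw [e]
  filter_upwards [Lp.coeFn_add ((ContinuousLinearMap.toSpanSingleton ℝ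
      (EuclideanSpace.single 0 (1 : ℝ) : State)).compLpL 2 (timeMeasure T) (v 0))
    ((ContinuousLinearMap.toSpanSingleton ℝ
      (EuclideanSpace.single 1 (1 : ℝ) : State)).compLpL 2 (timeMeasure T) (v 1)),
    ContinuousLinearMap.coeFn_compLpL (p := 2) (μ := timeMeasure T)
      (ContinuousLinearMap.toSpanSingleton ℝ (EuclideanSpace.single 0 (1 : ℝ) : State)) (v 0),
    ContinuousLinearMap.coeFn_compLpL (p := 2) (μ := timeMeasure T)
      (ContinuousLinearMap.toSpanSingleton ℝ (EuclideanSpace.single 1 (1 : ℝ) : State)) (v 1)]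
    with t h1 h2 h3
  rw [h1, Pi.add_apply, h2, h3]
  fin_cases i <;> simp

@[simp]
theorem comp_ofPair (v : Pair T) (i : Fin 2) : comp i (ofPair v) = v i := by
  apply Lp.ext
  filter_upwards [coeFn_comp i (ofPair v), coeFn_ofPair v i] with t h1 h2
  rw [h1]; exact h2

/-- The pair of components of a vector-valued `L²` function. -/
noncomputable def toPair : L2 T →L[ℝ] Pair T :=
  ((PiLp.continuousLinearEquiv 2 ℝ (fun _ : Fin 2 => ScalarL2 T)).symm :
      (Fin 2 → ScalarL2 T) →L[ℝ] Pair T).comp (ContinuousLinearMap.pi fun i => comp i)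

@[simp]
theorem toPair_apply (f : L2 T) (i : Fin 2) : toPair f i = comp i f := rfl

theorem ofPair_toPair (f : L2 T) : ofPair (toPair f) = f := ext_comp fun i => by simp

theorem toPair_injective : Function.Injective (toPair (T := T)) := fun f g h => by
  rw [← ofPair_toPair f, h, ofPair_toPair]

theorem integral_smul_apply {ψ : ℝ → ℝ} {f : L2 T}
    (h : Integrable (fun t => ψ t • f t) (timeMeasure T)) (i : Fin 2) :
    (∫ t, ψ t • f t ∂(timeMeasure T)) i = ∫ t, ψ t * comp i f t ∂(timeMeasure T) := by
  have h1 := ContinuousLinearMap.integral_comp_comm (EuclideanSpace.proj i : State →L[ℝ] ℝ) h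
  change (EuclideanSpace.proj i : State →L[ℝ] ℝ) (∫ t, ψ t • f t ∂(timeMeasure T)) = _
  rw [← h1]
  refine integral_congr_ae ?_
  filter_upwards [coeFn_comp i f] with t ht
  rw [ht]
  simp

theorem isWeakDeriv_iff {f g : L2 T} : IsWeakDeriv f g ↔ ∀ i, ∀ φ, IsTest T φ →
    ∫ t, deriv φ t * comp i f t ∂(timeMeasure T)
      = -∫ t, φ t * comp i g t ∂(timeMeasure T) := by
  constructor
  · intro h i φ hφ
    rw [← integral_smul_apply (hφ.integrable_deriv f), ← integral_smul_apply (hφ.integrable g),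
      h φ hφ]
    rfl
  · intro h φ hφ
    ext i
    rw [integral_smul_apply (hφ.integrable_deriv f), h i φ hφ,
      ← integral_smul_apply (hφ.integrable g)]
    rfl

theorem isWeakDeriv_ofPair (hT : 0 < T) (v : Pair T) :
    IsWeakDeriv (ofPair (onPair (volterra T) v)) (ofPair v) := by
  rw [isWeakDeriv_iff]
  intro i φ hφ
  rw [comp_ofPair, comp_ofPair, onPair_apply, volterra_apply]
  exact (isPrim_prim (v i)).integral_test hT hφ

theorem IsWeakDeriv.exists_comp_eq (hT : 0 < T) {f g : L2 T} (h : IsWeakDeriv f g) (i : Fin 2) :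
    ∃ c : ℝ, comp i f = c • emb T 1 + volterra T (comp i g) :=
  exists_eq_add_volterra hT (isWeakDeriv_iff.1 h i)

theorem IsWeakDeriv.unique {f g g' : L2 T} (h : IsWeakDeriv f g) (h' : IsWeakDeriv f g') :
    g = g' := by
  refine ext_comp fun i => ?_
  rw [← sub_eq_zero]
  refine eq_zero_of_integral_test fun φ hφ => ?_
  obtain ⟨F, F', hF, hF', -⟩ := hφ.isPrim
  rw [integral_eq_inner_emb hF, inner_sub_right, ← integral_eq_inner_emb hF,
    ← integral_eq_inner_emb hF]
  have h1 := isWeakDeriv_iff.1 h i φ hφ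
  have h2 := isWeakDeriv_iff.1 h' i φ hφ
  linarith

theorem eqOn_of_ae_eq (hT : 0 < T) {f g : ℝ → ℝ} (hf : ContinuousOn f (Icc 0 T))
    (hg : ContinuousOn g (Icc 0 T)) (h : f =ᵐ[timeMeasure T] g) : EqOn f g (Icc 0 T) := by
  refine Measure.eqOn_Icc_of_ae_eq volume hT.ne ?_ hf hg
  rwa [Measure.restrict_congr_set Ioo_ae_eq_Icc.symm]

theorem IsContRep.eqOn (hT : 0 < T) {f : L2 T} {g : ℝ → State} (hg : IsContRep f g) {i : Fin 2}
    {F : BC} (hF : comp i f = emb T F) : EqOn (fun t => g t i) F (Icc 0 T) := by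
  refine eqOn_of_ae_eq hT ?_ F.continuous.continuousOn ?_
  · exact (EuclideanSpace.proj i : State →L[ℝ] ℝ).continuous.comp_continuousOn hg.1
  · have h2 := coeFn_comp i f
    rw [hF] at h2
    filter_upwards [hg.2, h2, coeFn_emb (T := T) F] with t h1 h2 h3
    rw [← h1, ← h2, h3]

/-- The integration constant is the value at 0 of the continuous representative. -/
theorem IsWeakDeriv.comp_eq (hT : 0 < T) {f g : L2 T} (h : IsWeakDeriv f g)
    (h0 : VanishesAtZero f) (i : Fin 2) : comp i f = volterra T (comp i g) := by
  obtain ⟨c, hc⟩ := h.exists_comp_eq hT i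
  obtain ⟨G, hG, hG0⟩ := h0
  have h1 : comp i f = emb T (c • 1 + prim (comp i g)) := by
    rw [hc, map_add, map_smul]; rfl
  have h2 := hG.eqOn hT h1 (⟨le_rfl, hT.le⟩ : (0 : ℝ) ∈ Icc 0 T)
  have h3 : c = 0 := by simpa [hG0] using h2.symm
  rw [hc, h3, zero_smul, zero_add]

theorem isContRep_ofPair {v : Pair T} {F : Fin 2 → BC} (h : ∀ i, v i = emb T (F i)) :
    IsContRep (ofPair v) (fun t => WithLp.toLp 2 fun i => F i t) := by
  constructor
  · refine Continuous.continuousOn ?_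
    exact (PiLp.continuous_toLp 2 _).comp (continuous_pi fun i => (F i).continuous)
  · have h0 := coeFn_ofPair v 0
    have h1 := coeFn_ofPair v 1
    rw [h 0] at h0
    rw [h 1] at h1
    filter_upwards [h0, h1, coeFn_emb (T := T) (F 0), coeFn_emb (T := T) (F 1)] with t h0 h1 h2 h3
    ext i
    fin_cases i
    · exact h0.trans h2
    · exact h1.trans h3

end Components

end SupersonicDuct

namespace SupersonicDuct

variable {T : ℝ}

/-! ### Coefficients of the duct problem -/

/-- The bounded continuous function which agrees with `f` on `[0, T]` and is constant on both sides
of it. -/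
noncomputable def clamp (hT : 0 ≤ T) (f : ℝ → ℝ) (hf : Continuous f) : BC :=
  (BoundedContinuousFunction.mkOfCompact
    (⟨fun t : Icc 0 T => f t, hf.comp continuous_subtype_val⟩ : C(Icc 0 T, ℝ))).compContinuous
    ⟨projIcc 0 T hT, continuous_projIcc⟩

theorem clamp_apply (hT : 0 ≤ T) {f : ℝ → ℝ} (hf : Continuous f) {t : ℝ} (ht : t ∈ Icc 0 T) :
    clamp hT f hf t = f t := by
  change f (projIcc 0 T hT t) = f t
  rw [projIcc_of_mem hT ht]

theorem isPrim_clamp (hT : 0 ≤ T) {f f' : ℝ → ℝ} (hf : Continuous f) (hf' : Continuous f')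
    (h : ∀ t, HasDerivAt f (f' t) t) : IsPrim (clamp hT f hf) (emb T (clamp hT f' hf')) := by
  refine isPrim_of_hasDerivAt fun t ht => ?_
  rw [clamp_apply hT hf' ⟨ht.1.le, ht.2.le⟩]
  refine (h t).congr_of_eventuallyEq ?_
  filter_upwards [isOpen_Ioo.mem_nhds ht] with s hs
  exact clamp_apply hT hf ⟨hs.1.le, hs.2.le⟩

namespace Duct

variable {d : Duct}

theorem cb_nonneg (hd : d.Admissible) : 0 ≤ d.cb :=
  mul_nonneg (Real.sqrt_nonneg _) (Real.rpow_nonneg hd.ρb_pos.le _)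

theorem continuous_α (hd : d.Admissible) : Continuous d.α := hd.α_smooth.continuous

theorem hasDerivAt_α (hd : d.Admissible) (t : ℝ) : HasDerivAt d.α (deriv d.α t) t :=
  (hd.α_smooth.differentiable (by norm_num) t).hasDerivAt

theorem contDiff_deriv_α (hd : d.Admissible) : ContDiff ℝ 1 (deriv d.α) :=
  ((contDiff_succ_iff_deriv (n := 1)).1 hd.α_smooth).2.2

theorem continuous_deriv_α (hd : d.Admissible) : Continuous (deriv d.α) :=
  (contDiff_deriv_α hd).continuous

theorem hasDerivAt_deriv_α (hd : d.Admissible) (t : ℝ) :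
    HasDerivAt (deriv d.α) (deriv (deriv d.α) t) t :=
  ((contDiff_deriv_α hd).differentiable (by norm_num) t).hasDerivAt

theorem continuous_deriv_deriv_α (hd : d.Admissible) : Continuous (deriv (deriv d.α)) :=
  (contDiff_deriv_α hd).continuous_deriv (by norm_num)

theorem hasDerivAt_uα (hd : d.Admissible) (t : ℝ) : HasDerivAt d.uα (d.α t * d.uα t) t := by
  have h1 : HasDerivAt (fun t => ∫ s in (0 : ℝ)..t, d.α s) (d.α t) t :=
    intervalIntegral.integral_hasDerivAt_right ((continuous_α hd).intervalIntegrable _ _)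
      ((continuous_α hd).stronglyMeasurableAtFilter _ _) (continuous_α hd).continuousAt
  refine (h1.exp.mul_const d.ub).congr_deriv ?_
  rw [uα]
  ring

theorem continuous_uα (hd : d.Admissible) : Continuous d.uα :=
  continuous_iff_continuousAt.2 fun t => (hasDerivAt_uα hd t).continuousAt

theorem ub_le_uα (hd : d.Admissible) {t : ℝ} (ht : 0 ≤ t) : d.ub ≤ d.uα t := by
  have h1 : 0 ≤ d.ub := (cb_nonneg hd).trans hd.supersonic.le
  exact le_mul_of_one_le_left h1 (Real.one_le_exp (hd.α_primitive t ht))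

/-- The signs of the sound speed in the two characteristic speeds. -/
def sign : Fin 2 → ℝ := ![-1, 1]

/-- The coefficients of the system for the perturbation `m`. -/
noncomputable def coeffs (hd : d.Admissible) (hT : 0 < T) : Coeffs T where
  -- Half the lower bound ub − cb of the background speeds; the other half is left for the
  -- perturbation.
  κ := (d.ub - d.cb) / 2
  κ_pos := half_pos (sub_pos.2 hd.supersonic)
  β := clamp hT.le (fun t => d.α t / 2) ((continuous_α hd).div_const 2)
  β' := clamp hT.le (fun t => deriv d.α t / 2) ((continuous_deriv_α hd).div_const 2)
  β'' := emb T (clamp hT.le (fun t => deriv (deriv d.α) t / 2)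
    ((continuous_deriv_deriv_α hd).div_const 2))
  isPrim_β := isPrim_clamp _ _ _ fun t => (hasDerivAt_α hd t).div_const 2
  isPrim_β' := isPrim_clamp _ _ _ fun t => (hasDerivAt_deriv_α hd t).div_const 2
  μ i := clamp hT.le (fun t => d.uα t + sign i * d.cb) ((continuous_uα hd).add continuous_const)
  μ' i := clamp hT.le (fun t => d.α t * d.uα t) ((continuous_α hd).mul (continuous_uα hd))
  μ'' i := emb T (clamp hT.le (fun t => deriv d.α t * d.uα t + d.α t * (d.α t * d.uα t))
    (((continuous_deriv_α hd).mul (continuous_uα hd)).add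
      ((continuous_α hd).mul ((continuous_α hd).mul (continuous_uα hd)))))
  isPrim_μ i := isPrim_clamp _ _ _ fun t => (hasDerivAt_uα hd t).add_const _
  isPrim_μ' i := isPrim_clamp _ _ _ fun t => (hasDerivAt_α hd t).mul (hasDerivAt_uα hd t)
  -- The speeds are u ± c with u = r + s and c = (γ − 1)/2 · (s − r); `sign j` is also the sign of
  -- the j-th invariant in c.
  ℓ i j := 1 + sign i * ((d.γ - 1) / 2) * sign j
  μ_ge i t ht := by
    rw [clamp_apply _ _ ht]
    have h1 := ub_le_uα hd ht.1
    have h2 := cb_nonneg hd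
    fin_cases i <;> simp only [sign] <;> simp <;> linarith

theorem speed_eq (hd : d.Admissible) (hT : 0 < T) {t : ℝ} (ht : t ∈ Icc 0 T) (m : State)
    (i : Fin 2) :
    d.speed t m i = (coeffs hd hT).μ i t + ∑ j, (coeffs hd hT).ℓ i j * m j := by
  have h1 : d.γ - 1 ≠ 0 := (sub_pos.2 hd.one_lt_γ).ne'
  have hμ : (coeffs hd hT).μ i t = d.uα t + sign i * d.cb := clamp_apply hT.le _ ht
  have hℓ : ∀ j, (coeffs hd hT).ℓ i j = 1 + sign i * ((d.γ - 1) / 2) * sign j := fun j => rfl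
  rw [hμ, Fin.sum_univ_two, hℓ, hℓ]
  fin_cases i <;>
  · simp [speed, charSpeed, velocity, soundSpeed, rα, sα, sign]
    field_simp
    ring

end Duct

theorem Coeffs.exists_speedBound (c : Coeffs T) : ∃ R, 0 < R ∧ c.SpeedBound R := by
  set Λ : ℝ := ∑ i, ∑ j, |c.ℓ i j| with hΛ
  have hΛ0 : 0 ≤ Λ := Finset.sum_nonneg fun i _ => Finset.sum_nonneg fun j _ => abs_nonneg _
  set M : ℝ := ‖(prim : ScalarL2 T →L[ℝ] BC)‖ * ‖volterra T‖ with hM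
  have hM0 : 0 ≤ M := by positivity
  have hκ := c.κ_pos
  -- On this ball |mⱼ| ≤ M R, so the perturbation of each speed is at most Λ M R ≤ κ.
  refine ⟨c.κ / (Λ * M + 1), by positivity, fun u hu i t ht => ?_⟩
  have hm : ∀ j, |m u j t| ≤ M * (c.κ / (Λ * M + 1)) := by
    intro j
    refine ((m u j).norm_coe_le_norm t).trans ?_
    refine (prim.le_opNorm _).trans ?_
    rw [hM, mul_assoc]
    refine mul_le_mul_of_nonneg_left (((volterra T).le_opNorm _).trans ?_) (norm_nonneg _)
    exact mul_le_mul_of_nonneg_left ((norm_apply_le_pair u.1 j).trans hu.1) (norm_nonneg _)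
  have h1 : c.lam u i t = c.μ i t + ∑ j, c.ℓ i j * m u j t := by
    simp [lam, Fin.sum_univ_two]
  have h2 : |∑ j, c.ℓ i j * m u j t| ≤ Λ * (M * (c.κ / (Λ * M + 1))) := by
    refine (Finset.abs_sum_le_sum_abs _ _).trans ?_
    have h3 : ∑ j, |c.ℓ i j| ≤ Λ := Finset.single_le_sum (f := fun i => ∑ j, |c.ℓ i j|)
      (fun i _ => Finset.sum_nonneg fun j _ => abs_nonneg _) (Finset.mem_univ i)
    refine le_trans ?_ (mul_le_mul_of_nonneg_right h3 (by positivity))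
    rw [Finset.sum_mul]
    refine Finset.sum_le_sum fun j _ => ?_
    rw [abs_mul]
    exact mul_le_mul_of_nonneg_left (hm j) (abs_nonneg _)
  have h3 : Λ * (M * (c.κ / (Λ * M + 1))) ≤ c.κ := by
    rw [← mul_assoc, ← mul_div_assoc, div_le_iff₀ (by positivity)]
    nlinarith
  have h4 := c.μ_ge i t ht
  rw [h1]
  linarith [neg_abs_le (∑ j, c.ℓ i j * m u j t)]

/-! ### Elements of Sobolev spaces determined by their top derivative -/

/-- The element of `H²` with given second derivative, vanishing to second order at `0`. -/
noncomputable def ofDeriv₂ (hT : 0 < T) : Pair T →L[ℝ] Sobolev 2 T :=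
  (((PiLp.continuousLinearEquiv 2 ℝ (fun _ : Fin 3 => L2 T)).symm :
      (Fin 3 → L2 T) →L[ℝ] PiLp 2 (fun _ : Fin 3 => L2 T)).comp
    (ContinuousLinearMap.pi ![ofPair.comp (onPair ((volterra T).comp (volterra T))),
      ofPair.comp (onPair (volterra T)), ofPair])).codRestrict (Sobolev 2 T) fun h i => by
    fin_cases i
    · exact isWeakDeriv_ofPair hT (onPair (volterra T) h)
    · exact isWeakDeriv_ofPair hT h

/-- The element of `H¹` with given derivative, vanishing at `0`. -/
noncomputable def ofDeriv₁ (hT : 0 < T) : Pair T →L[ℝ] Sobolev 1 T :=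
  (((PiLp.continuousLinearEquiv 2 ℝ (fun _ : Fin 2 => L2 T)).symm :
      (Fin 2 → L2 T) →L[ℝ] PiLp 2 (fun _ : Fin 2 => L2 T)).comp
    (ContinuousLinearMap.pi ![ofPair.comp (onPair (volterra T)),
      ofPair])).codRestrict (Sobolev 1 T) fun h i => by
    fin_cases i
    exact isWeakDeriv_ofPair hT h

theorem wderiv_ofDeriv₂_zero (hT : 0 < T) (h : Pair T) :
    wderiv (ofDeriv₂ hT h) 0 = ofPair (onPair ((volterra T).comp (volterra T)) h) := rfl

theorem wderiv_ofDeriv₂_one (hT : 0 < T) (h : Pair T) :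
    wderiv (ofDeriv₂ hT h) 1 = ofPair (onPair (volterra T) h) := rfl

theorem wderiv_ofDeriv₁_zero (hT : 0 < T) (h : Pair T) :
    wderiv (ofDeriv₁ hT h) 0 = ofPair (onPair (volterra T) h) := rfl

theorem toH1_ofDeriv₂ (hT : 0 < T) (h : Pair T) :
    toH1 (ofDeriv₂ hT h) = ofDeriv₁ hT (onPair (volterra T) h) := by
  refine Subtype.ext (PiLp.ext fun i => ?_)
  fin_cases i <;> rfl

/-- Weak derivatives are unique, so comparing solutions in L² suffices for uniqueness in H². -/
theorem sobolev_ext {f g : Sobolev 2 T} (h : wderiv f 0 = wderiv g 0) : f = g := by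
  have h1 : wderiv f 1 = wderiv g 1 := by
    have hf : IsWeakDeriv (wderiv f 0) (wderiv f 1) := f.2 0
    have hg : IsWeakDeriv (wderiv g 0) (wderiv g 1) := g.2 0
    exact hf.unique (h ▸ hg)
  have h2 : wderiv f 2 = wderiv g 2 := by
    have hf : IsWeakDeriv (wderiv f 1) (wderiv f 2) := f.2 1
    have hg : IsWeakDeriv (wderiv g 1) (wderiv g 2) := g.2 1
    exact hf.unique (h1 ▸ hg)
  refine Subtype.ext (PiLp.ext fun i => ?_)
  fin_cases i
  · exact h
  · exact h1
  · exact h2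

/-- The compatibility conditions kill both integration constants; this matches the boundary value at
x = 0 with m₀. -/
theorem ofDeriv₂_toPair (hT : 0 < T) {f : Sobolev 2 T} (h0 : VanishesAtZero (wderiv f 0))
    (h1 : VanishesAtZero (wderiv f 1)) : ofDeriv₂ hT (toPair (wderiv f 2)) = f := by
  refine sobolev_ext ?_
  rw [wderiv_ofDeriv₂_zero]
  refine ext_comp fun i => ?_
  have hf0 : IsWeakDeriv (wderiv f 0) (wderiv f 1) := f.2 0
  have hf1 : IsWeakDeriv (wderiv f 1) (wderiv f 2) := f.2 1
  rw [comp_ofPair, hf0.comp_eq hT h0, hf1.comp_eq hT h1]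
  rfl

theorem norm_wderiv_le {k : ℕ} (f : Sobolev k T) (i : Fin (k + 1)) : ‖wderiv f i‖ ≤ ‖f‖ :=
  PiLp.norm_apply_le f.1 i

end SupersonicDuct

namespace SupersonicDuct

variable {T : ℝ}

namespace Coeffs

variable (c : Coeffs T) {R : ℝ}

/-! ### Existence -/

theorem lam_apply (u : Pair T × Pair T) (i : Fin 2) (t : ℝ) :
    c.lam u i t = c.μ i t + ∑ j, c.ℓ i j * m u j t := by
  simp [lam, Fin.sum_univ_two]

theorem exists_norm_dyPair_le (hR0 : 0 ≤ R) : ∃ K, 0 ≤ K ∧ ∀ h : Pair T, ‖h‖ ≤ R →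
    ‖c.dyPair (h, h)‖ ≤ K * ‖h‖ := by
  obtain ⟨K, hK, -, h2⟩ := c.bddLipOn_dyPair R
  refine ⟨K, hK, fun h hh => ?_⟩
  have h3 := h2 (h, h) ⟨hh, hh⟩ 0 ⟨by simpa using hR0, by simpa using hR0⟩
  have h4 : c.dyPair 0 = 0 := PiLp.ext fun i => dy_at_zero
  rwa [h4, sub_zero, sub_zero, Prod.norm_mk, max_self] at h3

theorem onPair_volterra_dyPair {c : Coeffs T} (hR : c.SpeedBound R) {u : Pair T × Pair T}
    (hu : u ∈ ball T R) (i : Fin 2) : onPair (volterra T) (c.dyPair u) i = emb T (c.y u i) :=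
  volterra_dy (hR u hu i)

end Coeffs

namespace Duct

variable {d : Duct}

theorem system_iff (t : ℝ) (v w₁ w₀ : State) :
    v.ofLp + (d.Lam t w₀).mulVec w₁.ofLp
        = (d.α t / 2) • (d.Lam t w₀).mulVec ![w₀ 0 + w₀ 1, w₀ 0 + w₀ 1] ↔
      ∀ i, v i + w₁ i / d.speed t w₀ i = d.α t / 2 * ((w₀ 0 + w₀ 1) / d.speed t w₀ i) := by
  rw [funext_iff]
  refine forall_congr' fun i => ?_
  have h1 : (![w₀ 0 + w₀ 1, w₀ 0 + w₀ 1] : Fin 2 → ℝ) i = w₀ 0 + w₀ 1 := by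
    fin_cases i <;> rfl
  simp only [Lam, Pi.add_apply, Pi.smul_apply, Matrix.mulVec_diagonal, h1, smul_eq_mul,
    one_div_mul_eq_div]

theorem system_ofDeriv (hd : d.Admissible) (hT : 0 < T) {R : ℝ}
    (hR : (coeffs hd hT).SpeedBound R) {h : Pair T} (hh : ‖h‖ ≤ R) :
    ∀ᵐ t ∂(timeMeasure T),
      (wderiv (ofDeriv₁ hT ((coeffs hd hT).dyPair (h, h))) 0 t).ofLp
        + (d.Lam t (wderiv (ofDeriv₂ hT h) 0 t)).mulVec (wderiv (ofDeriv₂ hT h) 1 t).ofLp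
      = (d.α t / 2) • (d.Lam t (wderiv (ofDeriv₂ hT h) 0 t)).mulVec
          ![wderiv (ofDeriv₂ hT h) 0 t 0 + wderiv (ofDeriv₂ hT h) 0 t 1,
            wderiv (ofDeriv₂ hT h) 0 t 0 + wderiv (ofDeriv₂ hT h) 0 t 1] := by
  set c := coeffs hd hT with hc
  have hu : (h, h) ∈ Coeffs.ball T R := ⟨hh, hh⟩
  have hy : ∀ᵐ t ∂(timeMeasure T), ∀ i,
      wderiv (ofDeriv₁ hT (c.dyPair (h, h))) 0 t i = c.y (h, h) i t := by
    refine ae_all_iff.2 fun i => ?_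
    have h1 := coeFn_ofPair (onPair (volterra T) (c.dyPair (h, h))) i
    rw [Coeffs.onPair_volterra_dyPair hR hu] at h1
    filter_upwards [h1, coeFn_emb (T := T) (c.y (h, h) i)] with t h2 h3
    rw [wderiv_ofDeriv₁_zero, h2, h3]
  have hp : ∀ᵐ t ∂(timeMeasure T), ∀ i,
      wderiv (ofDeriv₂ hT h) 1 t i = Coeffs.p (h, h) i t := by
    refine ae_all_iff.2 fun i => ?_
    filter_upwards [coeFn_ofPair (onPair (volterra T) h) i,
      coeFn_emb (T := T) (Coeffs.p (h, h) i)] with t h2 h3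
    rw [wderiv_ofDeriv₂_one, h2, ← h3]
    rfl
  have hm : ∀ᵐ t ∂(timeMeasure T), ∀ i,
      wderiv (ofDeriv₂ hT h) 0 t i = Coeffs.m (h, h) i t := by
    refine ae_all_iff.2 fun i => ?_
    filter_upwards [coeFn_ofPair (onPair ((volterra T).comp (volterra T)) h) i,
      coeFn_emb (T := T) (Coeffs.m (h, h) i)] with t h2 h3
    rw [wderiv_ofDeriv₂_zero, h2, ← h3]
    rfl
  filter_upwards [hy, hp, hm, ae_restrict_mem measurableSet_Ioo] with t h1 h2 h3 ht
  have ht' : t ∈ Icc 0 T := ⟨ht.1.le, ht.2.le⟩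
  refine (system_iff t _ _ _).2 fun i => ?_
  have h4 : d.speed t (wderiv (ofDeriv₂ hT h) 0 t) i = c.lam (h, h) i t := by
    rw [speed_eq hd hT ht', c.lam_apply]
    simp only [h3, hc]
  have h5 : c.κ ≤ c.lam (h, h) i t := hR _ hu i t ht'
  have h6 : c.lam (h, h) i t ≠ 0 := (c.κ_pos.trans_le h5).ne'
  have h7 : c.a (h, h) i t = 1 / c.lam (h, h) i t :=
    eq_one_div_of_mul_eq_one_left (recip_mul_apply c.κ_pos h5)
  have h8 : c.y (h, h) i t = 1 / c.lam (h, h) i t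
      * (d.α t / 2 * (Coeffs.m (h, h) 0 t + Coeffs.m (h, h) 1 t) - Coeffs.p (h, h) i t) := by
    have hβ : c.β t = d.α t / 2 := clamp_apply hT.le _ ht'
    rw [← h7, ← hβ]
    simp [Coeffs.y, Coeffs.q, Fin.sum_univ_two, Coeffs.p]
  rw [h1, h2, h3, h3, h4, h8]
  field_simp
  ring

theorem speed_ofDeriv_ne_zero (hd : d.Admissible) (hT : 0 < T) {R : ℝ}
    (hR : (coeffs hd hT).SpeedBound R) {h : Pair T} (hh : ‖h‖ ≤ R) {t : ℝ} (ht : t ∈ Icc 0 T)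
    (i : Fin 2) : d.speed t (WithLp.toLp 2 fun i => Coeffs.m (h, h) i t) i ≠ 0 := by
  have h1 := hR (h, h) ⟨hh, hh⟩ i t ht
  rw [Coeffs.lam_apply] at h1
  rw [speed_eq hd hT ht]
  exact ((coeffs hd hT).κ_pos.trans_le h1).ne'

theorem exists_isSolution (hd : d.Admissible) (hT : 0 < T) :
    ∃ ε₀ C : ℝ, 0 < ε₀ ∧ 0 < C ∧ ∀ m₀ : Sobolev 2 T, VanishesAtZero (wderiv m₀ 0) →
      VanishesAtZero (wderiv m₀ 1) → ‖m₀‖ ≤ ε₀ →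
      ∃ m : ℝ → Sobolev 2 T, d.IsSolution m₀ m ∧ ∀ x ∈ Icc 0 d.L, ‖m x‖ ≤ C * ‖m₀‖ ∧
        ‖derivWithin (fun y => toH1 (m y)) (Icc 0 d.L) x‖ ≤ C * ‖m₀‖ := by
  set c := coeffs hd hT with hc
  obtain ⟨R, hR0, hR⟩ := c.exists_speedBound
  obtain ⟨C₀, -, hC₀⟩ := c.exists_solution hT hd.L_pos.le hR0 hR
  obtain ⟨K, hK, hdy⟩ := c.exists_norm_dyPair_le hR0.le
  set N : ℝ := ‖(toPair : L2 T →L[ℝ] Pair T)‖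
  have hN : 0 ≤ N := norm_nonneg _
  set E : ℝ := Real.exp (C₀ * d.L)
  have hE0 : 0 < E := Real.exp_pos _
  set S : ℝ := √E
  have hS0 : 0 < S := Real.sqrt_pos.2 hE0
  have hSE : S ^ 2 = E := Real.sq_sqrt hE0.le
  set A : ℝ := ‖ofDeriv₂ (T := T) hT‖ + ‖ofDeriv₁ (T := T) hT‖ * K + 1
  have hA2 : ‖ofDeriv₂ (T := T) hT‖ ≤ A := by
    have : 0 ≤ ‖ofDeriv₁ (T := T) hT‖ * K := by positivity
    linarith
  have hA1 : ‖ofDeriv₁ (T := T) hT‖ * K ≤ A := by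
    have := norm_nonneg (ofDeriv₂ (T := T) hT)
    linarith
  have hA0 : 0 < A := by positivity
  -- N bounds the passage from m₀ to its second derivative and S = √exp(C₀L) the growth in x, so
  -- S‖h₀‖ ≤ R; A converts bounds on h into bounds on m and ∂ₓm.
  refine ⟨R / (S * (N + 1)), A * (S * (N + 1)), by positivity, by positivity,
    fun m₀ h0 h1 hm₀ => ?_⟩
  set h₀ : Pair T := toPair (wderiv m₀ 2)
  have hh₀ : S * ‖h₀‖ ≤ S * (N + 1) * ‖m₀‖ := by
    rw [mul_assoc]
    refine mul_le_mul_of_nonneg_left ?_ hS0.le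
    refine (toPair.le_opNorm _).trans ?_
    exact mul_le_mul (by linarith) (norm_wderiv_le _ _) (norm_nonneg _) (by linarith)
  have hh₀R : S * ‖h₀‖ ≤ R := by
    refine hh₀.trans ?_
    rwa [le_div_iff₀ (by positivity), mul_comm] at hm₀
  obtain ⟨h, hh0, hcont, hbd, hhR, hder⟩ := hC₀ h₀ (by
    rw [← hSE, ← mul_pow]
    exact pow_le_pow_left₀ (by positivity) hh₀R 2)
  have hbd' : ∀ x ∈ Icc 0 d.L, ‖h x‖ ≤ S * (N + 1) * ‖m₀‖ := fun x hx => by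
    refine le_trans ((sq_le_sq₀ (norm_nonneg _) (by positivity)).1 ?_) hh₀
    rw [mul_pow, hSE]
    exact hbd x hx
  have hder' : ∀ x ∈ Icc 0 d.L, HasDerivWithinAt (fun y => toH1 (ofDeriv₂ hT (h y)))
      (ofDeriv₁ hT (c.dyPair (h x, h x))) (Icc 0 d.L) x := fun x hx => by
    simp only [toH1_ofDeriv₂]
    exact (ofDeriv₁ hT).hasFDerivAt.comp_hasDerivWithinAt x (hder x hx)
  have hderiv : ∀ x ∈ Icc 0 d.L, derivWithin (fun y => toH1 (ofDeriv₂ hT (h y))) (Icc 0 d.L) x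
      = ofDeriv₁ hT (c.dyPair (h x, h x)) := fun x hx =>
    (hder' x hx).derivWithin (uniqueDiffOn_Icc hd.L_pos x hx)
  have hrep : ∀ x, IsContRep (wderiv (ofDeriv₂ hT (h x)) 0)
      fun t => WithLp.toLp 2 fun i => Coeffs.m (h x, h x) i t := fun x =>
    isContRep_ofPair fun i => rfl
  refine ⟨fun x => ofDeriv₂ hT (h x), ⟨?_, ?_, ?_, ?_, ?_, ?_⟩, fun x hx => ⟨?_, ?_⟩⟩
  · exact (ofDeriv₂ hT).continuous.comp_continuousOn hcont
  · refine (contDiffOn_one_iff_derivWithin (uniqueDiffOn_Icc hd.L_pos)).2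
      ⟨fun x hx => (hder' x hx).differentiableWithinAt, ?_⟩
    refine ContinuousOn.congr ((ofDeriv₁ hT).continuous.comp_continuousOn ?_) hderiv
    exact (c.continuousOn_dyPair R).comp (hcont.prodMk hcont) fun x hx => ⟨hhR x hx, hhR x hx⟩
  · exact fun x hx => ⟨_, hrep x, fun t ht i => speed_ofDeriv_ne_zero hd hT hR (hhR x hx) ht i⟩
  · intro x hx
    rw [hderiv x hx]
    exact system_ofDeriv hd hT hR (hhR x hx)
  · simp only [hh0]
    exact ofDeriv₂_toPair hT h0 h1
  · exact fun x hx => ⟨_, hrep x, PiLp.ext fun i => Coeffs.m_zero (h x, h x) i⟩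
  · rw [mul_assoc]
    refine ((ofDeriv₂ hT).le_opNorm _).trans ?_
    exact mul_le_mul hA2 (hbd' x hx) (norm_nonneg _) hA0.le
  · rw [hderiv x hx, mul_assoc]
    refine ((ofDeriv₁ hT).le_opNorm _).trans ?_
    refine (mul_le_mul_of_nonneg_left (hdy (h x) (hhR x hx)) (norm_nonneg (ofDeriv₁ hT))).trans ?_
    rw [← mul_assoc]
    exact mul_le_mul hA1 (hbd' x hx) (norm_nonneg _) hA0.le

end Duct

end SupersonicDuct

namespace SupersonicDuct

variable {T : ℝ}

/-! ### A priori properties of an arbitrary solution -/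

theorem norm_emb_one_pos (hT : 0 < T) : 0 < ‖emb T 1‖ := by
  refine norm_pos_iff.2 fun h => ?_
  have h1 : (fun _ => (1 : ℝ)) =ᵐ[timeMeasure T] fun _ => (0 : ℝ) := by
    have h2 := coeFn_emb (T := T) 1
    rw [h] at h2
    filter_upwards [h2, Lp.coeFn_zero ℝ 2 (timeMeasure T)] with t h3 h4
    rw [← Pi.zero_apply (M := fun _ => ℝ) t, ← h4, h3]
    rfl
  exact one_ne_zero (eqOn_of_ae_eq hT continuousOn_const continuousOn_const h1
    (⟨le_rfl, hT.le⟩ : (0 : ℝ) ∈ Icc 0 T))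

/-- The Sobolev embedding of `H¹(0, T)` in the continuous functions. -/
theorem exists_sobolev_bound (hT : 0 < T) : ∃ B, 0 ≤ B ∧ ∀ f g : L2 T, IsWeakDeriv f g → ∀ i,
    ∃ F : BC, comp i f = emb T F ∧ ‖F‖ ≤ B * (‖f‖ + ‖g‖) := by
  set e := ‖emb T 1‖
  have he : 0 < e := norm_emb_one_pos hT
  set N := ‖(comp 0 : L2 T →L[ℝ] ScalarL2 T)‖ + ‖(comp 1 : L2 T →L[ℝ] ScalarL2 T)‖
  have hN : ∀ (i : Fin 2) (f : L2 T), ‖comp i f‖ ≤ N * ‖f‖ := fun i f => by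
    refine ((comp i).le_opNorm f).trans (mul_le_mul_of_nonneg_right ?_ (norm_nonneg _))
    fin_cases i
    · exact le_add_of_nonneg_right (norm_nonneg _)
    · exact le_add_of_nonneg_left (norm_nonneg _)
  have hN0 : 0 ≤ N := by positivity
  set V := ‖volterra T‖
  set W := ‖(prim : ScalarL2 T →L[ℝ] BC)‖
  have hV : 0 ≤ V := norm_nonneg _
  have hW : 0 ≤ W := norm_nonneg (prim : ScalarL2 T →L[ℝ] BC)
  refine ⟨e⁻¹ * (N + V * N) + W * N, by positivity, fun f g h i => ?_⟩
  obtain ⟨c, hc⟩ := h.exists_comp_eq hT i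
  refine ⟨c • 1 + prim (comp i g), ?_, ?_⟩
  · rw [hc, map_add, map_smul]
    rfl
  have hf := norm_nonneg f
  have hg := norm_nonneg g
  have h1 : |c| * e ≤ N * ‖f‖ + V * (N * ‖g‖) := by
    rw [← Real.norm_eq_abs, ← norm_smul, eq_sub_of_add_eq hc.symm]
    refine (norm_sub_le _ _).trans (add_le_add (hN i f) ?_)
    exact ((volterra T).le_opNorm _).trans (mul_le_mul_of_nonneg_left (hN i g) hV)
  have h2 : |c| ≤ e⁻¹ * (N * ‖f‖ + V * (N * ‖g‖)) := by
    rwa [inv_mul_eq_div, le_div_iff₀ he]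
  have h3 : ‖(c • 1 : BC)‖ ≤ |c| := by
    rw [norm_smul, Real.norm_eq_abs]
    exact mul_le_of_le_one_right (abs_nonneg _) (by simp)
  have h4 : ‖prim (comp i g)‖ ≤ W * (N * ‖g‖) :=
    (prim.le_opNorm _).trans (mul_le_mul_of_nonneg_left (hN i g) hW)
  have h5 : e⁻¹ * (N * ‖f‖ + V * (N * ‖g‖)) ≤ e⁻¹ * ((N + V * N) * (‖f‖ + ‖g‖)) := by
    refine mul_le_mul_of_nonneg_left ?_ (inv_nonneg.2 he.le)
    have : 0 ≤ N * ‖g‖ + V * N * ‖f‖ := by positivity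
    linarith
  have h6 : W * (N * ‖g‖) ≤ W * N * (‖f‖ + ‖g‖) := by
    have : 0 ≤ W * N * ‖f‖ := by positivity
    linarith
  refine (norm_add_le _ _).trans ?_
  linarith

/-- The continuous representative of the `i`-th component of `f`, if `f` vanishes at `0`. -/
noncomputable def rep (f : Sobolev 2 T) (i : Fin 2) : BC := prim (comp i (wderiv f 1))

theorem rep_zero (f : Sobolev 2 T) (i : Fin 2) : rep f i 0 = 0 := prim_zero_apply _

/-- The `i`-th derivative as a continuous linear map. -/
noncomputable def wderivL (k : ℕ) (T : ℝ) (i : Fin (k + 1)) : Sobolev k T →L[ℝ] L2 T :=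
  (PiLp.proj 2 (𝕜 := ℝ) (fun _ : Fin (k + 1) => L2 T) i).comp (Sobolev k T).subtypeL

theorem comp_wderiv_zero (hT : 0 < T) {f : Sobolev 2 T} (h : VanishesAtZero (wderiv f 0))
    (i : Fin 2) : comp i (wderiv f 0) = emb T (rep f i) := by
  have h1 : IsWeakDeriv (wderiv f 0) (wderiv f 1) := f.2 0
  exact h1.comp_eq hT h i

namespace Coeffs

/-- The speeds associated with `f`. -/
noncomputable def speedOf (c : Coeffs T) (f : Sobolev 2 T) (i : Fin 2) : BC :=
  c.μ i + ∑ j, c.ℓ i j • rep f j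

theorem speedOf_apply (c : Coeffs T) (f : Sobolev 2 T) (i : Fin 2) (t : ℝ) :
    c.speedOf f i t = c.μ i t + ∑ j, c.ℓ i j * rep f j t := by
  simp [speedOf, Fin.sum_univ_two]

end Coeffs

namespace Duct

variable {d : Duct}

namespace IsSolution

variable {m₀ : Sobolev 2 T} {m : ℝ → Sobolev 2 T}

/-- At t = 0 the perturbation vanishes and the speed is that of the background; being continuous in
t and never zero, it stays positive by the intermediate value theorem. -/
theorem speedOf_pos (hd : d.Admissible) (hT : 0 < T) (hm : d.IsSolution m₀ m) {x : ℝ}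
    (hx : x ∈ Icc 0 d.L) (i : Fin 2) {t : ℝ} (ht : t ∈ Icc 0 T) :
    0 < (coeffs hd hT).speedOf (m x) i t := by
  have h0 : ∀ s ∈ Icc 0 T, (coeffs hd hT).speedOf (m x) i s ≠ 0 := by
    obtain ⟨g, hg, hg0⟩ := hm.speed_ne_zero x hx
    intro s hs
    have h1 : ∀ j, g s j = rep (m x) j s := fun j =>
      hg.eqOn hT (comp_wderiv_zero hT (hm.initial x hx) j) hs
    have h2 := hg0 s hs i
    rw [speed_eq hd hT hs] at h2
    rw [Coeffs.speedOf_apply]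
    simpa only [h1] using h2
  have h00 : (0 : ℝ) ∈ Icc 0 T := ⟨le_rfl, hT.le⟩
  have h1 : 0 < (coeffs hd hT).speedOf (m x) i 0 := by
    have h2 := (coeffs hd hT).μ_ge i 0 h00
    have h3 := (coeffs hd hT).κ_pos
    simp only [Coeffs.speedOf_apply, rep_zero, mul_zero, Finset.sum_const_zero, add_zero]
    linarith
  by_contra! h
  obtain ⟨s, hs, hs0⟩ := intermediate_value_Icc' ht.1
    ((coeffs hd hT).speedOf (m x) i).continuous.continuousOn ⟨h, h1.le⟩
  exact h0 s ⟨hs.1, hs.2.trans ht.2⟩ hs0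

/-- The speeds are jointly continuous on the compact rectangle [0, L] × [0, T] and attain a positive
minimum, which depends on the solution. -/
theorem exists_le_speedOf (hd : d.Admissible) (hT : 0 < T) (hm : d.IsSolution m₀ m) :
    ∃ κ, 0 < κ ∧ ∀ x ∈ Icc 0 d.L, ∀ i, ∀ t ∈ Icc 0 T,
      κ ≤ (coeffs hd hT).speedOf (m x) i t := by
  have key : ∀ i, ∃ κ, 0 < κ ∧ ∀ x ∈ Icc 0 d.L, ∀ t ∈ Icc 0 T,
      κ ≤ (coeffs hd hT).speedOf (m x) i t := by
    intro i
    have hr : ∀ j, ContinuousOn (fun x => rep (m x) j) (Icc 0 d.L) := fun j =>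
      ((prim.comp (comp j)).comp (wderivL 2 T 1)).continuous.comp_continuousOn hm.continuousOn
    have hs : ContinuousOn (fun x => (coeffs hd hT).speedOf (m x) i) (Icc 0 d.L) :=
      continuousOn_const.add (continuousOn_finsetSum _ fun j _ => (continuous_const_smul _).comp_continuousOn (hr j))
    have hc : ContinuousOn (fun z : ℝ × ℝ => (coeffs hd hT).speedOf (m z.1) i z.2)
        (Icc 0 d.L ×ˢ Icc 0 T) :=
      continuous_eval.comp_continuousOn
        ((hs.comp continuousOn_fst fun z hz => hz.1).prodMk continuousOn_snd)
    obtain ⟨z, hz, hmin⟩ := (isCompact_Icc.prod isCompact_Icc).exists_isMinOn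
      (⟨(0, 0), ⟨le_rfl, hd.L_pos.le⟩, ⟨le_rfl, hT.le⟩⟩ :
        (Icc 0 d.L ×ˢ Icc 0 T).Nonempty) hc
    refine ⟨(coeffs hd hT).speedOf (m z.1) i z.2, hm.speedOf_pos hd hT hz.1 i hz.2,
      fun x hx t ht => ?_⟩
    exact isMinOn_iff.1 hmin (x, t) ⟨hx, ht⟩
  choose κ hκ hle using key
  refine ⟨min (κ 0) (κ 1), lt_min (hκ 0) (hκ 1), fun x hx i t ht => ?_⟩
  refine le_trans ?_ (hle i x hx t ht)
  fin_cases i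
  · exact min_le_left _ _
  · exact min_le_right _ _

theorem hasDerivWithinAt_toPair (hm : d.IsSolution m₀ m) {x : ℝ} (hx : x ∈ Icc 0 d.L) :
    HasDerivWithinAt (fun y => toPair (wderiv (m y) 0))
      (toPair (wderiv (derivWithin (fun y => toH1 (m y)) (Icc 0 d.L) x) 0)) (Icc 0 d.L) x :=
  (toPair.comp (wderivL 1 T 0)).hasFDerivAt.comp_hasDerivWithinAt x
    ((hm.contDiffOn.differentiableOn one_ne_zero) x hx).hasDerivWithinAt

theorem comp_derivWithin (hd : d.Admissible) (hT : 0 < T) (hm : d.IsSolution m₀ m) {x : ℝ}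
    (hx : x ∈ Icc 0 d.L) {κ : ℝ} (hκ : 0 < κ)
    (hle : ∀ i, ∀ t ∈ Icc 0 T, κ ≤ (coeffs hd hT).speedOf (m x) i t) (i : Fin 2) :
    comp i (wderiv (derivWithin (fun y => toH1 (m y)) (Icc 0 d.L) x) 0)
      = recip hκ ((coeffs hd hT).speedOf (m x) i) • (emb T ((coeffs hd hT).β * ∑ j, rep (m x) j)
        - comp i (wderiv (m x) 1)) := by
  set c := coeffs hd hT with hc
  have hF : ∀ᵐ t ∂(timeMeasure T), ∀ j, wderiv (m x) 0 t j = rep (m x) j t := by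
    refine ae_all_iff.2 fun j => ?_
    have h1 := coeFn_comp j (wderiv (m x) 0)
    rw [comp_wderiv_zero hT (hm.initial x hx)] at h1
    filter_upwards [h1, coeFn_emb (T := T) (rep (m x) j)] with t h2 h3
    rw [← h2, h3]
  apply Lp.ext
  filter_upwards [hF, hm.equation x hx, ae_restrict_mem measurableSet_Ioo,
    coeFn_comp i (wderiv (derivWithin (fun y => toH1 (m y)) (Icc 0 d.L) x) 0),
    coeFn_comp i (wderiv (m x) 1), coeFn_emb (T := T) (c.β * ∑ j, rep (m x) j),
    coeFn_bc_smul (recip hκ (c.speedOf (m x) i)) (emb T (c.β * ∑ j, rep (m x) j)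
        - comp i (wderiv (m x) 1)),
    Lp.coeFn_sub (emb T (c.β * ∑ j, rep (m x) j)) (comp i (wderiv (m x) 1))]
    with t h1 h2 ht h3 h4 h5 h6 h7
  have ht' : t ∈ Icc 0 T := ⟨ht.1.le, ht.2.le⟩
  have h8 := (system_iff t _ _ _).1 h2 i
  have h9 : d.speed t (wderiv (m x) 0 t) i = c.speedOf (m x) i t := by
    rw [speed_eq hd hT ht', c.speedOf_apply]
    simp only [h1, hc]
  have h10 := hle i t ht'
  have h11 : recip hκ (c.speedOf (m x) i) t = 1 / c.speedOf (m x) i t :=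
    eq_one_div_of_mul_eq_one_left (recip_mul_apply hκ h10)
  have hβ : c.β t = d.α t / 2 := clamp_apply hT.le _ ht'
  rw [h9, h1, h1] at h8
  rw [h6, h7, h3, Pi.sub_apply, h5, h4, h11, eq_sub_of_add_eq h8, ← hβ]
  simp only [BoundedContinuousFunction.coe_mul, Pi.mul_apply, Fin.sum_univ_two,
    BoundedContinuousFunction.coe_add, Pi.add_apply]
  ring

end IsSolution

end Duct

end SupersonicDuct

namespace SupersonicDuct

variable {T : ℝ}

namespace Duct

variable {d : Duct}

namespace IsSolution

variable {m₀ : Sobolev 2 T} {m m' : ℝ → Sobolev 2 T}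

/-! ### Uniqueness -/

theorem exists_rep_bound (hd : d.Admissible) (hT : 0 < T) (hm : d.IsSolution m₀ m) :
    ∃ B, 0 ≤ B ∧ ∀ x ∈ Icc 0 d.L, (∀ j, ‖rep (m x) j‖ ≤ B) ∧
      ∃ F : Fin 2 → BC, ∀ j, comp j (wderiv (m x) 1) = emb T (F j) ∧ ‖F j‖ ≤ B := by
  obtain ⟨M, hM⟩ := isCompact_Icc.exists_bound_of_continuousOn hm.continuousOn
  obtain ⟨B, hB, h⟩ := exists_sobolev_bound hT
  have hM0 : 0 ≤ M := (norm_nonneg _).trans (hM 0 ⟨le_rfl, hd.L_pos.le⟩)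
  set W : Fin 2 → ℝ := fun j =>
    ‖(prim.comp ((comp j).comp (wderivL 2 T 1)) : Sobolev 2 T →L[ℝ] BC)‖
  have hW : ∀ j, 0 ≤ W j := fun j =>
    norm_nonneg (prim.comp ((comp j).comp (wderivL 2 T 1)) : Sobolev 2 T →L[ℝ] BC)
  have hW0 := hW 0
  have hW1 := hW 1
  refine ⟨(W 0 + W 1) * M + B * (M + M), by positivity, fun x hx => ⟨fun j => ?_, ?_⟩⟩
  · have h1 : ‖rep (m x) j‖ ≤ W j * M :=
      ((prim.comp ((comp j).comp (wderivL 2 T 1))).le_opNorm (m x)).trans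
        (mul_le_mul_of_nonneg_left (hM x hx) (hW j))
    have h2 : W j ≤ W 0 + W 1 := by
      fin_cases j
      · exact le_add_of_nonneg_right hW1
      · exact le_add_of_nonneg_left hW0
    have h3 : 0 ≤ B * (M + M) := by positivity
    have h4 := mul_le_mul_of_nonneg_right h2 hM0
    linarith
  · have h1 : IsWeakDeriv (wderiv (m x) 1) (wderiv (m x) 2) := (m x).2 1
    choose F hF hFB using h _ _ h1
    refine ⟨F, fun j => ⟨hF j, (hFB j).trans ?_⟩⟩
    have h3 : 0 ≤ (W 0 + W 1) * M := by positivity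
    have h4 : B * (‖wderiv (m x) 1‖ + ‖wderiv (m x) 2‖) ≤ B * (M + M) :=
      mul_le_mul_of_nonneg_left (add_le_add ((norm_wderiv_le _ _).trans (hM x hx))
        ((norm_wderiv_le _ _).trans (hM x hx))) hB
    linarith

theorem norm_emb_speedOf_sub_le (c : Coeffs T) {f f' : Sobolev 2 T} {w : Pair T}
    (hw : ∀ j, w j = emb T (rep f j) - emb T (rep f' j)) (i : Fin 2) :
    ‖emb T (c.speedOf f i - c.speedOf f' i)‖ ≤ (∑ i, ∑ j, |c.ℓ i j|) * ‖w‖ := by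
  have h1 : emb T (c.speedOf f i - c.speedOf f' i) = ∑ j, c.ℓ i j • w j := by
    simp only [Coeffs.speedOf, add_sub_add_left_eq_sub, ← Finset.sum_sub_distrib, ← smul_sub,
      map_sum, map_smul, hw, map_sub]
  rw [h1]
  refine (norm_sum_le _ _).trans ?_
  refine le_trans ?_ (mul_le_mul_of_nonneg_right (Finset.single_le_sum
    (f := fun i => ∑ j, |c.ℓ i j|) (fun i _ => Finset.sum_nonneg fun j _ => abs_nonneg _)
    (Finset.mem_univ i)) (norm_nonneg _))
  rw [Finset.sum_mul]
  refine Finset.sum_le_sum fun j _ => ?_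
  rw [norm_smul, Real.norm_eq_abs]
  exact mul_le_mul_of_nonneg_left (norm_apply_le_pair w j) (abs_nonneg _)

/-- The energy inequality for the difference of two solutions. -/
theorem exists_inner_sub_le (hd : d.Admissible) (hT : 0 < T) (hm : d.IsSolution m₀ m)
    (hm' : d.IsSolution m₀ m') :
    ∃ K, 0 ≤ K ∧ ∀ x ∈ Icc 0 d.L,
      2 * inner ℝ
        (toPair (wderiv (derivWithin (fun y => toH1 (m y)) (Icc 0 d.L) x) 0)
          - toPair (wderiv (derivWithin (fun y => toH1 (m' y)) (Icc 0 d.L) x) 0))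
        (toPair (wderiv (m x) 0) - toPair (wderiv (m' x) 0))
      ≤ K * ‖toPair (wderiv (m x) 0) - toPair (wderiv (m' x) 0)‖ ^ 2 := by
  set c := coeffs hd hT
  obtain ⟨κ₁, hκ₁, hle₁⟩ := hm.exists_le_speedOf hd hT
  obtain ⟨κ₂, hκ₂, hle₂⟩ := hm'.exists_le_speedOf hd hT
  obtain ⟨κ, hκ, hle, hle'⟩ : ∃ κ, 0 < κ ∧
      (∀ x ∈ Icc 0 d.L, ∀ i, ∀ t ∈ Icc 0 T, κ ≤ c.speedOf (m x) i t) ∧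
      (∀ x ∈ Icc 0 d.L, ∀ i, ∀ t ∈ Icc 0 T, κ ≤ c.speedOf (m' x) i t) :=
    ⟨min κ₁ κ₂, lt_min hκ₁ hκ₂, fun x hx i t ht => (min_le_left _ _).trans (hle₁ x hx i t ht),
      fun x hx i t ht => (min_le_right _ _).trans (hle₂ x hx i t ht)⟩
  obtain ⟨B, hB, hrep⟩ := hm.exists_rep_bound hd hT
  obtain ⟨B', hB', hrep'⟩ := hm'.exists_rep_bound hd hT
  set Λ : ℝ := ∑ i, ∑ j, |c.ℓ i j| with hΛ
  have hΛ0 : 0 ≤ Λ := Finset.sum_nonneg fun i _ => Finset.sum_nonneg fun j _ => abs_nonneg _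
  have hΛi : ∀ i, ∑ j, |c.ℓ i j| ≤ Λ := fun i => Finset.single_le_sum
    (f := fun i => ∑ j, |c.ℓ i j|) (fun i _ => Finset.sum_nonneg fun j _ => abs_nonneg _)
    (Finset.mem_univ i)
  set D : ℝ := κ⁻¹ * κ⁻¹ * (‖c.μ' 0‖ + ‖c.μ' 1‖ + Λ * B)
  set S : ℝ := (‖c.β‖ * (B' + B') + B') * (κ⁻¹ * κ⁻¹ * Λ)
  have hκ' : 0 ≤ κ⁻¹ := (inv_pos.2 hκ).le
  have hD0 : 0 ≤ D := by positivity
  have hS0 : 0 ≤ S := by positivity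
  refine ⟨2 * (4 * κ⁻¹ * ‖c.β‖ + D + 2 * S), by positivity, fun x hx => ?_⟩
  set w := toPair (wderiv (m x) 0) - toPair (wderiv (m' x) 0) with hw
  have hwj : ∀ j, w j = emb T (rep (m x) j) - emb T (rep (m' x) j) := fun j => by
    rw [← comp_wderiv_zero hT (hm.initial x hx), ← comp_wderiv_zero hT (hm'.initial x hx)]
    rfl
  have key : ∀ i, 2 * inner ℝ
      (comp i (wderiv (derivWithin (fun y => toH1 (m y)) (Icc 0 d.L) x) 0)
        - comp i (wderiv (derivWithin (fun y => toH1 (m' y)) (Icc 0 d.L) x) 0)) (w i)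
      ≤ (4 * κ⁻¹ * ‖c.β‖ + D + 2 * S) * ‖w‖ ^ 2 := by
    intro i
    obtain ⟨F, hF⟩ := (hrep x hx).2
    obtain ⟨hr', F', hF'⟩ := hrep' x hx
    set a := recip hκ (c.speedOf (m x) i)
    set a' := recip hκ (c.speedOf (m' x) i)
    set q : BC := c.β * ∑ j, rep (m' x) j - F' i
    -- The same splitting of a q as for the approximations, now with the true time derivative and no
    -- consistency error.
    have hdiff : comp i (wderiv (derivWithin (fun y => toH1 (m y)) (Icc 0 d.L) x) 0)
        - comp i (wderiv (derivWithin (fun y => toH1 (m' y)) (Icc 0 d.L) x) 0)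
        = a • (c.β • ∑ j, w j - ((comp i (wderiv (m x) 1) - comp i (wderiv (m' x) 1)) + 0))
          + (a - a') • emb T q := by
      rw [hm.comp_derivWithin hd hT hx hκ (hle x hx), hm'.comp_derivWithin hd hT hx hκ (hle' x hx),
        map_sub, ← (hF' i).1, ← bc_smul_emb, ← bc_smul_emb]
      simp only [hwj, Finset.sum_sub_distrib, ← map_sum]
      module
    -- Both solutions vanish at t = 0, so the difference w is J of its time derivative and
    -- `inner_smul_volterra_ge` applies directly.
    have hv : volterra T (comp i (wderiv (m x) 1) - comp i (wderiv (m' x) 1)) = w i := by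
      rw [hwj, map_sub]
      rfl
    have hlam : IsPrim (c.speedOf (m x) i) (emb T (c.μ' i + ∑ j, c.ℓ i j • F j)) := by
      refine ((c.isPrim_μ i).add (.sum fun j _ => (isPrim_prim
        (comp j (wderiv (m x) 1))).smul (c.ℓ i j))).congr ?_
      simp only [map_add, map_sum, map_smul, (hF _).1]
    have hda : ‖-(a * a * (c.μ' i + ∑ j, c.ℓ i j • F j))‖ ≤ D := by
      rw [norm_neg]
      refine (norm_mul_le _ _).trans (mul_le_mul ((norm_mul_le _ _).trans
        (mul_le_mul (norm_recip_le _ _) (norm_recip_le _ _) (norm_nonneg _) hκ')) ?_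
        (norm_nonneg _) (by positivity))
      refine (norm_add_le _ _).trans (add_le_add ?_ ?_)
      · fin_cases i
        · exact le_add_of_nonneg_right (norm_nonneg _)
        · exact le_add_of_nonneg_left (norm_nonneg _)
      · refine (norm_sum_le _ _).trans (le_trans ?_ (mul_le_mul_of_nonneg_right (hΛi i) hB))
        rw [Finset.sum_mul]
        refine Finset.sum_le_sum fun j _ => ?_
        rw [norm_smul, Real.norm_eq_abs]
        exact mul_le_mul_of_nonneg_left (hF j).2 (abs_nonneg _)
    have h1 : -(D * ‖w‖ ^ 2) ≤ 2 * inner ℝ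
        (a • (comp i (wderiv (m x) 1) - comp i (wderiv (m' x) 1))) (w i) := by
      have h2 := inner_smul_volterra_ge hT (hlam.recip hκ (hle x hx i))
        (fun t _ => recip_nonneg hκ _ t) (comp i (wderiv (m x) 1) - comp i (wderiv (m' x) 1))
      rw [hv] at h2
      refine le_trans (neg_le_neg ?_) h2
      exact mul_le_mul hda (pow_le_pow_left₀ (norm_nonneg _) (norm_apply_le_pair w i) 2)
        (by positivity) hD0
    have hq : ‖q‖ ≤ ‖c.β‖ * (B' + B') + B' := by
      refine (norm_sub_le _ _).trans (add_le_add ?_ (hF' i).2)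
      refine (norm_mul_le _ _).trans (mul_le_mul_of_nonneg_left ?_ (norm_nonneg _))
      rw [Fin.sum_univ_two]
      exact (norm_add_le _ _).trans (add_le_add (hr' 0) (hr' 1))
    have hs : ‖(a - a') • emb T q‖ ≤ S * ‖w‖ := by
      rw [bc_smul_emb, mul_comm, ← bc_smul_emb, mul_assoc]
      refine (norm_bc_smul_le _ _).trans (mul_le_mul hq ?_ (norm_nonneg _) (by positivity))
      rw [mul_assoc]
      refine (norm_emb_le_of_abs_le (g := c.speedOf (m x) i - c.speedOf (m' x) i)
        fun t => abs_recip_sub_recip_le hκ _ _ t).trans ?_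
      exact mul_le_mul_of_nonneg_left (norm_emb_speedOf_sub_le c hwj i) (by positivity)
    rw [hdiff]
    have h3 := inner_difference_le (β := c.β) (r := 0) (norm_recip_le hκ _) h1 hs
    simpa using h3
  rw [inner_pair, Fin.sum_univ_two]
  have h0 := key 0
  have h1 := key 1
  simp only [PiLp.sub_apply, toPair_apply] at h0 h1 ⊢
  linarith

theorem eqOn (hd : d.Admissible) (hT : 0 < T) (hm : d.IsSolution m₀ m)
    (hm' : d.IsSolution m₀ m') : EqOn m m' (Icc 0 d.L) := by
  intro x hx
  obtain ⟨K, hK, h⟩ := hm.exists_inner_sub_le hd hT hm'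
  have h1 := norm_sq_le_of_inner_deriv_le hK le_rfl
    (fun y hy => (hm.hasDerivWithinAt_toPair hy).sub (hm'.hasDerivWithinAt_toPair hy))
    (fun y hy => by simpa using h y hy) x hx
  simp only [Pi.sub_apply, hm.boundary, hm'.boundary, sub_self, norm_zero, zero_mul, add_zero,
    ne_eq, OfNat.ofNat_ne_zero, not_false_eq_true, zero_pow, mul_zero] at h1
  refine sobolev_ext (toPair_injective (sub_eq_zero.1 (norm_eq_zero.1 ?_)))
  exact pow_eq_zero_iff two_ne_zero |>.1 (le_antisymm h1 (sq_nonneg _))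

end IsSolution

end Duct

/-! ### Conclusion -/

theorem iSup_enorm_le {E : Type*} [SeminormedAddGroup E] {s : Set ℝ} {f : ℝ → E} {C : ℝ}
    (h : ∀ x ∈ s, ‖f x‖ ≤ C) : ⨆ x ∈ s, ‖f x‖ₑ ≤ ENNReal.ofReal C :=
  iSup₂_le fun x hx => by
    rw [← ofReal_norm]
    exact ENNReal.ofReal_le_ofReal (h x hx)

end SupersonicDuct

theorem theorem4p2 (d : SupersonicDuct.Duct) (hd : d.Admissible) (T₀ : ℝ) (hT₀ : 0 < T₀) :
    ∃ ε₁ C₁ T₁ : ℝ, 0 < ε₁ ∧ 0 < C₁ ∧ T₀ < T₁ ∧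
      ∀ ε : ℝ, 0 < ε → ε < ε₁ →
      ∀ m₀ : SupersonicDuct.Sobolev 2 T₁,
        SupersonicDuct.VanishesAtZero (SupersonicDuct.wderiv m₀ 0) →
        SupersonicDuct.VanishesAtZero (SupersonicDuct.wderiv m₀ 1) →
        ‖m₀‖ ≤ ε →
        ∃ m : ℝ → SupersonicDuct.Sobolev 2 T₁,
          d.IsSolution m₀ m ∧
          (⨆ x ∈ Set.Icc 0 d.L, ‖m x‖ₑ)
            + (⨆ x ∈ Set.Icc 0 d.L,
                ‖derivWithin (fun y => SupersonicDuct.toH1 (m y)) (Set.Icc 0 d.L) x‖ₑ)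
            ≤ ENNReal.ofReal (C₁ * ε) ∧
          ∀ m' : ℝ → SupersonicDuct.Sobolev 2 T₁, d.IsSolution m₀ m' →
            ∀ x ∈ Set.Icc 0 d.L, m' x = m x := by
  have hT : 0 < T₀ + 1 := by linarith
  obtain ⟨ε₀, C, hε₀, hC, h⟩ := SupersonicDuct.Duct.exists_isSolution hd hT
  -- Existence and uniqueness hold on any interval, so T₁ = T₀ + 1 is one choice; each of the two
  -- suprema contributes one C.
  refine ⟨ε₀, C + C, T₀ + 1, hε₀, by positivity, by linarith, fun ε hε hεε₀ m₀ h0 h1 hm₀ => ?_⟩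
  obtain ⟨m, hm, hbd⟩ := h m₀ h0 h1 (hm₀.trans hεε₀.le)
  have hCε : C * ‖m₀‖ ≤ C * ε := mul_le_mul_of_nonneg_left hm₀ hC.le
  refine ⟨m, hm, ?_, fun m' hm' x hx => hm'.eqOn hd hT hm hx⟩
  rw [add_mul, ENNReal.ofReal_add (by positivity) (by positivity)]
  exact add_le_add (SupersonicDuct.iSup_enorm_le fun x hx => (hbd x hx).1.trans hCε)
    (SupersonicDuct.iSup_enorm_le fun x hx => (hbd x hx).2.trans hCε)
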